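/- For $\delta>0$ let $w_\delta(x)=(1+|x|)^{-\delta}$ on $\mathbb{R}^3$ and $L^r_{w_\delta}=L^r(\mathbb{R}^3,w_\delta\,dx)$; $|\cdot|$ denotes the Euclidean norm of vectors and tensors. Let $0<\gamma\le 2$. Then there exists a constant $C_\gamma\ge 1$, depending only on $\gamma$, with the following property. Let $0<T<+\infty$, let $\mathbf{u}_0\in L^2_{w_\gamma}$ be a divergence-free vector field on $\mathbb{R}^3$, let $\mathbb{F}=(F_{i,j})_{1\le i,j\le 3}$ be a tensor field with $\mathbb{F}\in L^2((0,T),L^2_{w_\gamma})$, and let $\mathbf{b}\in L^3((0,T),L^3_{w_{3\gamma/2}})$ be a time-dependent vector field with $\nabla\cdot\mathbf{b}=0$. Let $\mathbf{u}$ be a solution, in the sense of distributions on $(0,T)\times\mathbb{R}^3$, of $$\partial_t\mathbf{u}=\Delta\mathbf{u}-(\mathbf{b}\cdot\nabla)\mathbf{u}-\nabla p+\nabla\cdot\mathbb{F},\qquad \nabla\cdot\mathbf{u}=0,\qquad \mathbf{u}(0,\cdot)=\mathbf{u}_0,$$ where $(\nabla\cdot\mathbb{F})_j=\sum_i\partial_iF_{i,j}$,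 such that: - $\mathbf{u}\in L^\infty((0,T),L^2_{w_\gamma})$ and $\nabla\mathbf{u}\in L^2((0,T),L^2_{w_\gamma})$; - $p=\sum_{i,j=1}^3R_iR_j(b_iu_j-F_{i,j})$, where $R_i=\partial_i/\sqrt{-\Delta}$ are the Riesz transforms, $\sum_{i,j}R_iR_j(b_iu_j)\in L^3((0,T),L^{6/5}_{w_{6\gamma/5}})$ and $\sum_{i,j}R_iR_jF_{i,j}\in L^2((0,T),L^2_{w_\gamma})$; - $t\mapsto\mathbf{u}(t,\cdot)$ is weakly continuous from $[0,T)$ to $L^2_{w_\gamma}$, and $\lim_{t\to0^+}\|\mathbf{u}(t,\cdot)-\mathbf{u}_0\|_{L^2_{w_\gamma}}=0$; - there is a non-negative locally finite measure $\mu$ on $(0,T)\times\mathbb{R}^3$ such that, in the sense of distributions on $(0,T)\times\mathbb{R}^3$, $$\partial_t\Big(\frac{|\mathbf{u}|^2}{2}\Big)=\Delta\Big(\frac{|\mathbf{u}|^2}{2}\Big)-|\nabla\mathbf{u}|^2-\nabla\cdot\Big(\frac{|\mathbf{u}|^2}{2}\mathbf{b}\Big)-\nabla\cdot(p\mathbf{u})+\mathbf{u}\cdot(\nabla\cdot\mathbb{F})-\mu,$$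 where $\mathbf{u}\cdot(\nabla\cdot\mathbb{F})=\sum_{i,j}\big(\partial_i(F_{i,j}u_j)-F_{i,j}\partial_iu_j\big)$. Assume moreover that, for some constant $C_0\ge 0$ and almost every $t\in(0,T)$, $$\|\mathbf{b}(t,\cdot)\|_{L^3_{w_{3\gamma/2}}}\le C_0\|\mathbf{u}(t,\cdot)\|_{L^3_{w_{3\gamma/2}}}.$$ If $0<T_0<T$ is such that $$C_\gamma(1+C_0^4)\Big(1+C_0^4+\|\mathbf{u}_0\|_{L^2_{w_\gamma}}^2+\int_0^{T_0}\|\mathbb{F}(s,\cdot)\|_{L^2_{w_\gamma}}^2\,ds\Big)^2T_0\le1,$$ then $$\sup_{0\le t\le T_0}\|\mathbf{u}(t,\cdot)\|_{L^2_{w_\gamma}}^2\le C_\gamma\Big(1+C_0^4+\|\mathbf{u}_0\|_{L^2_{w_\gamma}}^2+\int_0^{T_0}\|\mathbb{F}(s,\cdot)\|_{L^2_{w_\gamma}}^2\,ds\Big)$$ and $$\int_0^{T_0}\|\nabla\mathbf{u}(s,\cdot)\|_{L^2_{w_\gamma}}^2\,ds\le C_\gamma\Big(1+C_0^4+\|\mathbf{u}_0\|_{L^2_{w_\gamma}}^2+\int_0^{T_0}\|\mathbb{F}(s,\cdot)\|_{L^2_{w_\gamma}}^2\,ds\Big).$$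 -/

import Mathlib

open MeasureTheory Set Filter Topology
open scoped ENNReal NNReal ContDiff FourierTransform

noncomputable section

namespace WeightedNS

/-- The physical space `ℝ³`, with its Euclidean norm. -/
abbrev E3 : Type := EuclideanSpace ℝ (Fin 3)

/-- `3 × 3` tensors, with the Euclidean (Frobenius) norm; the entry `(i, j)` of `A` is `A (i, j)`. -/
abbrev Tensor3 : Type := EuclideanSpace ℝ (Fin 3 × Fin 3)

/-- The weight `w_δ(x) = 1 / (1 + |x|)^δ`. -/
def weight (δ : ℝ) (x : E3) : ℝ := 1 / (1 + ‖x‖) ^ δ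

/-- The measure `w_δ(x) dx` on `ℝ³`; thus `L^r_{w_δ} = L^r(w_δ dx)`. -/
def wMeasure (δ : ℝ) : Measure E3 :=
  volume.withDensity fun x => ENNReal.ofReal (weight δ x)

/-- Lebesgue measure on the slab `(0,T) × ℝ³`. -/
def slab (T : ℝ) : Measure (ℝ × E3) := (volume.restrict (Ioo 0 T)).prod volume

/-- `f ∈ L^q((0,T), L^r_{w_δ})`, for a function `f(t,x)` of time and space. -/
def MemLtLx {V : Type*} [NormedAddCommGroup V] (T : ℝ) (q r : ℝ≥0∞) (δ : ℝ)
    (f : ℝ → E3 → V) : Prop :=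
  AEStronglyMeasurable (fun z : ℝ × E3 => f z.1 z.2) (slab T) ∧
    eLpNorm (fun t => eLpNorm (f t) r (wMeasure δ)) q (volume.restrict (Ioo 0 T)) < ⊤

/-! ### Test functions and distributional derivatives -/

/-- `φ ∈ 𝒟(ℝ³)`. -/
def IsTest (φ : E3 → ℝ) : Prop := ContDiff ℝ ∞ φ ∧ HasCompactSupport φ

/-- `φ ∈ 𝒟((0,T) × ℝ³)`. -/
def IsSlabTest (T : ℝ) (φ : ℝ × E3 → ℝ) : Prop :=
  ContDiff ℝ ∞ φ ∧ HasCompactSupport φ ∧ tsupport φ ⊆ Ioo 0 T ×ˢ univ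

/-- Time derivative of a (smooth) function on `ℝ × ℝ³`. -/
def dt (φ : ℝ × E3 → ℝ) (z : ℝ × E3) : ℝ := fderiv ℝ φ z (1, 0)

/-- Partial derivative `∂_i` in space of a (smooth) function on `ℝ × ℝ³`. -/
def dx (i : Fin 3) (φ : ℝ × E3 → ℝ) (z : ℝ × E3) : ℝ :=
  fderiv ℝ φ z (0, EuclideanSpace.single i 1)

/-- Laplacian in space of a (smooth) function on `ℝ × ℝ³`. -/
def lapl (φ : ℝ × E3 → ℝ) (z : ℝ × E3) : ℝ := ∑ i, dx i (dx i φ) z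

/-- `∇ · v = 0` in `𝒟'(ℝ³)`. -/
def DivFree (v : E3 → E3) : Prop :=
  ∀ φ : E3 → ℝ, IsTest φ →
    ∫ x, ∑ i, v x i * fderiv ℝ φ x (EuclideanSpace.single i 1) = 0

/-- `∇ · v = 0` in `𝒟'((0,T) × ℝ³)`. -/
def SlabDivFree (T : ℝ) (v : ℝ → E3 → E3) : Prop :=
  ∀ φ : ℝ × E3 → ℝ, IsSlabTest T φ →
    ∫ z, ∑ i, v z.1 z.2 i * dx i φ z ∂(slab T) = 0

/-- `Du = ∇u` in `𝒟'((0,T) × ℝ³)`, the entry `(i, j)` of `Du` being `∂_i u_j`. -/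
def IsWeakGradient (T : ℝ) (u : ℝ → E3 → E3) (Du : ℝ → E3 → Tensor3) : Prop :=
  ∀ φ : ℝ × E3 → ℝ, IsSlabTest T φ → ∀ i j : Fin 3,
    ∫ z, u z.1 z.2 j * dx i φ z ∂(slab T) = - ∫ z, Du z.1 z.2 (i, j) * φ z ∂(slab T)

/-! ### Riesz transforms -/

/-- The symbol `√-1 ξ_i / |ξ|` of the Riesz transform `R_i = ∂_i / √(-Δ)`. -/
def rieszSymbol (i : Fin 3) (ξ : E3) : ℂ := Complex.I * (ξ i : ℂ) / (‖ξ‖ : ℂ)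

/-- `R_i R_j φ` for a real test function `φ`, as a Fourier multiplier (the result is real-valued). -/
def rieszRiesz (i j : Fin 3) (φ : E3 → ℝ) (x : E3) : ℝ :=
  (𝓕⁻ (fun ξ : E3 => rieszSymbol i ξ * rieszSymbol j ξ * 𝓕 (fun y : E3 => (φ y : ℂ)) ξ) x).re

/-- `g = R_i R_j f` in `L^r_{w_δ}`, where `R_i R_j` is the continuous extension to `L^r_{w_δ}`
(for `1 < r < ∞`, `0 < δ < 3`) of the operator `R_i R_j` on the dense subspace `𝒟(ℝ³)`. -/
def IsRieszRiesz (r : ℝ≥0∞) (δ : ℝ) (i j : Fin 3) (f g : E3 → ℝ) : Prop :=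
  MemLp f r (wMeasure δ) ∧ MemLp g r (wMeasure δ) ∧
    ∃ φ : ℕ → E3 → ℝ, (∀ n, IsTest (φ n)) ∧
      Tendsto (fun n => eLpNorm (fun x => φ n x - f x) r (wMeasure δ)) atTop (𝓝 0) ∧
      Tendsto (fun n => eLpNorm (fun x => rieszRiesz i j (φ n) x - g x) r (wMeasure δ))
        atTop (𝓝 0)

/-- The pressure is `p = ∑ᵢⱼ R_i R_j (b_i u_j - F_ij)`, with
`∑ᵢⱼ R_i R_j (b_i u_j) ∈ L³((0,T), L^{6/5}_{w_{6γ/5}})` and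
`∑ᵢⱼ R_i R_j F_ij ∈ L²((0,T), L²_{w_γ})`. -/
def IsPressure (γ T : ℝ) (F : ℝ → E3 → Tensor3) (b u : ℝ → E3 → E3) (p : ℝ → E3 → ℝ) : Prop :=
  ∃ P Q : Fin 3 → Fin 3 → ℝ → E3 → ℝ,
    (∀ i j, ∀ᵐ t ∂(volume.restrict (Ioo 0 T)),
      IsRieszRiesz (6 / 5) (6 * γ / 5) i j (fun x => b t x i * u t x j) (P i j t)) ∧
    (∀ i j, ∀ᵐ t ∂(volume.restrict (Ioo 0 T)),
      IsRieszRiesz 2 γ i j (fun x => F t x (i, j)) (Q i j t)) ∧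
    MemLtLx T 3 (6 / 5) (6 * γ / 5) (fun t x => ∑ i, ∑ j, P i j t x) ∧
    MemLtLx T 2 2 γ (fun t x => ∑ i, ∑ j, Q i j t x) ∧
    ∀ᵐ z ∂(slab T), p z.1 z.2 = ∑ i, ∑ j, (P i j z.1 z.2 - Q i j z.1 z.2)

/-! ### The advection-diffusion problem -/

/-- `∂_t u = Δu - (b·∇)u - ∇p + ∇·F` in `𝒟'((0,T) × ℝ³)`, where `Du = ∇u` and
`(∇·F)_j = ∑ᵢ ∂_i F_ij`. -/
def SolvesAD (T : ℝ) (F : ℝ → E3 → Tensor3) (b u : ℝ → E3 → E3) (Du : ℝ → E3 → Tensor3)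
    (p : ℝ → E3 → ℝ) : Prop :=
  ∀ φ : ℝ × E3 → ℝ, IsSlabTest T φ → ∀ j : Fin 3,
    - ∫ z, u z.1 z.2 j * dt φ z ∂(slab T) =
      ∫ z, (u z.1 z.2 j * lapl φ z
        - (∑ i, b z.1 z.2 i * Du z.1 z.2 (i, j)) * φ z
        + p z.1 z.2 * dx j φ z
        - ∑ i, F z.1 z.2 (i, j) * dx i φ z) ∂(slab T)

/-- The local energy balance
`∂_t(|u|²/2) = Δ(|u|²/2) - |∇u|² - ∇·((|u|²/2) b) - ∇·(p u) + u·(∇·F) - μ` in `𝒟'((0,T) × ℝ³)`,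
where `Du = ∇u` and `u·(∇·F) = ∑ᵢⱼ (∂_i (F_ij u_j) - F_ij ∂_i u_j)`. -/
def LocalEnergyBalance (T : ℝ) (F : ℝ → E3 → Tensor3) (b u : ℝ → E3 → E3)
    (Du : ℝ → E3 → Tensor3) (p : ℝ → E3 → ℝ) (μ : Measure (ℝ × E3)) : Prop :=
  ∀ φ : ℝ × E3 → ℝ, IsSlabTest T φ →
    - ∫ z, ‖u z.1 z.2‖ ^ 2 / 2 * dt φ z ∂(slab T) =
      ∫ z, (‖u z.1 z.2‖ ^ 2 / 2 * lapl φ z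
        - ‖Du z.1 z.2‖ ^ 2 * φ z
        + ‖u z.1 z.2‖ ^ 2 / 2 * (∑ i, b z.1 z.2 i * dx i φ z)
        + p z.1 z.2 * (∑ i, u z.1 z.2 i * dx i φ z)
        - (∑ i, ∑ j, F z.1 z.2 (i, j) * u z.1 z.2 j * dx i φ z)
        - (∑ i, ∑ j, F z.1 z.2 (i, j) * Du z.1 z.2 (i, j)) * φ z) ∂(slab T)
      - ∫ z, φ z ∂μ

/-- `u`, with gradient `Du` and pressure `p`, is a solution on `(0,T)` of the advection-diffusion
problem with divergence-free initial value `u₀`, forcing tensor `F` and drift `b`, in the weighted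
energy class, with the pressure given by Riesz transforms, weakly continuous in time, strongly
continuous at time `0` and obeying the local energy inequality. -/
structure IsADSolution (γ T : ℝ) (u₀ : E3 → E3) (F : ℝ → E3 → Tensor3) (b u : ℝ → E3 → E3)
    (Du : ℝ → E3 → Tensor3) (p : ℝ → E3 → ℝ) : Prop where
  u₀_mem : MemLp u₀ 2 (wMeasure γ)
  u₀_div : DivFree u₀
  F_mem : MemLtLx T 2 2 γ F
  b_mem : MemLtLx T 3 3 (3 * γ / 2) b
  b_div : SlabDivFree T b
  u_mem : MemLtLx T ∞ 2 γ u
  Du_grad : IsWeakGradient T u Du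
  Du_mem : MemLtLx T 2 2 γ Du
  pressure : IsPressure γ T F b u p
  equation : SolvesAD T F b u Du p
  u_div : SlabDivFree T u
  initial : u 0 =ᵐ[volume] u₀
  slice_mem : ∀ t ∈ Ico 0 T, MemLp (u t) 2 (wMeasure γ)
  weak_cont : ∀ ψ : E3 → E3, MemLp ψ 2 (wMeasure γ) →
    ContinuousOn (fun t => ∫ x, inner ℝ (u t x) (ψ x) ∂(wMeasure γ)) (Ico 0 T)
  strong_cont : Tendsto (fun t => eLpNorm (fun x => u t x - u₀ x) 2 (wMeasure γ)) (𝓝[>] 0) (𝓝 0)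
  energy : ∃ μ : Measure (ℝ × E3),
    (∀ K : Set (ℝ × E3), IsCompact K → K ⊆ Ioo 0 T ×ˢ univ → μ K < ⊤) ∧
    LocalEnergyBalance T F b u Du p μ

end WeightedNS

end

open scoped SchwartzMap Convolution

noncomputable section

namespace WeightedNS

/-! The proof is a weighted energy estimate. The local energy balance is tested with a time cutoff
times a cut-off version of the smooth weight `wt γ`, that is (1+|x|²)^(-γ/2), and the non-negative
measure is dropped. Write N, G, K for the weighted L² norms of u, ∇u and F, and H, M for the
weighted L³ norm of b and L⁶ norm of u. Because γ ≤ 2, the gradient of the weight w is O(w^(3/2)),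
and the drift term is at most a constant times H M N.

The pressure is the delicate term, since only its integral against u·∇w must be bounded, by
quantities that do not involve p. The operator R_i R_j is moved by symmetry onto w V, where V has
the size of w^(1/2) u, and is then commuted with w. The leading part needs nothing beyond the L²
contraction given by Plancherel, which applies because w b u lies in L² by Hölder with 1/3 + 1/6 =
1/2. The commutator is dominated by the kernel |w(x)-w(y)| |x-y|^(-3), which Schur's test bounds on
L^(6/5) × L⁶ (`exists_lintegral_commKernel_bilinear_le`). Thus no L^p theory of singular integrals
with p ≠ 2 enters; the kernel bound itself comes from a Littlewood–Paley decomposition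
(`exists_norm_truncKernel_le`). The outcome is `exists_energyFlux_le`.

Integrating in time, removing the cutoff by Fatou and sending the starting time to 0 gives the
global energy inequality (`exists_energy_inequality`). The hypothesis on b and interpolation give H²
≤ C C₀² N M, and Sobolev gives M ≤ C (N + G). Young's inequality then absorbs half of the
dissipation, leaving N(t)² + ½∫G² bounded by the data plus C∫(N² + C₀⁴ N⁶ + K²)
(`exists_energy_gronwall`). This is an integral inequality with cubic growth in N², closed by a
continuity argument on short times (`mul_integral_le_of_small`). The bounds hold at almost every
time and reach every time by weak lower semicontinuity. -/

/-! ### Littlewood–Paley decomposition of R_i R_j and its kernel bound. -/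

/-- The smooth cutoff used for the dyadic decomposition of frequencies. -/
def freqBump : ContDiffBump (0 : E3) := ⟨1, 2, one_pos, one_lt_two⟩

/-- The symbol of `R_i R_j`. -/
def rieszMult (i j : Fin 3) (ξ : E3) : ℂ := rieszSymbol i ξ * rieszSymbol j ξ

lemma rieszSymbol_smul {c : ℝ} (hc : 0 < c) (i : Fin 3) (ξ : E3) :
    rieszSymbol i (c • ξ) = rieszSymbol i ξ := by
  have : (c : ℂ) ≠ 0 := by exact_mod_cast hc.ne'
  simp only [rieszSymbol, norm_smul, Real.norm_eq_abs, abs_of_pos hc, PiLp.smul_apply, smul_eq_mul]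
  push_cast
  rw [show Complex.I * (c * (ξ i : ℂ)) = c * (Complex.I * (ξ i : ℂ)) by ring,
    mul_div_mul_left _ _ this]

lemma rieszMult_smul {c : ℝ} (hc : 0 < c) (i j : Fin 3) (ξ : E3) :
    rieszMult i j (c • ξ) = rieszMult i j ξ := by
  simp only [rieszMult, rieszSymbol_smul hc]

lemma norm_rieszSymbol_le (i : Fin 3) (ξ : E3) : ‖rieszSymbol i ξ‖ ≤ 1 := by
  simp only [rieszSymbol, norm_div, norm_mul, Complex.norm_I, one_mul, Complex.norm_real, norm_norm]
  exact div_le_one_of_le₀ (PiLp.norm_apply_le ξ i) (norm_nonneg _)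

lemma norm_rieszMult_le (i j : Fin 3) (ξ : E3) : ‖rieszMult i j ξ‖ ≤ 1 := by
  rw [rieszMult, norm_mul]
  exact mul_le_one₀ (norm_rieszSymbol_le i ξ) (norm_nonneg _) (norm_rieszSymbol_le j ξ)

lemma rieszMult_neg (i j : Fin 3) (ξ : E3) : rieszMult i j (-ξ) = rieszMult i j ξ := by
  simp only [rieszMult, rieszSymbol, norm_neg, PiLp.neg_apply]
  push_cast
  ring

lemma contDiffAt_rieszSymbol (i : Fin 3) {ξ : E3} (hξ : ξ ≠ 0) :
    ContDiffAt ℝ ∞ (rieszSymbol i) ξ := by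
  have h1 : ContDiffAt ℝ ∞ (fun x : E3 => ((x i : ℝ) : ℂ)) ξ :=
    (Complex.ofRealCLM.contDiff.comp
      (EuclideanSpace.proj i : E3 →L[ℝ] ℝ).contDiff).contDiffAt
  have h2 : ContDiffAt ℝ ∞ (fun x : E3 => ((‖x‖ : ℝ) : ℂ)) ξ :=
    Complex.ofRealCLM.contDiff.contDiffAt.comp ξ (contDiffAt_norm ℝ hξ)
  have h3 := (contDiffAt_const (c := Complex.I)).mul h1
  have h4 := ContDiffAt.inv (𝕜 := ℝ) (f := fun x : E3 => ((‖x‖ : ℝ) : ℂ)) h2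
    (by exact_mod_cast norm_ne_zero_iff.2 hξ)
  refine (h3.mul h4).congr_of_eventuallyEq (Eventually.of_forall fun x => ?_)
  simp only [rieszSymbol, div_eq_mul_inv]
  rfl

/-- The part of the symbol of `R_i R_j` between the frequency scales `1/c` and `1/d`. -/
def multPart (i j : Fin 3) (c d : ℝ) (ξ : E3) : ℂ :=
  rieszMult i j ξ * ((freqBump (c • ξ) - freqBump (d • ξ) : ℝ) : ℂ)

/-- The symbol is singular only at the origin, and there both bumps equal 1 on a neighbourhood, so
their difference kills the singularity. -/
lemma contDiff_multPart (i j : Fin 3) {c d : ℝ} :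
    ContDiff ℝ ∞ (multPart i j c d) := by
  rw [contDiff_iff_contDiffAt]
  intro ξ
  by_cases hξ : ξ = 0
  · subst hξ
    have h (c : ℝ) : ∀ᶠ x in 𝓝 (0 : E3), freqBump (c • x) = 1 := by
      have : Tendsto (fun x : E3 => c • x) (𝓝 0) (𝓝 0) := by
        have : Continuous (fun x : E3 => c • x) := by fun_prop
        simpa using this.tendsto 0
      filter_upwards [this (Metric.closedBall_mem_nhds (0 : E3) one_pos)] with x hx
      exact freqBump.one_of_mem_closedBall hx
    refine ContDiffAt.congr_of_eventuallyEq (f := fun _ => (0 : ℂ)) contDiffAt_const ?_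
    filter_upwards [h c, h d] with x h1 h2
    simp [multPart, h1, h2]
  · have h (c : ℝ) : ContDiff ℝ ∞ (fun x : E3 => freqBump (c • x)) :=
      freqBump.contDiff.comp (contDiff_const_smul c)
    exact ((contDiffAt_rieszSymbol i hξ).mul (contDiffAt_rieszSymbol j hξ)).mul
      (Complex.ofRealCLM.contDiff.contDiffAt.comp ξ ((h c).sub (h d)).contDiffAt)

lemma freqBump_smul_eq_zero {c : ℝ} (hc : 0 < c) {ξ : E3} (h : 2 / c ≤ ‖ξ‖) :
    freqBump (c • ξ) = 0 := by
  apply freqBump.zero_of_le_dist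
  rw [dist_zero_right, norm_smul, Real.norm_eq_abs, abs_of_pos hc]
  change 2 ≤ c * ‖ξ‖
  rw [div_le_iff₀ hc] at h
  linarith

lemma hasCompactSupport_multPart (i j : Fin 3) {c d : ℝ} (hc : 0 < c) (hd : 0 < d) :
    HasCompactSupport (multPart i j c d) := by
  apply HasCompactSupport.intro (isCompact_closedBall (0 : E3) (max (2 / c) (2 / d)))
  intro ξ hξ
  rw [Metric.mem_closedBall, dist_zero_right, not_le, max_lt_iff] at hξ
  simp [multPart, freqBump_smul_eq_zero hc hξ.1.le, freqBump_smul_eq_zero hd hξ.2.le]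

lemma norm_multPart_le (i j : Fin 3) (c d : ℝ) (ξ : E3) : ‖multPart i j c d ξ‖ ≤ 1 := by
  rw [multPart, norm_mul, Complex.norm_real]
  refine mul_le_one₀ (norm_rieszMult_le i j ξ) (norm_nonneg _) ?_
  rw [Real.norm_eq_abs, abs_le]
  constructor <;>
  linarith [freqBump.nonneg (x := c • ξ), freqBump.nonneg (x := d • ξ),
    freqBump.le_one (x := c • ξ), freqBump.le_one (x := d • ξ)]

/-- The Littlewood–Paley kernel of `R_i R_j` at unit scale. -/
def lpKernel (i j : Fin 3) : 𝓢(E3, ℂ) :=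
  𝓕⁻ ((hasCompactSupport_multPart i j (c := 1 / 2) (d := 1) (by norm_num) one_pos).toSchwartzMap
    (contDiff_multPart i j))

/-- The frequency truncation of the symbol of `R_i R_j`, as a Schwartz function. -/
def truncMult (i j : Fin 3) (N : ℕ) : 𝓢(E3, ℂ) :=
  (hasCompactSupport_multPart i j (c := 2 ^ (-(N : ℤ))) (d := 2 ^ (N : ℤ))
    (by positivity) (by positivity)).toSchwartzMap (contDiff_multPart i j)

/-- The kernel of the frequency truncation of `R_i R_j`. -/
def truncKernel (i j : Fin 3) (N : ℕ) : 𝓢(E3, ℂ) := 𝓕⁻ (truncMult i j N)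

lemma truncMult_apply (i j : Fin 3) (N : ℕ) (ξ : E3) :
    truncMult i j N ξ = multPart i j (2 ^ (-(N : ℤ))) (2 ^ (N : ℤ)) ξ := rfl

/-- Homogeneity of degree zero makes each dyadic piece a dilate of one fixed symbol, and the bumps
telescope between the scales 2^N and 2^(-N). -/
lemma truncMult_eq_sum (i j : Fin 3) (N : ℕ) (ξ : E3) :
    truncMult i j N ξ =
      ∑ k ∈ Finset.range (2 * N), multPart i j (1 / 2) 1 ((2 : ℝ) ^ ((N : ℤ) - k) • ξ) := by
  have h : ∀ k ∈ Finset.range (2 * N), multPart i j (1 / 2) 1 ((2 : ℝ) ^ ((N : ℤ) - k) • ξ) =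
      (rieszMult i j ξ * (freqBump ((2 : ℝ) ^ ((N : ℤ) - (k + 1 : ℕ)) • ξ) : ℝ)) -
      (rieszMult i j ξ * (freqBump ((2 : ℝ) ^ ((N : ℤ) - (k : ℕ)) • ξ) : ℝ)) := by
    intro k _
    rw [multPart, rieszMult_smul (by positivity), smul_smul, one_smul]
    have : (1 / 2 : ℝ) * 2 ^ ((N : ℤ) - k) = 2 ^ ((N : ℤ) - (k + 1 : ℕ)) := by
      rw [show (N : ℤ) - (k + 1 : ℕ) = (N - k) - 1 by push_cast; ring, zpow_sub_one₀ two_ne_zero]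
      ring
    rw [this]
    push_cast
    ring
  rw [Finset.sum_congr rfl h, Finset.sum_range_sub
    (fun k : ℕ => rieszMult i j ξ * (freqBump ((2 : ℝ) ^ ((N : ℤ) - (k : ℕ)) • ξ) : ℝ)),
    truncMult_apply, multPart]
  rw [show (N : ℤ) - (2 * N : ℕ) = -N by push_cast; ring]
  push_cast
  simp only [sub_zero]
  ring

lemma fourierInv_comp_smul {g : E3 → ℂ} {c : ℝ} (hc : 0 < c) (x : E3) :
    𝓕⁻ (fun ξ : E3 => g (c • ξ)) x = ((c⁻¹ ^ 3 : ℝ) : ℂ) * 𝓕⁻ g (c⁻¹ • x) := by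
  rw [Real.fourierInv_eq, Real.fourierInv_eq]
  have := Measure.integral_comp_smul (volume : Measure E3)
    (fun v : E3 => Real.fourierChar (inner ℝ v (c⁻¹ • x)) • g v) c
  rw [finrank_euclideanSpace_fin, abs_of_pos (by positivity)] at this
  rw [show (((c⁻¹ ^ 3 : ℝ) : ℂ) * ∫ v : E3, Real.fourierChar (inner ℝ v (c⁻¹ • x)) • g v) =
    (c ^ 3)⁻¹ • ∫ v : E3, Real.fourierChar (inner ℝ v (c⁻¹ • x)) • g v by
      rw [inv_pow, Complex.real_smul], ← this]
  congr 1
  ext v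
  rw [inner_smul_left, inner_smul_right]
  simp [hc.ne']

lemma truncKernel_eq_sum (i j : Fin 3) (N : ℕ) (x : E3) :
    truncKernel i j N x = ∑ k ∈ Finset.range (2 * N),
      ((((2 : ℝ) ^ ((k : ℤ) - N)) ^ 3 : ℝ) : ℂ) * lpKernel i j ((2 : ℝ) ^ ((k : ℤ) - N) • x) := by
  have h0 : truncKernel i j N x = 𝓕⁻ (truncMult i j N : E3 → ℂ) x := by
    rw [truncKernel, SchwartzMap.fourierInv_coe]
  have h1 (z : E3) : lpKernel i j z = 𝓕⁻ (multPart i j (1 / 2) 1) z := by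
    rw [lpKernel, SchwartzMap.fourierInv_coe]; rfl
  rw [h0, show (truncMult i j N : E3 → ℂ) = fun ξ => ∑ k ∈ Finset.range (2 * N),
    multPart i j (1 / 2) 1 ((2 : ℝ) ^ ((N : ℤ) - k) • ξ) from
      funext (truncMult_eq_sum i j N), Real.fourierInv_eq]
  simp_rw [Finset.smul_sum]
  rw [integral_finsetSum]
  · refine Finset.sum_congr rfl fun k _ => ?_
    rw [← Real.fourierInv_eq (fun ξ => multPart i j (1 / 2) 1 ((2 : ℝ) ^ ((N : ℤ) - k) • ξ)),
      fourierInv_comp_smul (by positivity), h1, ← zpow_neg, neg_sub]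
  · intro k _
    have hc : (0 : ℝ) < 2 ^ ((N : ℤ) - k) := by positivity
    have : Integrable (fun ξ : E3 => multPart i j (1 / 2) 1 ((2 : ℝ) ^ ((N : ℤ) - k) • ξ)) := by
      refine Integrable.comp_smul ?_ hc.ne'
      exact (contDiff_multPart i j).continuous.integrable_of_hasCompactSupport
        (hasCompactSupport_multPart i j (by norm_num) one_pos)
    simpa using (Real.fourierIntegral_convergent_iff (μ := volume) (f := fun ξ : E3 =>
      multPart i j (1 / 2) 1 ((2 : ℝ) ^ ((N : ℤ) - k) • ξ)) (-x)).2 this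

/-- The summand peaks where 2^(k-N) is comparable to 1/r and decays geometrically on both sides, so
the bound is free of r, of N and of the number of terms. This is what sums the dyadic kernels. -/
lemma sum_min_zpow_le (r : ℝ) (hr : 0 < r) (N M : ℕ) :
    ∑ k ∈ Finset.range M, min ((2 : ℝ) ^ ((k : ℤ) - N) * r) ((2 : ℝ) ^ ((k : ℤ) - N) * r)⁻¹ ≤
      2 * ∑' k : ℤ, (1 / 2 : ℝ) ^ k.natAbs := by
  have hsum : Summable fun k : ℤ => (1 / 2 : ℝ) ^ k.natAbs := by
    have h : Summable fun n : ℕ => (1 / 2 : ℝ) ^ n :=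
      summable_geometric_of_lt_one (by norm_num) (by norm_num)
    exact Summable.of_nat_of_neg (by simpa using h) (by simpa using h)
  -- Here 2^m ≤ r < 2^(m+1). Replacing r by 2^m costs at most a factor two, which is the 2 in the
  -- bound.
  obtain ⟨m, hm1, hm2⟩ := exists_mem_Ico_zpow hr (one_lt_two (α := ℝ))
  have key : ∀ k : ℤ, min ((2 : ℝ) ^ k * r) ((2 : ℝ) ^ k * r)⁻¹ ≤
      2 * (1 / 2 : ℝ) ^ (k + m).natAbs := by
    intro k
    rcases le_or_gt 0 (k + m) with h | h
    · refine (min_le_right _ _).trans ?_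
      have h1 : (2 : ℝ) ^ (k + m) ≤ 2 ^ k * r := by
        rw [zpow_add₀ two_ne_zero]; gcongr
      calc ((2 : ℝ) ^ k * r)⁻¹ ≤ ((2 : ℝ) ^ (k + m))⁻¹ := by gcongr
        _ = (1 / 2 : ℝ) ^ (k + m).natAbs := by
          rw [one_div, inv_pow, ← zpow_natCast, Int.natAbs_of_nonneg h]
        _ ≤ 2 * (1 / 2 : ℝ) ^ (k + m).natAbs := by
          linarith [show 0 ≤ (1 / 2 : ℝ) ^ (k + m).natAbs by positivity]
    · refine (min_le_left _ _).trans ?_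
      have h1 : (1 / 2 : ℝ) ^ (k + m).natAbs = 2 ^ (k + m) := by
        rw [one_div, inv_pow, ← zpow_natCast, Int.ofNat_natAbs_of_nonpos h.le, zpow_neg, inv_inv]
      rw [h1, zpow_add₀ two_ne_zero]
      have h2 : r ≤ 2 * 2 ^ m := by
        rw [zpow_add_one₀ two_ne_zero] at hm2; linarith
      calc (2 : ℝ) ^ k * r ≤ 2 ^ k * (2 * 2 ^ m) := by gcongr
        _ = _ := by ring
  calc _ ≤ ∑ k ∈ Finset.range M, 2 * (1 / 2 : ℝ) ^ ((k : ℤ) - N + m).natAbs :=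
        Finset.sum_le_sum fun k _ => key _
    _ = 2 * ∑ k ∈ (Finset.range M).map
        ⟨fun k : ℕ => (k : ℤ) - N + m, fun a b h => by simpa using h⟩, (1 / 2 : ℝ) ^ k.natAbs := by
        rw [Finset.sum_map, Finset.mul_sum]; rfl
    _ ≤ _ := by
        gcongr
        exact hsum.sum_le_tsum _ fun k _ => by positivity

/-- The point is uniformity in N: the commutator estimate can be made for the truncations and passed
to the limit. The origin is set apart because the inverse on the right is 0 there by convention. -/
lemma exists_norm_truncKernel_le (i j : Fin 3) :
    ∃ C : ℝ, 0 < C ∧ ∀ (N : ℕ) (x : E3), ‖truncKernel i j N x‖ ≤ C * (‖x‖ ^ 3)⁻¹ ∨ x = 0 := by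
  -- The decay orders 2 and 4 lie on either side of the dimension 3, so |z|³ times the unit-scale
  -- kernel is small both near the origin and at infinity.
  obtain ⟨A, hA0, hA⟩ := (lpKernel i j).decay 2 0
  obtain ⟨B, hB0, hB⟩ := (lpKernel i j).decay 4 0
  set S := ∑' k : ℤ, (1 / 2 : ℝ) ^ k.natAbs
  have hS : 0 ≤ S := tsum_nonneg fun k => by positivity
  refine ⟨(A + B) * (2 * S) + 1, by positivity, fun N x => ?_⟩
  by_cases hx : x = 0
  · exact Or.inr hx
  left
  have hx0 : 0 < ‖x‖ := norm_pos_iff.2 hx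
  have key (z : E3) (hz : z ≠ 0) :
      ‖z‖ ^ 3 * ‖lpKernel i j z‖ ≤ (A + B) * min ‖z‖ ‖z‖⁻¹ := by
    have hz0 : 0 < ‖z‖ := norm_pos_iff.2 hz
    have h1 := hA z
    have h2 := hB z
    rw [norm_iteratedFDeriv_zero] at h1 h2
    rw [mul_min_of_nonneg _ _ (by positivity), le_min_iff]
    constructor
    · calc _ = ‖z‖ * (‖z‖ ^ 2 * ‖lpKernel i j z‖) := by ring
        _ ≤ ‖z‖ * (A + B) := by gcongr; linarith
        _ = _ := by ring
    · calc _ = ‖z‖⁻¹ * (‖z‖ ^ 4 * ‖lpKernel i j z‖) := by field_simp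
        _ ≤ ‖z‖⁻¹ * (A + B) := by gcongr; linarith
        _ = _ := by ring
  have : ‖x‖ ^ 3 * ‖truncKernel i j N x‖ ≤ (A + B) * (2 * S) := by
    rw [truncKernel_eq_sum]
    calc _ ≤ ‖x‖ ^ 3 * ∑ k ∈ Finset.range (2 * N), ((2 : ℝ) ^ ((k : ℤ) - N)) ^ 3 *
          ‖lpKernel i j ((2 : ℝ) ^ ((k : ℤ) - N) • x)‖ := by
          gcongr
          refine (norm_sum_le _ _).trans (Finset.sum_le_sum fun k _ => ?_)
          rw [norm_mul, Complex.norm_real, Real.norm_of_nonneg (by positivity)]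
      _ ≤ ∑ k ∈ Finset.range (2 * N), (A + B) *
          min ((2 : ℝ) ^ ((k : ℤ) - N) * ‖x‖) ((2 : ℝ) ^ ((k : ℤ) - N) * ‖x‖)⁻¹ := by
          rw [Finset.mul_sum]
          refine Finset.sum_le_sum fun k _ => ?_
          have h := key ((2 : ℝ) ^ ((k : ℤ) - N) • x) (smul_ne_zero (by positivity) hx)
          rw [norm_smul, Real.norm_of_nonneg (by positivity)] at h
          refine le_trans (le_of_eq ?_) h
          ring
      _ ≤ _ := by
          rw [← Finset.mul_sum]
          gcongr
          exact sum_min_zpow_le _ hx0 _ _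
  rw [← div_eq_mul_inv, le_div_iff₀ (by positivity)]
  linarith

/-- The symbol and the bumps are even. Evenness of the kernel is what makes the truncated operators
symmetric. -/
lemma truncKernel_neg (i j : Fin 3) (N : ℕ) (x : E3) :
    truncKernel i j N (-x) = truncKernel i j N x := by
  have h (y : E3) : truncKernel i j N y = 𝓕⁻ (truncMult i j N : E3 → ℂ) y := by
    rw [truncKernel, SchwartzMap.fourierInv_coe]
  rw [h, h, Real.fourierInv_eq, Real.fourierInv_eq, ← integral_neg_eq_self]
  congr 1
  ext v
  have hb (c : ℝ) : freqBump (c • -v) = freqBump (c • v) := by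
    rw [smul_neg, freqBump.neg]
  rw [inner_neg_neg, truncMult_apply, truncMult_apply, multPart, multPart, rieszMult_neg, hb, hb]

/-! ### Truncated operators: convergence, L² contraction, symmetry. -/

/-- A real test function as a complex Schwartz function. -/
def testSchwartz {φ : E3 → ℝ} (hφ : IsTest φ) : 𝓢(E3, ℂ) :=
  (hφ.2.comp_left (g := Complex.ofReal) Complex.ofReal_zero).toSchwartzMap
    (Complex.ofRealCLM.contDiff.comp hφ.1)

lemma testSchwartz_apply {φ : E3 → ℝ} (hφ : IsTest φ) (x : E3) :
    testSchwartz hφ x = (φ x : ℂ) := rfl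

/-- The real kernel of the frequency truncation of `R_i R_j`. -/
def rieszKernel (i j : Fin 3) (N : ℕ) (x : E3) : ℝ := (truncKernel i j N x).re

/-- The frequency truncation of `R_i R_j`. -/
def rieszTrunc (i j : Fin 3) (N : ℕ) (φ : E3 → ℝ) (x : E3) : ℝ :=
  ∫ y, φ y * rieszKernel i j N (x - y)

lemma continuous_rieszKernel (i j : Fin 3) (N : ℕ) : Continuous (rieszKernel i j N) :=
  Complex.continuous_re.comp (truncKernel i j N).continuous

/-- Both descriptions are used: the kernel for symmetry and commutators, the multiplier for
convergence and the L² bound. -/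
lemma rieszTrunc_eq_fourierInv (i j : Fin 3) (N : ℕ) {φ : E3 → ℝ} (hφ : IsTest φ) (x : E3) :
    rieszTrunc i j N φ x =
      (𝓕⁻ (SchwartzMap.pairing (ContinuousLinearMap.mul ℂ ℂ) (𝓕 (testSchwartz hφ))
        (truncMult i j N)) x).re := by
  have h1 : 𝓕⁻ (SchwartzMap.pairing (ContinuousLinearMap.mul ℂ ℂ) (𝓕 (testSchwartz hφ))
        (truncMult i j N)) =
      SchwartzMap.convolution (ContinuousLinearMap.mul ℂ ℂ) (testSchwartz hφ)
        (truncKernel i j N) := by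
    simp [SchwartzMap.convolution, truncKernel]
  rw [h1, SchwartzMap.convolution_apply, convolution_def, rieszTrunc, ← Complex.reCLM_apply,
    ← ContinuousLinearMap.integral_comp_comm]
  · congr 1
    ext y
    simp [testSchwartz_apply, rieszKernel]
  · have : Continuous fun t => ((ContinuousLinearMap.mul ℂ ℂ) (testSchwartz hφ t))
        (truncKernel i j N (x - t)) := by
      simp only [ContinuousLinearMap.mul_apply']
      have h1 := (testSchwartz hφ).continuous
      have h2 := (truncKernel i j N).continuous
      fun_prop
    refine this.integrable_of_hasCompactSupport ?_
    refine HasCompactSupport.mono (f := φ) hφ.2 ?_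
    intro t ht
    contrapose! ht
    have : φ t = 0 := by simpa using ht
    simp [testSchwartz_apply, this]

lemma tendsto_truncMult (i j : Fin 3) (ξ : E3) :
    Tendsto (fun N => truncMult i j N ξ) atTop (𝓝 (rieszMult i j ξ)) := by
  by_cases hξ : ξ = 0
  · have : rieszMult i j ξ = 0 := by simp [hξ, rieszMult, rieszSymbol]
    simp [truncMult_apply, multPart, this]
  have h1 : ∀ᶠ N : ℕ in atTop, freqBump ((2 : ℝ) ^ (-(N : ℤ)) • ξ) = 1 := by
    have : Tendsto (fun N : ℕ => ((1 / 2 : ℝ) ^ N) • ξ) atTop (𝓝 ((0 : ℝ) • ξ)) :=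
      (tendsto_pow_atTop_nhds_zero_of_lt_one (by norm_num) (by norm_num)).smul_const ξ
    rw [zero_smul] at this
    filter_upwards [this (Metric.closedBall_mem_nhds (0 : E3) one_pos)] with N hN
    apply freqBump.one_of_mem_closedBall
    rw [zpow_neg, zpow_natCast, ← inv_pow, ← one_div]
    exact hN
  have h2 : ∀ᶠ N : ℕ in atTop, freqBump ((2 : ℝ) ^ (N : ℤ) • ξ) = 0 := by
    have : Tendsto (fun N : ℕ => (2 : ℝ) ^ N * ‖ξ‖) atTop atTop :=
      (tendsto_pow_atTop_atTop_of_one_lt one_lt_two).atTop_mul_const (norm_pos_iff.2 hξ)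
    filter_upwards [this.eventually_ge_atTop 2] with N hN
    apply freqBump_smul_eq_zero (by positivity)
    rw [zpow_natCast, div_le_iff₀ (by positivity)]
    linarith
  refine tendsto_const_nhds.congr' ?_
  filter_upwards [h1, h2] with N h1 h2
  rw [truncMult_apply, multPart, h1, h2]
  simp

/-- Dominated convergence on the Fourier side: the truncated symbols are bounded by 1 and the
transform of a test function is integrable. -/
lemma tendsto_rieszTrunc (i j : Fin 3) {φ : E3 → ℝ} (hφ : IsTest φ) (x : E3) :
    Tendsto (fun N => rieszTrunc i j N φ x) atTop (𝓝 (rieszRiesz i j φ x)) := by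
  simp_rw [rieszTrunc_eq_fourierInv i j _ hφ, rieszRiesz, SchwartzMap.fourierInv_coe,
    Real.fourierInv_eq]
  refine (Complex.continuous_re.tendsto _).comp ?_
  refine tendsto_integral_of_dominated_convergence
    (fun ξ => ‖𝓕 (testSchwartz hφ) ξ‖) (fun N => ?_) ?_ (fun N => ?_) ?_
  · refine Continuous.aestronglyMeasurable ?_
    have h1 := (SchwartzMap.pairing (ContinuousLinearMap.mul ℂ ℂ) (𝓕 (testSchwartz hφ))
        (truncMult i j N)).continuous
    have h2 : Continuous (fun v : E3 => Real.fourierChar (inner ℝ v x)) :=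
      Real.continuous_fourierChar.comp (by fun_prop)
    exact h2.smul h1
  · exact (𝓕 (testSchwartz hφ)).integrable.norm
  · refine Eventually.of_forall fun ξ => ?_
    rw [Circle.norm_smul, SchwartzMap.pairing_apply_apply]
    simp only [ContinuousLinearMap.mul_apply', norm_mul]
    exact mul_le_of_le_one_right (norm_nonneg _) (norm_multPart_le _ _ _ _ _)
  · refine Eventually.of_forall fun ξ => ?_
    refine Tendsto.const_smul ?_ _
    simp only [SchwartzMap.pairing_apply_apply, ContinuousLinearMap.mul_apply']
    rw [mul_comm (rieszSymbol i ξ * rieszSymbol j ξ)]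
    have : 𝓕 (fun y : E3 => (φ y : ℂ)) ξ = 𝓕 (testSchwartz hφ) ξ := by
      rw [SchwartzMap.fourier_coe]; rfl
    rw [this]
    exact (tendsto_truncMult i j ξ).const_mul _

lemma exists_abs_rieszTrunc_le (i j : Fin 3) {φ : E3 → ℝ} (hφ : IsTest φ) :
    ∃ C : ℝ, ∀ N x, |rieszTrunc i j N φ x| ≤ C := by
  refine ⟨∫ ξ, ‖𝓕 (testSchwartz hφ) ξ‖, fun N x => ?_⟩
  rw [rieszTrunc_eq_fourierInv i j _ hφ, SchwartzMap.fourierInv_coe, Real.fourierInv_eq]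
  refine (Complex.abs_re_le_norm _).trans ?_
  refine norm_integral_le_of_norm_le (𝓕 (testSchwartz hφ)).integrable.norm
    (Eventually.of_forall fun ξ => ?_)
  rw [Circle.norm_smul, SchwartzMap.pairing_apply_apply]
  simp only [ContinuousLinearMap.mul_apply', norm_mul]
  exact mul_le_of_le_one_right (norm_nonneg _) (norm_multPart_le _ _ _ _ _)

lemma continuous_rieszTrunc (i j : Fin 3) (N : ℕ) {φ : E3 → ℝ} (hφ : IsTest φ) :
    Continuous (rieszTrunc i j N φ) := by
  rw [show rieszTrunc i j N φ = _ from funext (rieszTrunc_eq_fourierInv i j N hφ)]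
  exact Complex.continuous_re.comp (SchwartzMap.continuous _)

lemma measurable_rieszRiesz (i j : Fin 3) {φ : E3 → ℝ} (hφ : IsTest φ) :
    Measurable (rieszRiesz i j φ) :=
  measurable_of_tendsto_metrizable (fun N => (continuous_rieszTrunc i j N hφ).measurable)
    (tendsto_pi_nhds.2 (tendsto_rieszTrunc i j hφ))

lemma exists_abs_rieszRiesz_le (i j : Fin 3) {φ : E3 → ℝ} (hφ : IsTest φ) :
    ∃ C : ℝ, ∀ x, |rieszRiesz i j φ x| ≤ C := by
  obtain ⟨C, hC⟩ := exists_abs_rieszTrunc_le i j hφ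
  exact ⟨C, fun x => le_of_tendsto (tendsto_rieszTrunc i j hφ x).abs
    (Eventually.of_forall fun N => hC N x)⟩

/-- Plancherel, with a symbol bounded by 1. Taking real parts does not increase the norm. -/
lemma eLpNorm_rieszTrunc_le (i j : Fin 3) (N : ℕ) {φ : E3 → ℝ} (hφ : IsTest φ) :
    eLpNorm (rieszTrunc i j N φ) 2 volume ≤ eLpNorm φ 2 volume := by
  set g := SchwartzMap.pairing (ContinuousLinearMap.mul ℂ ℂ) (𝓕 (testSchwartz hφ))
        (truncMult i j N) with hg
  have h1 : eLpNorm (rieszTrunc i j N φ) 2 volume ≤ eLpNorm (𝓕⁻ g : 𝓢(E3, ℂ)) 2 volume := by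
    refine eLpNorm_mono fun x => ?_
    rw [rieszTrunc_eq_fourierInv i j N hφ]
    exact Complex.abs_re_le_norm _
  have hP (f : 𝓢(E3, ℂ)) : eLpNorm (𝓕 f : 𝓢(E3, ℂ)) 2 volume = eLpNorm f 2 volume := by
    have := SchwartzMap.norm_fourier_toL2_eq f
    rw [SchwartzMap.norm_toLp, SchwartzMap.norm_toLp] at this
    rwa [ENNReal.toReal_eq_toReal_iff' ((𝓕 f).memLp 2 volume).2.ne (f.memLp 2 volume).2.ne] at this
  have h2 : eLpNorm (𝓕⁻ g : 𝓢(E3, ℂ)) 2 volume = eLpNorm g 2 volume := by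
    rw [← hP (𝓕⁻ g), FourierTransform.fourier_fourierInv_eq]
  have h3 : eLpNorm g 2 volume ≤ eLpNorm (𝓕 (testSchwartz hφ) : 𝓢(E3, ℂ)) 2 volume := by
    refine eLpNorm_mono fun ξ => ?_
    rw [hg, SchwartzMap.pairing_apply_apply]
    simp only [ContinuousLinearMap.mul_apply', norm_mul]
    exact mul_le_of_le_one_right (norm_nonneg _) (norm_multPart_le _ _ _ _ _)
  have h4 : eLpNorm (testSchwartz hφ) 2 volume = eLpNorm φ 2 volume :=
    eLpNorm_congr_norm_ae (Eventually.of_forall fun x => by simp [testSchwartz_apply])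
  calc _ ≤ _ := h1
    _ = _ := h2
    _ ≤ _ := h3
    _ = _ := (hP _).trans h4

/-- The operators `R_i R_j` are contractions of `L²`. -/
lemma eLpNorm_rieszRiesz_le (i j : Fin 3) {φ : E3 → ℝ} (hφ : IsTest φ) :
    eLpNorm (rieszRiesz i j φ) 2 volume ≤ eLpNorm φ 2 volume := by
  refine (Lp.eLpNorm_lim_le_liminf_eLpNorm
    (fun N => (continuous_rieszTrunc i j N hφ).aestronglyMeasurable) _
    (Eventually.of_forall (tendsto_rieszTrunc i j hφ))).trans ?_
  refine liminf_le_of_le (by isBoundedDefault) fun b hb => ?_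
  obtain ⟨N, hN⟩ := hb.exists
  exact hN.trans (eLpNorm_rieszTrunc_le i j N hφ)

lemma rieszTrunc_symm (i j : Fin 3) (N : ℕ) {φ ψ : E3 → ℝ} (hφ : IsTest φ) (hψ : IsTest ψ) :
    ∫ x, rieszTrunc i j N φ x * ψ x = ∫ x, φ x * rieszTrunc i j N ψ x := by
  have hk (z : E3) : rieszKernel i j N (-z) = rieszKernel i j N z := by
    rw [rieszKernel, truncKernel_neg]; rfl
  have hφc := hφ.1.continuous
  have hψc := hψ.1.continuous
  simp_rw [rieszTrunc, ← integral_mul_const, ← integral_const_mul]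
  rw [integral_integral_swap]
  · congr 1
    ext y
    congr 1
    ext x
    rw [← hk (y - x), neg_sub]
    ring
  · have hc : Continuous (fun z : E3 × E3 => φ z.2 * rieszKernel i j N (z.1 - z.2) * ψ z.1) := by
      have := continuous_rieszKernel i j N
      fun_prop
    refine hc.integrable_of_hasCompactSupport ?_
    refine HasCompactSupport.intro (hψ.2.isCompact.prod hφ.2.isCompact) fun z hz => ?_
    rw [mem_prod, not_and_or] at hz
    rcases hz with h | h
    · simp [image_eq_zero_of_notMem_tsupport h]
    · simp [image_eq_zero_of_notMem_tsupport h]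

lemma tendsto_integral_rieszTrunc_mul (i j : Fin 3) {φ ψ : E3 → ℝ} (hφ : IsTest φ)
    (hψ : IsTest ψ) : Tendsto (fun N => ∫ x, rieszTrunc i j N φ x * ψ x) atTop
      (𝓝 (∫ x, rieszRiesz i j φ x * ψ x)) := by
  obtain ⟨C, hC⟩ := exists_abs_rieszTrunc_le i j hφ
  refine tendsto_integral_of_dominated_convergence (fun x => C * ‖ψ x‖) (fun N => ?_) ?_
    (fun N => Eventually.of_forall fun x => ?_) (Eventually.of_forall fun x => ?_)
  · exact ((continuous_rieszTrunc i j N hφ).mul hψ.1.continuous).aestronglyMeasurable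
  · exact (hψ.1.continuous.integrable_of_hasCompactSupport hψ.2).norm.const_mul C
  · rw [norm_mul]
    gcongr
    exact hC N x
  · exact (tendsto_rieszTrunc i j hφ x).mul_const _

/-- The operators `R_i R_j` are symmetric. -/
lemma integral_rieszRiesz_mul (i j : Fin 3) {φ ψ : E3 → ℝ} (hφ : IsTest φ) (hψ : IsTest ψ) :
    ∫ x, rieszRiesz i j φ x * ψ x = ∫ x, φ x * rieszRiesz i j ψ x := by
  refine tendsto_nhds_unique (tendsto_integral_rieszTrunc_mul i j hφ hψ) ?_
  simp_rw [rieszTrunc_symm i j _ hφ hψ]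
  simp_rw [mul_comm (φ _)]
  exact tendsto_integral_rieszTrunc_mul i j hψ hφ

/-! ### Commutators of R_i R_j with smooth functions. -/

/-- The kernel dominating the commutator of `ρ` with a Calderón–Zygmund operator of `ℝ³`. -/
def commKernel (ρ : E3 → ℝ) (x y : E3) : ℝ≥0∞ := ‖ρ x - ρ y‖ₑ * (‖x - y‖ₑ ^ 3)⁻¹

lemma commKernel_comm (ρ : E3 → ℝ) (x y : E3) : commKernel ρ x y = commKernel ρ y x := by
  rw [commKernel, commKernel, ← enorm_neg (ρ x - ρ y), ← enorm_neg (x - y), neg_sub, neg_sub]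

lemma IsTest.mul_left {ρ V : E3 → ℝ} (hρ : ContDiff ℝ ∞ ρ) (hV : IsTest V) :
    IsTest (fun x => ρ x * V x) :=
  ⟨hρ.mul hV.1, hV.2.mul_left⟩

/-- Commutators of `R_i R_j` with smooth functions are dominated by a positive integral operator. -/
lemma exists_enorm_rieszRiesz_commutator_le (i j : Fin 3) :
    ∃ C : ℝ≥0, ∀ (ρ V : E3 → ℝ), ContDiff ℝ ∞ ρ → IsTest V → ∀ x,
      ‖rieszRiesz i j (fun y => ρ y * V y) x - ρ x * rieszRiesz i j V x‖ₑ ≤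
        C * ∫⁻ y, commKernel ρ x y * ‖V y‖ₑ := by
  obtain ⟨C, hC0, hC⟩ := exists_norm_truncKernel_le i j
  refine ⟨C.toNNReal, fun ρ V hρ hV x => ?_⟩
  -- For a truncation the commutator is an absolutely convergent integral with kernel (ρ(y)-ρ(x))
  -- K_N(x-y). The bound on K_N is uniform in N, so no principal value appears in the limit.
  have hlim : Tendsto (fun N => rieszTrunc i j N (fun y => ρ y * V y) x -
      ρ x * rieszTrunc i j N V x) atTop
      (𝓝 (rieszRiesz i j (fun y => ρ y * V y) x - ρ x * rieszRiesz i j V x)) :=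
    (tendsto_rieszTrunc i j (hV.mul_left hρ) x).sub ((tendsto_rieszTrunc i j hV x).const_mul _)
  refine le_of_tendsto hlim.enorm (Eventually.of_forall fun N => ?_)
  have hi (φ : E3 → ℝ) (hφ : IsTest φ) : Integrable fun y => φ y * rieszKernel i j N (x - y) := by
    refine Continuous.integrable_of_hasCompactSupport ?_ hφ.2.mul_right
    have h1 := continuous_rieszKernel i j N
    have h2 := hφ.1.continuous
    fun_prop
  have heq : rieszTrunc i j N (fun y => ρ y * V y) x - ρ x * rieszTrunc i j N V x =
      ∫ y, (ρ y - ρ x) * V y * rieszKernel i j N (x - y) := by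
    rw [rieszTrunc, rieszTrunc, ← integral_const_mul,
      ← integral_sub (hi _ (hV.mul_left hρ)) ((hi V hV).const_mul _)]
    congr 1
    ext y
    ring
  rw [heq, ← lintegral_const_mul' _ _ ENNReal.coe_ne_top]
  refine (enorm_integral_le_lintegral_enorm _).trans (lintegral_mono fun y => ?_)
  rw [enorm_mul, enorm_mul, commKernel]
  -- On the diagonal the factor ρ(y)-ρ(x) vanishes, so the kernel need not be bounded at the origin.
  by_cases hxy : x = y
  · simp [hxy]
  · have hne : x - y ≠ 0 := sub_ne_zero.2 hxy
    have h1 : |rieszKernel i j N (x - y)| ≤ C * (‖x - y‖ ^ 3)⁻¹ :=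
      (Complex.abs_re_le_norm _).trans ((hC N (x - y)).resolve_right hne)
    have h2 : ‖rieszKernel i j N (x - y)‖ₑ ≤ (C.toNNReal : ℝ≥0∞) * (‖x - y‖ₑ ^ 3)⁻¹ := by
      rw [Real.enorm_eq_ofReal_abs]
      refine (ENNReal.ofReal_le_ofReal h1).trans (le_of_eq ?_)
      rw [ENNReal.ofReal_mul hC0.le, ENNReal.ofReal_inv_of_pos (by positivity),
        ENNReal.ofReal_pow (norm_nonneg _), ofReal_norm]
      rfl
    calc _ ≤ ‖ρ y - ρ x‖ₑ * ‖V y‖ₑ *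
        ((C.toNNReal : ℝ≥0∞) * (‖x - y‖ₑ ^ 3)⁻¹) := by gcongr
      _ = _ := by
        rw [← enorm_neg (ρ y - ρ x), neg_sub]
        ring

/-! ### Smooth power weights and Schur's test. -/

/-- The Japanese bracket `(1 + |x|²)^{1/2}`. -/
def jb (x : E3) : ℝ := √(1 + ‖x‖ ^ 2)

/-- The smooth weight `(1 + |x|²)^{-a/2}`. -/
def wt (a : ℝ) (x : E3) : ℝ := jb x ^ (-a)

lemma one_le_jb (x : E3) : 1 ≤ jb x := Real.one_le_sqrt.2 (by nlinarith [sq_nonneg ‖x‖])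

lemma jb_pos (x : E3) : 0 < jb x := one_pos.trans_le (one_le_jb x)

lemma jb_sq (x : E3) : jb x ^ 2 = 1 + ‖x‖ ^ 2 := Real.sq_sqrt (by positivity)

lemma norm_le_jb (x : E3) : ‖x‖ ≤ jb x := Real.le_sqrt_of_sq_le (by linarith)

lemma jb_le_jb_add (x y : E3) : jb x ≤ jb y + ‖x - y‖ := by
  have h1 := norm_le_jb y
  have h2 : ‖x‖ ≤ ‖y‖ + ‖x - y‖ := norm_le_norm_add_norm_sub y x |>.trans (by rw [norm_sub_rev])
  rw [jb, Real.sqrt_le_left (by positivity [jb_pos y])]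
  have h3 := norm_nonneg x
  nlinarith [jb_sq y, norm_nonneg (x - y), norm_nonneg y]

lemma contDiff_jb : ContDiff ℝ ∞ jb :=
  (contDiff_const.add (contDiff_norm_sq ℝ)).sqrt fun x => by positivity

lemma contDiff_wt (a : ℝ) : ContDiff ℝ ∞ (wt a) :=
  contDiff_jb.rpow_const_of_ne fun x => (jb_pos x).ne'

@[fun_prop]
lemma continuous_wt (a : ℝ) : Continuous (wt a) := (contDiff_wt a).continuous

@[fun_prop]
lemma measurable_wt (a : ℝ) : Measurable (wt a) := (continuous_wt a).measurable

lemma wt_pos (a : ℝ) (x : E3) : 0 < wt a x := Real.rpow_pos_of_pos (jb_pos x) _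

lemma wt_add (a b : ℝ) (x : E3) : wt (a + b) x = wt a x * wt b x := by
  rw [wt, neg_add, Real.rpow_add (jb_pos x)]; rfl

lemma wt_zero (x : E3) : wt 0 x = 1 := by simp [wt]

lemma wt_neg_mul_self (a : ℝ) (x : E3) : wt (-a) x * wt a x = 1 := by
  rw [← wt_add, neg_add_cancel, wt_zero]

lemma wt_rpow (a r : ℝ) (x : E3) : wt a x ^ r = wt (a * r) x := by
  rw [wt, wt, ← Real.rpow_mul (jb_pos x).le, neg_mul]

lemma wt_anti {a b : ℝ} (h : a ≤ b) (x : E3) : wt b x ≤ wt a x :=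
  Real.rpow_le_rpow_of_exponent_le (one_le_jb x) (by linarith)

lemma wt_le_wt_of_jb_le {a : ℝ} (ha : 0 ≤ a) {x y : E3} (h : jb x ≤ jb y) : wt a y ≤ wt a x :=
  Real.rpow_le_rpow_of_nonpos (jb_pos x) h (by linarith)

lemma lintegral_eq_scale {f : E3 → ℝ≥0∞} (hf : Measurable f) {r : ℝ} (hr : 0 < r) :
    ∫⁻ x, f x = ENNReal.ofReal (r ^ 3) * ∫⁻ x, f (r • x) := by
  have h := Measure.map_addHaar_smul (volume : Measure E3) hr.ne'
  have hm : Measurable (fun x : E3 => r • x) := measurable_const_smul r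
  rw [← lintegral_map hf hm, h, lintegral_smul_measure, finrank_euclideanSpace_fin, smul_eq_mul,
    ← mul_assoc, ← ENNReal.ofReal_mul (by positivity), abs_of_pos (by positivity),
    mul_inv_cancel₀ (by positivity), ENNReal.ofReal_one, one_mul]

/-- Scaling reduces to the unit ball, where the integral converges since τ < 3. The exact power of r
matters: it will be a multiple of the bracket at x, and the powers must add up to the weight of
order a + s. -/
lemma exists_lintegral_ball_norm_rpow_le {τ : ℝ} (hτ : τ < 3) :
    ∃ C : ℝ≥0, ∀ r : ℝ, 0 < r →
      ∫⁻ x in Metric.ball (0 : E3) r, ENNReal.ofReal (‖x‖ ^ (-τ)) ≤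
        C * ENNReal.ofReal (r ^ (3 - τ)) := by
  have hfin : ∫⁻ x in Metric.ball (0 : E3) 1, ENNReal.ofReal (‖x‖ ^ (-τ)) < ⊤ := by
    have : IntegrableOn (fun x : E3 => ‖x‖ ^ (-τ)) (Metric.ball 0 1) := by
      rw [integrableOn_fun_norm_addHaar volume (f := fun t => t ^ (-τ)),
        finrank_euclideanSpace_fin]
      have : IntegrableOn (fun y : ℝ => y ^ (2 - τ)) (Ioo 0 1) :=
        (intervalIntegral.integrableOn_Ioo_rpow_iff one_pos).2 (by linarith)
      refine this.congr_fun (fun y hy => ?_) measurableSet_Ioo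
      simp only [smul_eq_mul]
      rw [show (3 : ℕ) - 1 = 2 from rfl, ← Real.rpow_natCast, ← Real.rpow_add hy.1]
      congr 1
    exact this.lintegral_lt_top
  refine ⟨(∫⁻ x in Metric.ball (0 : E3) 1, ENNReal.ofReal (‖x‖ ^ (-τ))).toNNReal, fun r hr => ?_⟩
  rw [ENNReal.coe_toNNReal hfin.ne, ← lintegral_indicator measurableSet_ball,
    ← lintegral_indicator measurableSet_ball, lintegral_eq_scale _ hr]
  · have h (x : E3) : (Metric.ball (0 : E3) r).indicator
        (fun x => ENNReal.ofReal (‖x‖ ^ (-τ))) (r • x) = ENNReal.ofReal (r ^ (-τ)) *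
        (Metric.ball (0 : E3) 1).indicator (fun x => ENNReal.ofReal (‖x‖ ^ (-τ))) x := by
      have hiff : r • x ∈ Metric.ball (0 : E3) r ↔ x ∈ Metric.ball (0 : E3) 1 := by
        simp [norm_smul, abs_of_pos hr, hr]
      by_cases hx : x ∈ Metric.ball (0 : E3) 1
      · rw [indicator_of_mem hx, indicator_of_mem (hiff.2 hx), norm_smul,
          Real.norm_of_nonneg hr.le, Real.mul_rpow hr.le (norm_nonneg _),
          ENNReal.ofReal_mul (by positivity)]
      · rw [indicator_of_notMem hx, indicator_of_notMem (fun h => hx (hiff.1 h)), mul_zero]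
    simp_rw [h]
    rw [lintegral_const_mul' _ _ ENNReal.ofReal_ne_top, ← mul_assoc,
      ← ENNReal.ofReal_mul (by positivity), ← Real.rpow_natCast, ← Real.rpow_add hr, mul_comm]
    exact le_of_eq (by congr 2)
  · exact Measurable.indicator (by fun_prop) measurableSet_ball

lemma exists_lintegral_add_norm_rpow_le {s : ℝ} (hs : 0 < s) :
    ∃ C : ℝ≥0, ∀ r : ℝ, 0 < r →
      ∫⁻ x : E3, ENNReal.ofReal ((r + ‖x‖) ^ (-(3 + s))) ≤ C * ENNReal.ofReal (r ^ (-s)) := by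
  have hfin := finite_integral_one_add_norm (E := E3) (μ := volume) (r := 3 + s)
    (by rw [finrank_euclideanSpace_fin]; push_cast; linarith)
  refine ⟨(∫⁻ x : E3, ENNReal.ofReal ((1 + ‖x‖) ^ (-(3 + s)))).toNNReal, fun r hr => ?_⟩
  rw [ENNReal.coe_toNNReal hfin.ne, lintegral_eq_scale (by fun_prop) hr]
  have h (x : E3) : ENNReal.ofReal ((r + ‖r • x‖) ^ (-(3 + s))) =
      ENNReal.ofReal (r ^ (-(3 + s))) * ENNReal.ofReal ((1 + ‖x‖) ^ (-(3 + s))) := by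
    rw [← ENNReal.ofReal_mul (by positivity), ← Real.mul_rpow hr.le (by positivity), norm_smul,
      Real.norm_of_nonneg hr.le, mul_add, mul_one]
  simp_rw [h]
  rw [lintegral_const_mul' _ _ ENNReal.ofReal_ne_top, ← mul_assoc,
    ← ENNReal.ofReal_mul (by positivity), ← Real.rpow_natCast, ← Real.rpow_add hr, mul_comm]
  exact le_of_eq (by congr 3; push_cast; ring)

/-- With ρ = u/v ≤ 1 and a ≤ 2, one has 1 - ρ^a ≤ 1 - ρ² ≤ 2(1 - ρ). -/
lemma rpow_neg_sub_rpow_neg_le {a u v : ℝ} (ha2 : a ≤ 2) (hu : 0 < u) (huv : u ≤ v) :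
    u ^ (-a) - v ^ (-a) ≤ 2 * u ^ (-a) * ((v - u) / v) := by
  have hv : 0 < v := hu.trans_le huv
  have hr1 : u / v ≤ 1 := (div_le_one hv).2 huv
  have h1 : (u / v) ^ 2 ≤ (u / v) ^ a := by
    rw [← Real.rpow_natCast]
    exact Real.rpow_le_rpow_of_exponent_ge (by positivity) hr1 (by exact_mod_cast ha2)
  have h2 : v ^ (-a) = u ^ (-a) * (u / v) ^ a := by
    rw [Real.div_rpow hu.le hv.le, Real.rpow_neg hu.le, Real.rpow_neg hv.le]
    field_simp
  have h3 : (v - u) / v = 1 - u / v := by field_simp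
  rw [h2, h3]
  have h4 : 0 < u ^ (-a) := by positivity
  have h5 : 1 - (u / v) ^ a ≤ 2 * (1 - u / v) := by nlinarith [sq_nonneg (1 - u / v)]
  nlinarith

/-- Near the diagonal the brackets at x and y are comparable, and the difference of weights gains
|x-y| / `jb x`. This turns the singularity |x-y|^(-3) into the integrable |x-y|^(-2). -/
lemma abs_wt_sub_wt_le {a : ℝ} (ha : 0 < a) (ha2 : a ≤ 2) {x y : E3} (h : ‖x - y‖ ≤ jb x / 2) :
    |wt a x - wt a y| ≤ 2 * (jb x / 2) ^ (-a) * (‖x - y‖ / jb x) := by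
  have hX := jb_pos x
  have hY := jb_pos y
  have h1 := jb_le_jb_add x y
  have h2 := jb_le_jb_add y x
  rw [norm_sub_rev] at h2
  have hYX : jb x / 2 ≤ jb y := by linarith
  rcases le_total (jb x) (jb y) with hle | hle
  · rw [abs_of_nonneg (sub_nonneg.2 (wt_le_wt_of_jb_le ha.le hle))]
    refine (rpow_neg_sub_rpow_neg_le ha2 hX hle).trans ?_
    have : (jb y - jb x) / jb y ≤ ‖x - y‖ / jb x := by
      gcongr; linarith
    exact mul_le_mul (mul_le_mul_of_nonneg_left (Real.rpow_le_rpow_of_nonpos (half_pos hX)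
      (half_le_self hX.le) (neg_nonpos.2 ha.le)) zero_le_two) this
      (div_nonneg (sub_nonneg.2 hle) hY.le) (by positivity)
  · rw [abs_sub_comm,
      abs_of_nonneg (sub_nonneg.2 (wt_le_wt_of_jb_le ha.le hle))]
    refine (rpow_neg_sub_rpow_neg_le ha2 hY hle).trans ?_
    have : (jb x - jb y) / jb x ≤ ‖x - y‖ / jb x := by
      gcongr; linarith
    exact mul_le_mul (mul_le_mul_of_nonneg_left (Real.rpow_le_rpow_of_nonpos (half_pos hX)
      hYX (neg_nonpos.2 ha.le)) zero_le_two) this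
      (div_nonneg (sub_nonneg.2 hle) hX.le) (by positivity)

/-- A pointwise bound for the commutator kernel of a power weight. -/
lemma abs_wt_sub_wt_mul_le {a s : ℝ} (ha : 0 < a) (ha2 : a ≤ 2) (hs : 0 < s) (x y : E3)
    (hxy : x ≠ y) (hy0 : y ≠ 0) :
    |wt a x - wt a y| * (‖x - y‖ ^ 3)⁻¹ * wt s y ≤
      (Metric.ball 0 (jb x)).indicator
        (fun z => 2 * (jb x / 2) ^ (-(a + s)) / jb x * ‖z‖ ^ (-(2 : ℝ))) (x - y) +
      (Metric.ball 0 (2 * jb x)).indicator (fun z => 8 * jb x ^ (-(3 : ℝ)) * ‖z‖ ^ (-(a + s))) y +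
      27 * 2 ^ (3 + s) * wt a x * (jb x + ‖y‖) ^ (-(3 + s)) := by
  have hX := jb_pos x
  have hY := jb_pos y
  have hd : 0 < ‖x - y‖ := norm_pos_iff.2 (sub_ne_zero.2 hxy)
  have hwx := wt_pos a x
  have hwy := wt_pos a y
  have hws := wt_pos s y
  have h1 := jb_le_jb_add x y
  have h2 := jb_le_jb_add y x
  rw [norm_sub_rev] at h2
  have p1 : 0 ≤ (Metric.ball 0 (jb x)).indicator
        (fun z : E3 => 2 * (jb x / 2) ^ (-(a + s)) / jb x * ‖z‖ ^ (-(2 : ℝ))) (x - y) :=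
    indicator_nonneg (fun z _ => by positivity) _
  have p2 : 0 ≤ (Metric.ball 0 (2 * jb x)).indicator
      (fun z : E3 => 8 * jb x ^ (-(3 : ℝ)) * ‖z‖ ^ (-(a + s))) y :=
    indicator_nonneg (fun z _ => by positivity) _
  have p3 : 0 ≤ 27 * 2 ^ (3 + s) * wt a x * (jb x + ‖y‖) ^ (-(3 + s)) := by positivity
  -- Three regions, one for each term of the bound. Near the diagonal, smoothness of the weight is
  -- used. Away from it, the larger of the two weights dominates: that of y when y has the smaller
  -- bracket, so that |x-y| is at least half the bracket of x, and that of x otherwise, so that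
  -- |x-y| is at least a third of the bracket of y.
  rcases le_or_gt ‖x - y‖ (jb x / 2) with hn | hf
  · have hmem : x - y ∈ Metric.ball (0 : E3) (jb x) := by
      rw [mem_ball_zero_iff]; linarith
    rw [indicator_of_mem hmem] at p1 ⊢
    refine le_trans ?_ (le_add_of_le_of_nonneg (le_add_of_nonneg_right p2) p3)
    have hw : wt s y ≤ (jb x / 2) ^ (-s) :=
      Real.rpow_le_rpow_of_nonpos (by positivity) (by linarith) (by linarith)
    calc _ ≤ (2 * (jb x / 2) ^ (-a) * (‖x - y‖ / jb x)) * (‖x - y‖ ^ 3)⁻¹ * (jb x / 2) ^ (-s) := by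
          gcongr
          exact abs_wt_sub_wt_le ha ha2 hn
      _ = _ := by
          rw [neg_add, Real.rpow_add (by positivity), Real.rpow_neg hd.le, Real.rpow_two]
          field_simp
  · rcases le_or_gt (jb y) (jb x) with hle | hlt
    · have hy : ‖y‖ < 2 * jb x := by linarith [norm_le_jb y]
      have hy0' : 0 < ‖y‖ := norm_pos_iff.2 hy0
      have hmem : y ∈ Metric.ball (0 : E3) (2 * jb x) := by
        rw [mem_ball_zero_iff]; linarith
      rw [indicator_of_mem hmem] at p2 ⊢
      refine le_trans ?_ (le_add_of_le_of_nonneg (le_add_of_nonneg_left p1) p3)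
      have hw : wt a x ≤ wt a y := Real.rpow_le_rpow_of_nonpos hY hle (by linarith)
      have hw2 : |wt a x - wt a y| ≤ wt a y := by
        rw [abs_le]; constructor <;> linarith
      calc _ ≤ wt a y * ((jb x / 2) ^ 3)⁻¹ * wt s y := by gcongr
        _ = 8 * jb x ^ (-(3 : ℝ)) * wt (a + s) y := by
          rw [Real.rpow_neg hX.le, wt_add]
          norm_cast
          field_simp
          norm_num
        _ ≤ _ := by
          gcongr
          exact Real.rpow_le_rpow_of_nonpos hy0' (norm_le_jb y) (by linarith)
    · refine le_trans ?_ (le_add_of_nonneg_left (add_nonneg p1 p2))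
      have hw : wt a y ≤ wt a x := Real.rpow_le_rpow_of_nonpos hX hlt.le (by linarith)
      have hw2 : |wt a x - wt a y| ≤ wt a x := by
        rw [abs_le]; constructor <;> linarith
      have hd3 : jb y / 3 ≤ ‖x - y‖ := by linarith
      have hs2 : (jb x + ‖y‖) / 2 ≤ jb y := by linarith [norm_le_jb y]
      calc _ ≤ wt a x * ((jb y / 3) ^ 3)⁻¹ * wt s y := by gcongr
        _ = 27 * wt a x * jb y ^ (-(3 + s)) := by
          rw [wt, wt, neg_add, Real.rpow_add hY, Real.rpow_neg hY.le 3]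
          norm_cast
          field_simp
          norm_num
        _ ≤ 27 * wt a x * ((jb x + ‖y‖) / 2) ^ (-(3 + s)) := by
          gcongr ?_ * ?_
          exact Real.rpow_le_rpow_of_nonpos (by positivity) hs2 (by linarith)
        _ = _ := by
          rw [Real.div_rpow (by positivity) (by positivity), Real.rpow_neg zero_le_two (3 + s)]
          field_simp

/-- The weighted integrals behind Schur's test for the commutator kernel of a power weight. -/
lemma exists_lintegral_commKernel_le {a s : ℝ} (ha : 0 < a) (ha2 : a ≤ 2) (hs : 0 < s)
    (has : a + s < 3) :
    ∃ C : ℝ≥0, ∀ x, ∫⁻ y, commKernel (wt a) x y * ENNReal.ofReal (wt s y) ≤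
      C * ENNReal.ofReal (wt (a + s) x) := by
  obtain ⟨C₁, hC₁⟩ := exists_lintegral_ball_norm_rpow_le (τ := 2) (by norm_num)
  obtain ⟨C₂, hC₂⟩ := exists_lintegral_ball_norm_rpow_le has
  obtain ⟨C₃, hC₃⟩ := exists_lintegral_add_norm_rpow_le hs
  refine ⟨Real.toNNReal (2 * 2 ^ (a + s)) * C₁ + Real.toNNReal (8 * 2 ^ (3 - (a + s))) * C₂ +
    Real.toNNReal (27 * 2 ^ (3 + s)) * C₃, fun x => ?_⟩
  have hX := jb_pos x
  have hw := wt_pos a x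
  have hpt : ∀ᵐ y : E3, commKernel (wt a) x y * ENNReal.ofReal (wt s y) ≤
      (Metric.ball 0 (jb x)).indicator (fun z => ENNReal.ofReal
        (2 * (jb x / 2) ^ (-(a + s)) / jb x) * ENNReal.ofReal (‖z‖ ^ (-(2 : ℝ)))) (x - y) +
      (Metric.ball 0 (2 * jb x)).indicator (fun z => ENNReal.ofReal (8 * jb x ^ (-(3 : ℝ))) *
        ENNReal.ofReal (‖z‖ ^ (-(a + s)))) y +
      ENNReal.ofReal (27 * 2 ^ (3 + s) * wt a x) *
        ENNReal.ofReal ((jb x + ‖y‖) ^ (-(3 + s))) := by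
    -- Two null points are removed: the diagonal, and y = 0, where the negative power of ‖y‖ takes
    -- the value 0 by convention and would not majorize.
    filter_upwards [compl_mem_ae_iff.2 (measure_singleton (0 : E3)),
      compl_mem_ae_iff.2 (measure_singleton x)] with y hy0 hyx
    have hne : x ≠ y := fun h => hyx h.symm
    have hd : 0 < ‖x - y‖ := norm_pos_iff.2 (sub_ne_zero.2 hne)
    have h := abs_wt_sub_wt_mul_le ha ha2 hs x y hne hy0
    have e1 : commKernel (wt a) x y * ENNReal.ofReal (wt s y) =
        ENNReal.ofReal (|wt a x - wt a y| * (‖x - y‖ ^ 3)⁻¹ * wt s y) := by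
      rw [ENNReal.ofReal_mul (by positivity), ENNReal.ofReal_mul (by positivity),
        ENNReal.ofReal_inv_of_pos (by positivity), ENNReal.ofReal_pow (norm_nonneg _), ofReal_norm,
        ← Real.enorm_eq_ofReal_abs, commKernel]
    rw [e1]
    refine (ENNReal.ofReal_le_ofReal h).trans ?_
    refine ENNReal.ofReal_add_le.trans (add_le_add (ENNReal.ofReal_add_le.trans
      (add_le_add ?_ ?_)) ?_)
    · by_cases hm : x - y ∈ Metric.ball (0 : E3) (jb x)
      · rw [indicator_of_mem hm, indicator_of_mem hm, ENNReal.ofReal_mul (by positivity)]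
      · rw [indicator_of_notMem hm, indicator_of_notMem hm, ENNReal.ofReal_zero]
    · by_cases hm : y ∈ Metric.ball (0 : E3) (2 * jb x)
      · rw [indicator_of_mem hm, indicator_of_mem hm, ENNReal.ofReal_mul (by positivity)]
      · rw [indicator_of_notMem hm, indicator_of_notMem hm, ENNReal.ofReal_zero]
    · rw [ENNReal.ofReal_mul (by positivity)]
  have hm1 : Measurable ((Metric.ball (0 : E3) (jb x)).indicator (fun z => ENNReal.ofReal
        (2 * (jb x / 2) ^ (-(a + s)) / jb x) * ENNReal.ofReal (‖z‖ ^ (-(2 : ℝ))))) :=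
    Measurable.indicator (by fun_prop) measurableSet_ball
  have hm2 : Measurable fun y => (Metric.ball (0 : E3) (jb x)).indicator (fun z => ENNReal.ofReal
        (2 * (jb x / 2) ^ (-(a + s)) / jb x) * ENNReal.ofReal (‖z‖ ^ (-(2 : ℝ)))) (x - y) :=
    hm1.comp (measurable_const.sub measurable_id)
  refine (lintegral_mono_ae hpt).trans ?_
  rw [lintegral_add_right _ (by fun_prop),
    lintegral_add_left hm2,
    lintegral_sub_left_eq_self (μ := volume) _ x, lintegral_indicator measurableSet_ball,
    lintegral_indicator measurableSet_ball, lintegral_const_mul' _ _ ENNReal.ofReal_ne_top,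
    lintegral_const_mul' _ _ ENNReal.ofReal_ne_top, lintegral_const_mul' _ _ ENNReal.ofReal_ne_top]
  push_cast
  rw [add_mul, add_mul]
  refine add_le_add (add_le_add ?_ ?_) ?_
  · refine (mul_le_mul_right (hC₁ _ hX) _).trans (le_of_eq ?_)
    rw [mul_left_comm, ← ENNReal.ofReal_mul (by positivity), mul_comm (Real.toNNReal _ : ℝ≥0∞),
      mul_assoc]
    change _ = _ * (ENNReal.ofReal _ * _)
    rw [← ENNReal.ofReal_mul (by positivity)]
    congr 2
    rw [wt, Real.div_rpow hX.le zero_le_two, Real.rpow_neg zero_le_two,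
      show (3 : ℝ) - 2 = 1 by norm_num, Real.rpow_one]
    field_simp
  · refine (mul_le_mul_right (hC₂ _ (by positivity)) _).trans (le_of_eq ?_)
    rw [mul_left_comm, ← ENNReal.ofReal_mul (by positivity), mul_comm (Real.toNNReal _ : ℝ≥0∞),
      mul_assoc (C₂ : ℝ≥0∞)]
    change _ = _ * (ENNReal.ofReal _ * _)
    rw [← ENNReal.ofReal_mul (by positivity)]
    congr 2
    rw [wt, Real.mul_rpow zero_le_two hX.le, sub_eq_add_neg (3 : ℝ), Real.rpow_add hX,
      Real.rpow_neg hX.le 3]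
    field_simp
  · refine (mul_le_mul_right (hC₃ _ hX) _).trans (le_of_eq ?_)
    rw [mul_left_comm, ← ENNReal.ofReal_mul (by positivity), mul_comm (Real.toNNReal _ : ℝ≥0∞),
      mul_assoc (C₃ : ℝ≥0∞)]
    change _ = _ * (ENNReal.ofReal _ * _)
    rw [← ENNReal.ofReal_mul (by positivity)]
    congr 2
    rw [wt_add, mul_assoc]
    rfl

@[fun_prop]
lemma measurable_commKernel {ρ : E3 → ℝ} (hρ : Measurable ρ) :
    Measurable (fun z : E3 × E3 => commKernel ρ z.1 z.2) := by
  unfold commKernel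
  have h1 : Measurable (fun z : E3 × E3 => ‖z.1 - z.2‖ₑ) :=
    (measurable_fst.sub measurable_snd).enorm
  exact (((hρ.comp measurable_fst).sub (hρ.comp measurable_snd)).enorm).mul (h1.pow_const 3).inv

/-- Schur's test for the commutator kernel of a power weight. -/
lemma exists_lintegral_commKernel_bilinear_le {a σ r r' : ℝ} (ha : 0 < a) (ha2 : a ≤ 2)
    (hr : r.HolderConjugate r') (hσ : 0 < σ) (h1 : a + σ * r < 3) (h2 : a < σ * r')
    (h3 : σ * r' < 3) :
    ∃ C : ℝ≥0, ∀ g V : E3 → ℝ≥0∞, AEMeasurable g → AEMeasurable V →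
      ∫⁻ x, ∫⁻ y, commKernel (wt a) x y * ENNReal.ofReal (wt (-a) y) * g y * V x ≤
        C * (∫⁻ y, g y ^ r) ^ (1 / r) * (∫⁻ x, V x ^ r') ^ (1 / r') := by
  have hr0 : 0 < r := hr.pos
  have hr0' : 0 < r' := hr.symm.pos
  -- The orders σ r and σ r' - a are those for which all weights cancel after integrating the
  -- kernel. The hypotheses `h1`, `h2`, `h3` say that these two orders are admissible.
  obtain ⟨C₁, hC₁⟩ := exists_lintegral_commKernel_le ha ha2 (s := σ * r) (by positivity) h1
  obtain ⟨C₂, hC₂⟩ := exists_lintegral_commKernel_le ha ha2 (s := σ * r' - a) (by linarith)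
    (by linarith)
  have q1 : 0 ≤ 1 / r := by positivity
  have q2 : 0 ≤ 1 / r' := by positivity
  refine ⟨C₁ ^ (1 / r) * C₂ ^ (1 / r'), fun g V hg hV => ?_⟩
  set K : E3 × E3 → ℝ≥0∞ := fun z => commKernel (wt a) z.1 z.2 * ENNReal.ofReal (wt (-a) z.2)
  have hK : Measurable K := by
    have := measurable_commKernel (measurable_wt a)
    have h2 : Measurable (fun z : E3 × E3 => ENNReal.ofReal (wt (-a) z.2)) :=
      ENNReal.measurable_ofReal.comp ((measurable_wt _).comp measurable_snd)
    exact this.mul h2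
  -- Schur's splitting: g(y) V(x) is written as G H with reciprocal factors w_σ(x)/w_σ(y), and
  -- Hölder is applied for the measure with density K.
  set G : E3 × E3 → ℝ≥0∞ := fun z => g z.2 * ENNReal.ofReal (wt σ z.1 * wt (-σ) z.2)
  set H : E3 × E3 → ℝ≥0∞ := fun z => V z.1 * ENNReal.ofReal (wt (-σ) z.1 * wt σ z.2)
  have hww (b c : ℝ) : Measurable (fun z : E3 × E3 => ENNReal.ofReal (wt b z.1 * wt c z.2)) :=
    ENNReal.measurable_ofReal.comp (((measurable_wt b).comp measurable_fst).mul
      ((measurable_wt c).comp measurable_snd))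
  have hG : AEMeasurable G (volume.prod volume) := hg.comp_snd.mul (hww _ _).aemeasurable
  have hH : AEMeasurable H (volume.prod volume) := hV.comp_fst.mul (hww _ _).aemeasurable
  set ν := (volume.prod volume : Measure (E3 × E3)).withDensity K
  have hac : ν ≪ volume.prod volume := withDensity_absolutelyContinuous _ _
  have hint (f : E3 × E3 → ℝ≥0∞) (hf : AEMeasurable f (volume.prod volume)) :
      ∫⁻ z, f z ∂ν = ∫⁻ z, K z * f z ∂(volume.prod volume) :=
    lintegral_withDensity_eq_lintegral_mul₀ hK.aemeasurable hf
  have hpp (b c : ℝ) (x y : E3) : 0 ≤ wt b x * wt c y := (mul_pos (wt_pos b x) (wt_pos c y)).le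
  have hGr : ∫⁻ z, G z ^ r ∂ν ≤ C₁ * ∫⁻ y, g y ^ r := by
    rw [hint _ (hG.pow_const r), lintegral_prod_symm (fun z => K z * G z ^ r) (hK.aemeasurable.mul (hG.pow_const r)),
      ← lintegral_const_mul' _ _ ENNReal.coe_ne_top]
    refine lintegral_mono fun y => ?_
    have e (x : E3) : K (x, y) * G (x, y) ^ r =
        g y ^ r * ENNReal.ofReal (wt (-a) y * wt (-σ * r) y) *
          (commKernel (wt a) y x * ENNReal.ofReal (wt (σ * r) x)) := by
      simp only [K, G]
      rw [ENNReal.mul_rpow_of_nonneg _ _ hr0.le,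
        ENNReal.ofReal_rpow_of_nonneg (hpp _ _ _ _) hr0.le,
        Real.mul_rpow (wt_pos _ _).le (wt_pos _ _).le, wt_rpow, wt_rpow, commKernel_comm,
        ENNReal.ofReal_mul (wt_pos _ _).le, ENNReal.ofReal_mul (wt_pos _ _).le]
      ring
    simp_rw [e]
    have hm : Measurable fun x => commKernel (wt a) y x * ENNReal.ofReal (wt (σ * r) x) := by
      have := (measurable_commKernel (measurable_wt a)).comp (measurable_prodMk_left (x := y))
      exact this.mul (ENNReal.measurable_ofReal.comp (measurable_wt _))
    rw [lintegral_const_mul _ hm]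
    calc _ ≤ g y ^ r * ENNReal.ofReal (wt (-a) y * wt (-σ * r) y) *
          (C₁ * ENNReal.ofReal (wt (a + σ * r) y)) := by gcongr; exact hC₁ y
      _ = C₁ * g y ^ r * ENNReal.ofReal (wt (-a) y * wt (-σ * r) y * wt (a + σ * r) y) := by
        rw [ENNReal.ofReal_mul (hpp _ _ _ _)]
        ring
      _ = _ := by
        rw [← wt_add, ← wt_add, show -a + -σ * r + (a + σ * r) = 0 by ring, wt_zero,
          ENNReal.ofReal_one, mul_one]
  have hHr : ∫⁻ z, H z ^ r' ∂ν ≤ C₂ * ∫⁻ x, V x ^ r' := by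
    rw [hint _ (hH.pow_const r'), lintegral_prod (fun z => K z * H z ^ r') (hK.aemeasurable.mul (hH.pow_const r')),
      ← lintegral_const_mul' _ _ ENNReal.coe_ne_top]
    refine lintegral_mono fun x => ?_
    have e (y : E3) : K (x, y) * H (x, y) ^ r' =
        V x ^ r' * ENNReal.ofReal (wt (-σ * r') x) *
          (commKernel (wt a) x y * ENNReal.ofReal (wt (σ * r' - a) y)) := by
      simp only [K, H]
      rw [ENNReal.mul_rpow_of_nonneg _ _ hr0'.le,
        ENNReal.ofReal_rpow_of_nonneg (hpp _ _ _ _) hr0'.le,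
        Real.mul_rpow (wt_pos _ _).le (wt_pos _ _).le, wt_rpow, wt_rpow,
        ENNReal.ofReal_mul (wt_pos _ _).le, sub_eq_add_neg, wt_add,
        ENNReal.ofReal_mul (wt_pos _ _).le]
      ring
    simp_rw [e]
    have hm : Measurable fun y => commKernel (wt a) x y * ENNReal.ofReal (wt (σ * r' - a) y) := by
      have := (measurable_commKernel (measurable_wt a)).comp (measurable_prodMk_left (x := x))
      exact this.mul (ENNReal.measurable_ofReal.comp (measurable_wt _))
    rw [lintegral_const_mul _ hm]
    calc _ ≤ V x ^ r' * ENNReal.ofReal (wt (-σ * r') x) *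
          (C₂ * ENNReal.ofReal (wt (a + (σ * r' - a)) x)) := by gcongr; exact hC₂ x
      _ = C₂ * V x ^ r' * ENNReal.ofReal (wt (-σ * r') x * wt (a + (σ * r' - a)) x) := by
        rw [ENNReal.ofReal_mul (wt_pos _ _).le]
        ring
      _ = _ := by
        rw [← wt_add, show -σ * r' + (a + (σ * r' - a)) = 0 by ring, wt_zero,
          ENNReal.ofReal_one, mul_one]
  have hmain := ENNReal.lintegral_mul_le_Lp_mul_Lq ν hr (hG.mono_ac hac) (hH.mono_ac hac)
  have hleft : ∫⁻ x, ∫⁻ y, commKernel (wt a) x y * ENNReal.ofReal (wt (-a) y) * g y * V x =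
      ∫⁻ z, (G * H) z ∂ν := by
    rw [hint _ (hG.mul hH), lintegral_prod (fun z => K z * (G * H) z) (hK.aemeasurable.mul (hG.mul hH))]
    congr 1; ext x; congr 1; ext y
    simp only [K, G, H, Pi.mul_apply]
    have : ENNReal.ofReal (wt σ x * wt (-σ) y) * ENNReal.ofReal (wt (-σ) x * wt σ y) = 1 := by
      rw [← ENNReal.ofReal_mul (hpp _ _ _ _),
        show wt σ x * wt (-σ) y * (wt (-σ) x * wt σ y) =
          (wt (-σ) x * wt σ x) * (wt (-σ) y * wt σ y) by ring, wt_neg_mul_self, wt_neg_mul_self,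
        one_mul, ENNReal.ofReal_one]
    calc _ = commKernel (wt a) x y * ENNReal.ofReal (wt (-a) y) * (g y * V x) * 1 := by ring
      _ = _ := by rw [← this]; ring
  rw [hleft]
  refine hmain.trans ?_
  calc _ ≤ (C₁ * ∫⁻ y, g y ^ r) ^ (1 / r) * (C₂ * ∫⁻ x, V x ^ r') ^ (1 / r') := by gcongr
    _ = _ := by
      rw [ENNReal.mul_rpow_of_nonneg _ _ q1, ENNReal.mul_rpow_of_nonneg _ _ q2,
        ENNReal.coe_mul, ENNReal.coe_rpow_of_nonneg _ q1, ENNReal.coe_rpow_of_nonneg _ q2]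
      ring

/-! ### Weighted Lebesgue norms and duality for R_i R_j. -/

/-- Both 0 and ⊤ have real part 0 under `toReal`, which is not a conjugate exponent. -/
lemma HolderConjugate.ne_zero_ne_top {p q : ℝ≥0∞} (h : p.toReal.HolderConjugate q.toReal) :
    p ≠ 0 ∧ p ≠ ⊤ := by
  have := h.pos
  constructor <;> rintro rfl <;> simp at this

lemma lintegral_enorm_mul_le {α : Type*} {_ : MeasurableSpace α} {μ : Measure α} {V W : Type*}
    [NormedAddCommGroup V] [NormedAddCommGroup W] {p q : ℝ≥0∞}
    (h : p.toReal.HolderConjugate q.toReal) {f : α → V} {g : α → W}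
    (hf : AEStronglyMeasurable f μ) (hg : AEStronglyMeasurable g μ) :
    ∫⁻ x, ‖f x‖ₑ * ‖g x‖ₑ ∂μ ≤ eLpNorm f p μ * eLpNorm g q μ := by
  obtain ⟨hp0, hpt⟩ := HolderConjugate.ne_zero_ne_top h
  obtain ⟨hq0, hqt⟩ := HolderConjugate.ne_zero_ne_top h.symm
  rw [eLpNorm_eq_lintegral_rpow_enorm_toReal hp0 hpt, eLpNorm_eq_lintegral_rpow_enorm_toReal hq0 hqt]
  exact ENNReal.lintegral_mul_le_Lp_mul_Lq μ h hf.enorm hg.enorm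

lemma measurable_weight (δ : ℝ) : Measurable (weight δ) := by
  unfold weight; fun_prop

lemma weight_pos (δ : ℝ) (x : E3) : 0 < weight δ x := by unfold weight; positivity

lemma volume_absolutelyContinuous_wMeasure (δ : ℝ) : (volume : Measure E3) ≪ wMeasure δ := by
  refine withDensity_absolutelyContinuous' (measurable_weight δ).ennreal_ofReal.aemeasurable ?_
  exact Eventually.of_forall fun x => by simpa using weight_pos δ x

lemma wMeasure_absolutelyContinuous_volume (δ : ℝ) : wMeasure δ ≪ (volume : Measure E3) :=
  withDensity_absolutelyContinuous _ _

lemma wt_le_weight {a : ℝ} (ha : 0 ≤ a) (x : E3) : wt a x ≤ √2 ^ a * weight a x := by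
  have h : 1 + ‖x‖ ≤ √2 * jb x := one_add_norm_le_sqrt_two_mul_sqrt x
  have hX := jb_pos x
  have h2 : (1 + ‖x‖) ^ a ≤ √2 ^ a * jb x ^ a := by
    rw [← Real.mul_rpow (by positivity) hX.le]
    gcongr
  rw [wt, weight, Real.rpow_neg hX.le, mul_one_div, le_div_iff₀ (by positivity),
    inv_mul_le_iff₀ (by positivity), mul_comm]
  exact h2

lemma weight_le_wt {a : ℝ} (ha : 0 ≤ a) (x : E3) : weight a x ≤ wt a x := by
  have h : jb x ≤ 1 + ‖x‖ := sqrt_one_add_norm_sq_le x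
  have hX := jb_pos x
  rw [wt, weight, Real.rpow_neg hX.le, one_div]
  gcongr

/-- A weight of order a p in the measure is the p-th power of a weight of order a on the function.
All spaces of the problem then carry simple orders: γ = (γ/2)·2, 3γ/2 = (γ/2)·3 and 6γ/5 = γ·(6/5).
-/
lemma eLpNorm_wMeasure {V : Type*} [NormedAddCommGroup V] [NormedSpace ℝ V] (a : ℝ) {p : ℝ≥0∞}
    (hp0 : p ≠ 0) (hpt : p ≠ ⊤) (f : E3 → V) :
    eLpNorm f p (wMeasure (a * p.toReal)) = eLpNorm (fun x => weight a x • f x) p volume := by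
  have hp : 0 < p.toReal := ENNReal.toReal_pos hp0 hpt
  rw [eLpNorm_eq_lintegral_rpow_enorm_toReal hp0 hpt, eLpNorm_eq_lintegral_rpow_enorm_toReal hp0 hpt,
    wMeasure, lintegral_withDensity_eq_lintegral_mul_non_measurable _
      (measurable_weight _).ennreal_ofReal (Eventually.of_forall fun x => ENNReal.ofReal_lt_top)]
  congr 2
  ext x
  rw [Pi.mul_apply, enorm_smul, ENNReal.mul_rpow_of_nonneg _ _ hp.le,
    Real.enorm_of_nonneg (weight_pos _ _).le,
    ENNReal.ofReal_rpow_of_nonneg (weight_pos _ _).le hp.le]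
  congr 2
  rw [weight, weight, Real.div_rpow zero_le_one (by positivity), Real.one_rpow,
    ← Real.rpow_mul (by positivity)]

lemma eLpNorm_wt_smul_le {V : Type*} [NormedAddCommGroup V] [NormedSpace ℝ V] {a : ℝ} (ha : 0 ≤ a)
    {p : ℝ≥0∞} (hp0 : p ≠ 0) (hpt : p ≠ ⊤) (f : E3 → V) :
    eLpNorm (fun x => wt a x • f x) p volume ≤
      ENNReal.ofReal (√2 ^ a) * eLpNorm f p (wMeasure (a * p.toReal)) := by
  rw [eLpNorm_wMeasure a hp0 hpt]
  refine eLpNorm_le_mul_eLpNorm_of_ae_le_mul (Eventually.of_forall fun x => ?_) p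
  rw [norm_smul, norm_smul, Real.norm_of_nonneg (wt_pos a x).le,
    Real.norm_of_nonneg (weight_pos a x).le, ← mul_assoc]
  gcongr
  exact wt_le_weight ha x

lemma eLpNorm_wMeasure_le {V : Type*} [NormedAddCommGroup V] [NormedSpace ℝ V] {a : ℝ} (ha : 0 ≤ a)
    {p : ℝ≥0∞} (hp0 : p ≠ 0) (hpt : p ≠ ⊤) (f : E3 → V) :
    eLpNorm f p (wMeasure (a * p.toReal)) ≤ eLpNorm (fun x => wt a x • f x) p volume := by
  rw [eLpNorm_wMeasure a hp0 hpt]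
  refine eLpNorm_mono fun x => ?_
  rw [norm_smul, norm_smul, Real.norm_of_nonneg (wt_pos a x).le,
    Real.norm_of_nonneg (weight_pos a x).le]
  gcongr
  exact weight_le_wt ha x

lemma MemLp.wt_smul {V : Type*} [NormedAddCommGroup V] [NormedSpace ℝ V] {a : ℝ} (ha : 0 ≤ a)
    {p : ℝ≥0∞} (hp0 : p ≠ 0) (hpt : p ≠ ⊤) {f : E3 → V} (hf : MemLp f p (wMeasure (a * p.toReal))) :
    MemLp (fun x => wt a x • f x) p volume :=
  ⟨(continuous_wt a).aestronglyMeasurable.smul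
    (hf.1.mono_ac (volume_absolutelyContinuous_wMeasure _)),
    (eLpNorm_wt_smul_le ha hp0 hpt f).trans_lt (ENNReal.mul_lt_top ENNReal.ofReal_lt_top hf.2)⟩

lemma memLp_of_bounded_of_memLp_two {h : E3 → ℝ} (h2 : MemLp h 2 volume) {C : ℝ}
    (hC : ∀ x, |h x| ≤ C) {q : ℝ≥0∞} (hq : 2 ≤ q.toReal) : MemLp h q volume := by
  have hq0 : 0 < q.toReal := by linarith
  have hqq : q ≠ 0 ∧ q ≠ ⊤ := by constructor <;> rintro rfl <;> simp at hq0
  refine ⟨h2.1, ?_⟩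
  rw [eLpNorm_lt_top_iff_lintegral_rpow_enorm_lt_top hqq.1 hqq.2]
  have h3 := (eLpNorm_lt_top_iff_lintegral_rpow_enorm_lt_top two_ne_zero ENNReal.ofNat_ne_top).1 h2.2
  have hle : ∫⁻ x, ‖h x‖ₑ ^ q.toReal ≤
      ENNReal.ofReal C ^ (q.toReal - 2) * ∫⁻ x, ‖h x‖ₑ ^ (2 : ℝ≥0∞).toReal := by
    rw [← lintegral_const_mul' _ _ (ENNReal.rpow_ne_top_of_nonneg (by linarith)
      ENNReal.ofReal_ne_top)]
    refine lintegral_mono fun x => ?_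
    rw [show (2 : ℝ≥0∞).toReal = 2 by norm_num]
    calc ‖h x‖ₑ ^ q.toReal = ‖h x‖ₑ ^ (q.toReal - 2) * ‖h x‖ₑ ^ (2 : ℝ) := by
          rw [← ENNReal.rpow_add_of_nonneg _ _ (by linarith) zero_le_two]
          ring_nf
      _ ≤ _ := by
          gcongr
          · rw [Real.enorm_eq_ofReal_abs]
            exact ENNReal.ofReal_le_ofReal (hC x)
  exact hle.trans_lt (ENNReal.mul_lt_top
    (ENNReal.rpow_lt_top_of_nonneg (by linarith) ENNReal.ofReal_ne_top) h3)

/-- Boundedness together with membership in L² suffices for q ≥ 2. Only finiteness of the norm is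
needed, to justify limits, so no L^q bound for R_i R_j is required. -/
lemma memLp_rieszRiesz (i j : Fin 3) {φ : E3 → ℝ} (hφ : IsTest φ) {q : ℝ≥0∞}
    (hq : 2 ≤ q.toReal) : MemLp (rieszRiesz i j φ) q volume := by
  obtain ⟨C, hC⟩ := exists_abs_rieszRiesz_le i j hφ
  refine memLp_of_bounded_of_memLp_two ⟨(measurable_rieszRiesz i j hφ).aestronglyMeasurable, ?_⟩
    hC hq
  exact (eLpNorm_rieszRiesz_le i j hφ).trans_lt
    (hφ.1.continuous.memLp_of_hasCompactSupport hφ.2).2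

/-- The bilinear estimate for `R_i R_j` acting on a weighted test function. -/
lemma exists_lintegral_mul_rieszRiesz_wt_le {a σ : ℝ} {p q : ℝ≥0∞} (ha : 0 < a) (ha2 : a ≤ 2)
    (hpq : p.toReal.HolderConjugate q.toReal) (hσ : 0 < σ) (h1 : a + σ * p.toReal < 3)
    (h2 : a < σ * q.toReal) (h3 : σ * q.toReal < 3) :
    ∃ C : ℝ≥0, ∀ i j (f V : E3 → ℝ), AEStronglyMeasurable f volume → IsTest V →
      ∫⁻ x, ‖f x‖ₑ * ‖rieszRiesz i j (fun y => wt a y * V y) x‖ₑ ≤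
        (∫⁻ x, ‖wt a x * f x‖ₑ * ‖rieszRiesz i j V x‖ₑ) +
        C * eLpNorm (fun x => wt a x * f x) p volume * eLpNorm V q volume := by
  obtain ⟨A, hA⟩ := exists_lintegral_commKernel_bilinear_le ha ha2 hpq hσ h1 h2 h3
  choose B hB using exists_enorm_rieszRiesz_commutator_le
  obtain ⟨hp0, hpt⟩ := HolderConjugate.ne_zero_ne_top hpq
  obtain ⟨hq0, hqt⟩ := HolderConjugate.ne_zero_ne_top hpq.symm
  refine ⟨(∑ i, ∑ j, B i j) * A, fun i j f V hf hV => ?_⟩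
  have hVm : AEMeasurable (fun x => ‖V x‖ₑ) := hV.1.continuous.aestronglyMeasurable.enorm
  have hB' : (B i j : ℝ≥0∞) ≤ ((∑ i, ∑ j, B i j : ℝ≥0) : ℝ≥0∞) := by
    have h1 : B i j ≤ ∑ j, B i j :=
      Finset.single_le_sum (f := fun j => B i j) (fun _ _ => zero_le) (Finset.mem_univ j)
    have h2 : ∑ j, B i j ≤ ∑ i, ∑ j, B i j :=
      Finset.single_le_sum (f := fun i => ∑ j, B i j) (fun _ _ => zero_le) (Finset.mem_univ i)
    exact_mod_cast h1.trans h2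
  have hbd (x : E3) : ‖f x‖ₑ * ‖rieszRiesz i j (fun y => wt a y * V y) x‖ₑ ≤
      ‖wt a x * f x‖ₑ * ‖rieszRiesz i j V x‖ₑ +
        ‖f x‖ₑ * (B i j * ∫⁻ y, commKernel (wt a) x y * ‖V y‖ₑ) := by
    have := hB i j (wt a) V (contDiff_wt a) hV x
    calc _ ≤ ‖f x‖ₑ * (‖wt a x * rieszRiesz i j V x‖ₑ +
          ‖rieszRiesz i j (fun y => wt a y * V y) x - wt a x * rieszRiesz i j V x‖ₑ) := by
          gcongr
          refine le_trans (le_of_eq ?_) (enorm_add_le _ _)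
          congr 1; ring
      _ ≤ ‖f x‖ₑ * (‖wt a x * rieszRiesz i j V x‖ₑ +
          B i j * ∫⁻ y, commKernel (wt a) x y * ‖V y‖ₑ) := by gcongr
      _ = _ := by
          rw [mul_add, enorm_mul, enorm_mul]
          ring
  refine (lintegral_mono hbd).trans ?_
  have hm0 : AEMeasurable (fun x => ‖wt a x * f x‖ₑ * ‖rieszRiesz i j V x‖ₑ) :=
    (((continuous_wt a).aestronglyMeasurable.mul hf).enorm).mul
      (measurable_rieszRiesz i j hV).enorm.aemeasurable
  rw [lintegral_add_left' hm0]
  gcongr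
  have hm : AEMeasurable (fun z : E3 × E3 => ‖f z.1‖ₑ * (commKernel (wt a) z.1 z.2 * ‖V z.2‖ₑ))
      (volume.prod volume) :=
    (hf.enorm.comp_fst).mul ((measurable_commKernel (measurable_wt a)).aemeasurable.mul hVm.comp_snd)
  have hcm (x : E3) : AEMeasurable (fun y => commKernel (wt a) x y * ‖V y‖ₑ) :=
    (((measurable_commKernel (measurable_wt a)).comp
      (measurable_prodMk_left (x := x))).aemeasurable).mul hVm
  have hg : AEMeasurable (fun x => ‖wt a x * f x‖ₑ) :=
    ((continuous_wt a).aestronglyMeasurable.mul hf).enorm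
  calc ∫⁻ x, ‖f x‖ₑ * (B i j * ∫⁻ y, commKernel (wt a) x y * ‖V y‖ₑ)
      = B i j * ∫⁻ x, ∫⁻ y, ‖f x‖ₑ * (commKernel (wt a) x y * ‖V y‖ₑ) := by
        rw [← lintegral_const_mul' _ _ ENNReal.coe_ne_top]
        congr 1; ext x
        rw [lintegral_const_mul'' _ (hcm x)]
        ring
    -- After exchanging the variables, 1 = w_{-a}(y) w_a(y) is inserted so that only the weighted f
    -- appears. This is the origin of the factor w_{-a} in the Schur kernel.
    _ = B i j * ∫⁻ x, ∫⁻ y, commKernel (wt a) x y * ENNReal.ofReal (wt (-a) y) *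
          ‖wt a y * f y‖ₑ * ‖V x‖ₑ := by
        rw [lintegral_lintegral_swap hm]
        congr 2; ext x; congr 1; ext y
        rw [commKernel_comm, enorm_mul, Real.enorm_of_nonneg (wt_pos a y).le]
        have : ENNReal.ofReal (wt (-a) y) * ENNReal.ofReal (wt a y) = 1 := by
          rw [← ENNReal.ofReal_mul (wt_pos _ _).le, wt_neg_mul_self, ENNReal.ofReal_one]
        calc _ = 1 * (‖f y‖ₑ * (commKernel (wt a) x y * ‖V x‖ₑ)) := by rw [one_mul]
          _ = _ := by rw [← this]; ring
    _ ≤ (∑ i, ∑ j, B i j : ℝ≥0) * (A * (∫⁻ y, ‖wt a y * f y‖ₑ ^ p.toReal) ^ (1 / p.toReal) *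
          (∫⁻ x, ‖V x‖ₑ ^ q.toReal) ^ (1 / q.toReal)) := by
        gcongr
        exact hA _ _ hg hVm
    _ = _ := by
        rw [eLpNorm_eq_lintegral_rpow_enorm_toReal hp0 hpt,
          eLpNorm_eq_lintegral_rpow_enorm_toReal hq0 hqt]
        push_cast
        ring

/-- Duality for `R_i R_j` on the weighted space `L^p_{w_{ap}}`, against a test function. -/
lemma exists_enorm_integral_isRieszRiesz_le {a σ : ℝ} {p q : ℝ≥0∞} (ha : 0 < a) (ha2 : a ≤ 2)
    (hpq : p.toReal.HolderConjugate q.toReal) (hq2 : 2 ≤ q.toReal) (hσ : 0 < σ)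
    (h1 : a + σ * p.toReal < 3) (h2 : a < σ * q.toReal) (h3 : σ * q.toReal < 3) :
    ∃ C : ℝ≥0, ∀ i j (f P V : E3 → ℝ), IsRieszRiesz p (a * p.toReal) i j f P → IsTest V →
      ‖∫ x, P x * (wt a x * V x)‖ₑ ≤
        eLpNorm (fun x => wt a x * f x) 2 volume * eLpNorm V 2 volume +
        C * eLpNorm (fun x => wt a x * f x) p volume * eLpNorm V q volume := by
  obtain ⟨C, hC⟩ := exists_lintegral_mul_rieszRiesz_wt_le ha ha2 hpq hσ h1 h2 h3
  obtain ⟨hp0, hpt⟩ := HolderConjugate.ne_zero_ne_top hpq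
  refine ⟨C, fun i j f P V hfP hV => ?_⟩
  obtain ⟨hf, hP, φ, hφ, hφf, hφP⟩ := hfP
  have hac := volume_absolutelyContinuous_wMeasure (a * p.toReal)
  have hfm : AEStronglyMeasurable f volume := hf.1.mono_ac hac
  have hPm : AEStronglyMeasurable P volume := hP.1.mono_ac hac
  have hwV : IsTest (fun x => wt a x * V x) := hV.mul_left (contDiff_wt a)
  have hVm : AEStronglyMeasurable V volume := hV.1.continuous.aestronglyMeasurable
  have hVL (r : ℝ≥0∞) : MemLp V r volume := hV.1.continuous.memLp_of_hasCompactSupport hV.2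
  have hRV : MemLp (rieszRiesz i j V) q volume := memLp_rieszRiesz i j hV hq2
  have hRwm := (measurable_rieszRiesz i j hwV).aestronglyMeasurable (μ := (volume : Measure E3))
  have hwm {g : E3 → ℝ} (hg : AEStronglyMeasurable g volume) :
      AEStronglyMeasurable (fun x => wt a x * g x) volume :=
    (continuous_wt a).aestronglyMeasurable.mul hg
  -- the two pairings, bounded in the weighted norm
  have hL (g : E3 → ℝ) (hg : AEStronglyMeasurable g volume) :
      ∫⁻ x, ‖g x * (wt a x * V x)‖ₑ ≤
        ENNReal.ofReal (√2 ^ a) * eLpNorm g p (wMeasure (a * p.toReal)) * eLpNorm V q volume := by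
    calc _ = ∫⁻ x, ‖wt a x * g x‖ₑ * ‖V x‖ₑ := by
          congr 1; ext x; rw [← enorm_mul]; ring_nf
      _ ≤ _ := lintegral_enorm_mul_le hpq (hwm hg) hVm
      _ ≤ _ := by gcongr; exact eLpNorm_wt_smul_le ha.le hp0 hpt g
  have hR (g : E3 → ℝ) (hg : AEStronglyMeasurable g volume) :
      ∫⁻ x, ‖g x * rieszRiesz i j (fun y => wt a y * V y) x‖ₑ ≤
        ENNReal.ofReal (√2 ^ a) * eLpNorm g p (wMeasure (a * p.toReal)) *
          (eLpNorm (rieszRiesz i j V) q volume + C * eLpNorm V q volume) := by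
    simp_rw [enorm_mul]
    refine (hC i j g V hg hV).trans ?_
    calc _ ≤ eLpNorm (fun x => wt a x * g x) p volume * eLpNorm (rieszRiesz i j V) q volume +
          C * eLpNorm (fun x => wt a x * g x) p volume * eLpNorm V q volume := by
          gcongr
          exact lintegral_enorm_mul_le hpq (hwm hg) hRV.1
      _ = eLpNorm (fun x => wt a x * g x) p volume *
          (eLpNorm (rieszRiesz i j V) q volume + C * eLpNorm V q volume) := by ring
      _ ≤ _ := by gcongr; exact eLpNorm_wt_smul_le ha.le hp0 hpt g
  -- Convergence in the weighted L^p norm passes to a pairing with h as soon as the pairing is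
  -- bounded by that norm. It is applied once with h = w V and once with h = R_i R_j (w V).
  have hlimit (g : ℕ → E3 → ℝ) (G h : E3 → ℝ) (D : ℝ≥0∞) (hD : D ≠ ⊤)
      (hgm : ∀ n, AEStronglyMeasurable (g n) volume) (hG : MemLp G p (wMeasure (a * p.toReal)))
      (hGm : AEStronglyMeasurable G volume)
      (hg : Tendsto (fun n => eLpNorm (fun x => g n x - G x) p (wMeasure (a * p.toReal))) atTop
        (𝓝 0)) (hh : AEStronglyMeasurable h volume)
      (hb : ∀ k : E3 → ℝ, AEStronglyMeasurable k volume →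
        ∫⁻ x, ‖k x * h x‖ₑ ≤ ENNReal.ofReal (√2 ^ a) * eLpNorm k p (wMeasure (a * p.toReal)) * D) :
      Tendsto (fun n => ∫ x, g n x * h x) atTop (𝓝 (∫ x, G x * h x)) := by
    have hGi : Integrable (fun x => G x * h x) :=
      ⟨hGm.mul hh, (hb G hGm).trans_lt (ENNReal.mul_lt_top (ENNReal.mul_lt_top
        ENNReal.ofReal_lt_top hG.2) hD.lt_top)⟩
    have ht : Tendsto (fun n => ∫⁻ x, ‖g n x * h x - G x * h x‖ₑ) atTop (𝓝 0) := by
      have h0 : Tendsto (fun n => ENNReal.ofReal (√2 ^ a) *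
          eLpNorm (fun x => g n x - G x) p (wMeasure (a * p.toReal)) * D) atTop (𝓝 0) := by
        have := (ENNReal.Tendsto.const_mul (a := ENNReal.ofReal (√2 ^ a)) hg
          (Or.inr ENNReal.ofReal_ne_top))
        simpa using ENNReal.Tendsto.mul_const this (Or.inr hD)
      refine tendsto_of_tendsto_of_tendsto_of_le_of_le tendsto_const_nhds h0
        (fun n => zero_le) (fun n => ?_)
      refine le_trans (le_of_eq ?_) (hb _ ((hgm n).sub hGm))
      congr 1; ext x
      simp only [sub_mul]
    have hgi : ∀ᶠ n in atTop, Integrable (fun x => g n x * h x) := by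
      filter_upwards [ht.eventually (gt_mem_nhds one_pos)] with n hn
      have : Integrable (fun x => g n x * h x - G x * h x) :=
        ⟨((hgm n).mul hh).sub hGi.1, hn.trans ENNReal.one_lt_top⟩
      refine (this.add hGi).congr (Eventually.of_forall fun x => ?_)
      simp
    exact tendsto_integral_of_L1 _ hGi.1 hgi ht
  have hlim1 := hlimit (fun n => rieszRiesz i j (φ n)) P (fun x => wt a x * V x) _
    (hVL q).2.ne (fun n => (measurable_rieszRiesz i j (hφ n)).aestronglyMeasurable) hP hPm hφP
    (hwm hVm) hL
  have hlim2 := hlimit φ f (rieszRiesz i j (fun y => wt a y * V y)) _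
    (ENNReal.add_ne_top.2 ⟨hRV.2.ne, ENNReal.mul_ne_top ENNReal.coe_ne_top (hVL q).2.ne⟩)
    (fun n => (hφ n).1.continuous.aestronglyMeasurable) hf hfm hφf hRwm hR
  -- Symmetry holds for test functions and extends by density. The operator now acts on the smooth w
  -- V, where the commutator estimate is available.
  have heq : ∫ x, P x * (wt a x * V x) = ∫ x, f x * rieszRiesz i j (fun y => wt a y * V y) x := by
    refine tendsto_nhds_unique hlim1 (hlim2.congr fun n => ?_)
    exact (integral_rieszRiesz_mul i j (hφ n) hwV).symm
  rw [heq]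
  refine (enorm_integral_le_lintegral_enorm _).trans ?_
  simp_rw [enorm_mul (f _)]
  refine (hC i j f V hfm hV).trans ?_
  gcongr
  have h22 : (2 : ℝ≥0∞).toReal.HolderConjugate (2 : ℝ≥0∞).toReal := by
    simpa using Real.HolderConjugate.two_two
  calc _ ≤ _ := lintegral_enorm_mul_le h22 (hwm hfm)
        (measurable_rieszRiesz i j hV).aestronglyMeasurable
    _ ≤ _ := by gcongr; exact eLpNorm_rieszRiesz_le i j hV

/-! ### Mollifiers, used both in space and in time. -/

/-- A sequence of bump functions shrinking to the origin. -/
def mollBump (E : Type*) [NormedAddCommGroup E] [NormedSpace ℝ E] [HasContDiffBump E] (n : ℕ) :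
    ContDiffBump (0 : E) :=
  ⟨1 / (2 * (n + 1)), 1 / (n + 1), by positivity, by
    apply one_div_lt_one_div_of_lt <;> linarith [show (0 : ℝ) ≤ n by positivity]⟩

set_option linter.unusedSectionVars false

section Moll

variable {E : Type*} [NormedAddCommGroup E] [NormedSpace ℝ E] [FiniteDimensional ℝ E]
  [MeasurableSpace E] [BorelSpace E] [HasContDiffBump E] (μ : Measure E) [μ.IsAddHaarMeasure]

/-- The standard mollifiers. -/
def mollKer (n : ℕ) : E → ℝ := (mollBump E n).normed μ

/-- Regularization by convolution with the standard mollifiers. -/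
def moll (n : ℕ) (g : E → ℝ) : E → ℝ := mollKer μ n ⋆[ContinuousLinearMap.lsmul ℝ ℝ, μ] g

lemma contDiff_mollKer (n : ℕ) : ContDiff ℝ ∞ (mollKer μ n) := (mollBump E n).contDiff_normed

lemma hasCompactSupport_mollKer (n : ℕ) : HasCompactSupport (mollKer μ n) :=
  (mollBump E n).hasCompactSupport_normed

lemma mollKer_nonneg (n : ℕ) (x : E) : 0 ≤ mollKer μ n x := (mollBump E n).nonneg_normed x

lemma integral_mollKer (n : ℕ) : ∫ x, mollKer μ n x ∂μ = 1 := (mollBump E n).integral_normed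

lemma mollKer_eq_zero {n : ℕ} {x : E} (h : 1 / ((n : ℝ) + 1) ≤ ‖x‖) : mollKer μ n x = 0 := by
  have hs : Function.support (mollKer μ n) = Metric.ball 0 (mollBump E n).rOut :=
    (mollBump E n).support_normed_eq
  by_contra hne
  have : x ∈ Function.support (mollKer μ n) := hne
  rw [hs, mem_ball_zero_iff] at this
  exact absurd this (not_lt.2 h)

lemma tendsto_mollBump_rOut : Tendsto (fun n => (mollBump E n).rOut) atTop (𝓝 0) :=
  tendsto_one_div_add_atTop_nhds_zero_nat

lemma ae_tendsto_moll {g : E → ℝ} (hg : LocallyIntegrable g μ) :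
    ∀ᵐ x ∂μ, Tendsto (fun n => moll μ n g x) atTop (𝓝 (g x)) := by
  -- The ratio of outer to inner radius is exactly 2; Lebesgue differentiation requires that it stay
  -- bounded.
  refine ContDiffBump.ae_convolution_tendsto_right_of_locallyIntegrable (K := 2)
    (φ := fun n => mollBump E n) tendsto_mollBump_rOut (Eventually.of_forall fun n => ?_) hg
  change 1 / ((n : ℝ) + 1) ≤ 2 * (1 / (2 * (n + 1)))
  apply le_of_eq
  field_simp

lemma moll_apply (n : ℕ) (g : E → ℝ) (x : E) :
    moll μ n g x = ∫ y, mollKer μ n (x - y) * g y ∂μ := by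
  rw [moll, convolution_lsmul_swap]
  rfl

lemma moll_apply' (n : ℕ) (g : E → ℝ) (x : E) :
    moll μ n g x = ∫ t, mollKer μ n t * g (x - t) ∂μ := rfl

lemma contDiff_moll (n : ℕ) {g : E → ℝ} (hg : LocallyIntegrable g μ) :
    ContDiff ℝ ∞ (moll μ n g) :=
  (hasCompactSupport_mollKer μ n).contDiff_convolution_left _ (contDiff_mollKer μ n) hg

lemma convolutionExists_moll (n : ℕ) {g : E → ℝ} (hg : LocallyIntegrable g μ) (x : E) :
    Integrable (fun y => mollKer μ n (x - y) * g y) μ := by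
  have h := ((hasCompactSupport_mollKer μ n).convolutionExists_left (ContinuousLinearMap.lsmul ℝ ℝ)
    (contDiff_mollKer μ n).continuous hg x).integrable_swap
  exact h

lemma moll_sub (n : ℕ) {g h : E → ℝ} (hg : LocallyIntegrable g μ) (hh : LocallyIntegrable h μ)
    (x : E) : moll μ n (fun y => g y - h y) x = moll μ n g x - moll μ n h x := by
  simp_rw [moll_apply, mul_sub]
  exact integral_sub (convolutionExists_moll μ n hg x) (convolutionExists_moll μ n hh x)

/-- Young's inequality for mollifiers, in `L²`. -/
lemma eLpNorm_moll_le (n : ℕ) {g : E → ℝ} (hg : AEStronglyMeasurable g μ) :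
    eLpNorm (moll μ n g) 2 μ ≤ eLpNorm g 2 μ := by
  have hk : Measurable (fun t : E => ENNReal.ofReal (mollKer μ n t)) :=
    (contDiff_mollKer μ n).continuous.measurable.ennreal_ofReal
  have hk1 : ∫⁻ t, ENNReal.ofReal (mollKer μ n t) ∂μ = 1 := by
    rw [← ofReal_integral_eq_lintegral_ofReal, integral_mollKer, ENNReal.ofReal_one]
    · exact (contDiff_mollKer μ n).continuous.integrable_of_hasCompactSupport
        (hasCompactSupport_mollKer μ n)
    · exact Eventually.of_forall (mollKer_nonneg μ n)
  have hpt (x : E) : ‖moll μ n g x‖ₑ ^ (2 : ℝ) ≤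
      ∫⁻ t, ENNReal.ofReal (mollKer μ n t) * ‖g (x - t)‖ₑ ^ (2 : ℝ) ∂μ := by
    have hgx : AEMeasurable (fun t => ‖g (x - t)‖ₑ) μ :=
      (hg.comp_quasiMeasurePreserving (quasiMeasurePreserving_sub_left μ x)).enorm
    have h1 : ‖moll μ n g x‖ₑ ≤ ∫⁻ t, ENNReal.ofReal (mollKer μ n t) * ‖g (x - t)‖ₑ ∂μ := by
      rw [moll_apply']
      refine (enorm_integral_le_lintegral_enorm _).trans (le_of_eq ?_)
      congr 1; ext t
      rw [enorm_mul, Real.enorm_of_nonneg (mollKer_nonneg μ n t)]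
    -- Cauchy–Schwarz with the kernel split as k^(1/2) · k^(1/2). Since ∫ k = 1, one factor
    -- disappears.
    have h2 := ENNReal.lintegral_mul_le_Lp_mul_Lq μ Real.HolderConjugate.two_two
      (f := fun t => ENNReal.ofReal (mollKer μ n t) ^ (1 / 2 : ℝ))
      (g := fun t => ENNReal.ofReal (mollKer μ n t) ^ (1 / 2 : ℝ) * ‖g (x - t)‖ₑ)
      (hk.pow_const _).aemeasurable ((hk.pow_const _).aemeasurable.mul hgx)
    have e1 : (fun t => ENNReal.ofReal (mollKer μ n t) ^ (1 / 2 : ℝ)) *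
        (fun t => ENNReal.ofReal (mollKer μ n t) ^ (1 / 2 : ℝ) * ‖g (x - t)‖ₑ) =
        fun t => ENNReal.ofReal (mollKer μ n t) * ‖g (x - t)‖ₑ := by
      ext t
      rw [Pi.mul_apply, ← mul_assoc, ← ENNReal.rpow_add_of_nonneg _ _ (by norm_num) (by norm_num)]
      norm_num
    rw [e1] at h2
    have e2 (t : E) : (ENNReal.ofReal (mollKer μ n t) ^ (1 / 2 : ℝ)) ^ (2 : ℝ) =
        ENNReal.ofReal (mollKer μ n t) := by
      rw [← ENNReal.rpow_mul]; norm_num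
    simp_rw [ENNReal.mul_rpow_of_nonneg _ _ zero_le_two, e2, hk1, ENNReal.one_rpow, one_mul] at h2
    calc _ ≤ ((∫⁻ t, ENNReal.ofReal (mollKer μ n t) * ‖g (x - t)‖ₑ ^ (2 : ℝ) ∂μ) ^ (1 / 2 : ℝ)) ^
          (2 : ℝ) := by gcongr; exact h1.trans h2
      _ = _ := by rw [← ENNReal.rpow_mul]; norm_num
  rw [eLpNorm_eq_lintegral_rpow_enorm_toReal two_ne_zero ENNReal.ofNat_ne_top,
    eLpNorm_eq_lintegral_rpow_enorm_toReal two_ne_zero ENNReal.ofNat_ne_top]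
  simp only [ENNReal.toReal_ofNat]
  gcongr ?_ ^ _
  have hg2 : AEMeasurable (fun z : E × E => ENNReal.ofReal (mollKer μ n z.2) *
      ‖g (z.1 - z.2)‖ₑ ^ (2 : ℝ)) (μ.prod μ) :=
    (hk.comp measurable_snd).aemeasurable.mul ((hg.comp_quasiMeasurePreserving
      (quasiMeasurePreserving_sub_of_right_invariant μ μ)).enorm.pow_const _)
  calc _ ≤ ∫⁻ x, ∫⁻ t, ENNReal.ofReal (mollKer μ n t) * ‖g (x - t)‖ₑ ^ (2 : ℝ) ∂μ ∂μ :=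
        lintegral_mono hpt
    _ = ∫⁻ t, ENNReal.ofReal (mollKer μ n t) * ∫⁻ x, ‖g x‖ₑ ^ (2 : ℝ) ∂μ ∂μ := by
        rw [lintegral_lintegral_swap hg2]
        congr 1; ext t
        rw [lintegral_const_mul' _ _ ENNReal.ofReal_ne_top,
          lintegral_sub_right_eq_self (fun x => ‖g x‖ₑ ^ (2 : ℝ)) t]
    _ = _ := by rw [lintegral_mul_const _ hk, hk1, one_mul]

/-- Uniform continuity makes the difference uniformly small, and it vanishes off a fixed ball
because the mollifier radii are at most 1. -/
lemma tendsto_eLpNorm_moll_sub_of_test {φ : E → ℝ} (hφ : Continuous φ)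
    (hφc : HasCompactSupport φ) :
    Tendsto (fun n => eLpNorm (fun x => moll μ n φ x - φ x) 2 μ) atTop (𝓝 0) := by
  obtain ⟨R, hR⟩ := hφc.isCompact.isBounded.subset_closedBall (0 : E)
  have hK : IsCompact (Metric.closedBall (0 : E) (R + 1)) := isCompact_closedBall _ _
  have huc := hφc.uniformContinuous_of_continuous hφ
  have hfin : μ (Metric.closedBall (0 : E) (R + 1)) ^ (1 / (2 : ℝ)) ≠ ⊤ :=
    ENNReal.rpow_ne_top_of_nonneg (by norm_num) hK.measure_lt_top.ne
  rw [ENNReal.tendsto_nhds_zero]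
  intro ε hε
  obtain ⟨δ, hδ0, hδ⟩ : ∃ δ : ℝ, 0 < δ ∧
      μ (Metric.closedBall (0 : E) (R + 1)) ^ (1 / (2 : ℝ)) * ENNReal.ofReal δ ≤ ε := by
    have : Tendsto (fun δ : ℝ => μ (Metric.closedBall (0 : E) (R + 1)) ^ (1 / (2 : ℝ)) *
        ENNReal.ofReal δ) (𝓝[>] 0) (𝓝 0) := by
      have h1 : Tendsto ENNReal.ofReal (𝓝[>] 0) (𝓝 0) := by
        simpa using (ENNReal.tendsto_ofReal (tendsto_id (x := 𝓝 (0 : ℝ)))).mono_left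
          nhdsWithin_le_nhds
      simpa using ENNReal.Tendsto.const_mul h1 (Or.inr hfin)
    obtain ⟨δ, h1, h2⟩ := ((this.eventually (ge_mem_nhds hε)).and self_mem_nhdsWithin).exists
    exact ⟨δ, h2, h1⟩
  obtain ⟨η, hη0, hη⟩ := Metric.uniformContinuous_iff.1 huc δ hδ0
  have hev : ∀ᶠ n in atTop, (mollBump E n).rOut < η :=
    tendsto_mollBump_rOut.eventually (gt_mem_nhds hη0)
  filter_upwards [hev] with n hn
  have hsm : ∀ x, dist (moll μ n φ x) (φ x) ≤ δ := fun x =>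
    (mollBump E n).dist_normed_convolution_le hφ.aestronglyMeasurable fun y hy =>
      (hη (lt_of_lt_of_le hy hn.le)).le
  have hr1 : (mollBump E n).rOut ≤ 1 := by
    change 1 / ((n : ℝ) + 1) ≤ 1
    rw [div_le_one (by positivity)]; linarith [show (0 : ℝ) ≤ n by positivity]
  have hz (x : E) (hx : x ∉ Metric.closedBall (0 : E) (R + 1)) : moll μ n φ x - φ x = 0 := by
    rw [mem_closedBall_zero_iff, not_le] at hx
    have hφ0 (y : E) (hy : R < ‖y‖) : φ y = 0 := by
      by_contra h
      exact absurd (mem_closedBall_zero_iff.1 (hR (subset_tsupport φ h))) (not_le.2 hy)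
    rw [hφ0 x (by linarith), sub_zero, moll_apply']
    refine integral_eq_zero_of_ae (Eventually.of_forall fun t => ?_)
    by_cases ht : 1 / ((n : ℝ) + 1) ≤ ‖t‖
    · simp [mollKer_eq_zero μ ht]
    · have : ‖x‖ ≤ ‖x - t‖ + ‖t‖ := norm_le_norm_sub_add x t
      have h1 : ‖t‖ < 1 := lt_of_lt_of_le (not_le.1 ht) hr1
      simp [hφ0 (x - t) (by linarith)]
  have heq : (fun x => moll μ n φ x - φ x) =
      (Metric.closedBall (0 : E) (R + 1)).indicator (fun x => moll μ n φ x - φ x) := by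
    ext x
    by_cases hx : x ∈ Metric.closedBall (0 : E) (R + 1)
    · rw [indicator_of_mem hx]
    · rw [indicator_of_notMem hx, hz x hx]
  rw [heq, eLpNorm_indicator_eq_eLpNorm_restrict hK.measurableSet]
  refine (eLpNorm_le_of_ae_bound (C := δ) (Eventually.of_forall fun x => ?_)).trans ?_
  · rw [← dist_eq_norm]; exact hsm x
  · rw [Measure.restrict_apply_univ]
    simpa using hδ

/-- Density of continuous compactly supported functions, together with the contraction property of
mollification, gives three errors of size ε/3. -/
lemma tendsto_eLpNorm_moll_sub {g : E → ℝ} (hg : MemLp g 2 μ) :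
    Tendsto (fun n => eLpNorm (fun x => moll μ n g x - g x) 2 μ) atTop (𝓝 0) := by
  rw [ENNReal.tendsto_nhds_zero]
  intro ε hε
  have hε3 : ε / 3 ≠ 0 := (ENNReal.div_pos hε.ne' (by norm_num)).ne'
  obtain ⟨φ, hφc, hφε, hφ, hφm⟩ :=
    hg.exists_hasCompactSupport_eLpNorm_sub_le ENNReal.ofNat_ne_top hε3
  have hgl := hg.locallyIntegrable (by norm_num)
  have hφl := hφm.locallyIntegrable (by norm_num)
  filter_upwards [ENNReal.tendsto_nhds_zero.1 (tendsto_eLpNorm_moll_sub_of_test μ hφ hφc) (ε / 3)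
    (pos_iff_ne_zero.2 hε3)] with n hn
  have h1 : eLpNorm (moll μ n (fun y => g y - φ y)) 2 μ ≤ ε / 3 :=
    (eLpNorm_moll_le μ n (hg.1.sub hφm.1)).trans hφε
  have hdec : (fun x => moll μ n g x - g x) = (moll μ n (fun y => g y - φ y) +
      fun x => moll μ n φ x - φ x) - (g - φ) := by
    ext x
    simp only [Pi.sub_apply, Pi.add_apply, moll_sub μ n hgl hφl]
    ring
  have m1 : AEStronglyMeasurable (moll μ n (fun y => g y - φ y)) μ :=
    (contDiff_moll μ n (hgl.sub hφl)).continuous.aestronglyMeasurable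
  have m2 : AEStronglyMeasurable (fun x => moll μ n φ x - φ x) μ :=
    ((contDiff_moll μ n hφl).continuous.sub hφ).aestronglyMeasurable
  rw [hdec]
  refine (eLpNorm_sub_le (m1.add m2) (hg.1.sub hφm.1) (by norm_num)).trans ?_
  calc _ ≤ (ε / 3 + ε / 3) + ε / 3 := by
        gcongr
        exact (eLpNorm_add_le m1 m2 (by norm_num)).trans (add_le_add h1 hn)
    _ = ε := ENNReal.add_thirds ε

/-- Local `L²` convergence of mollifications. -/
lemma tendsto_eLpNorm_mul_moll_sub {g θ : E → ℝ}
    (hg2 : ∀ R, MemLp ((Metric.closedBall (0 : E) R).indicator g) 2 μ) (hθ : Continuous θ)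
    (hθc : HasCompactSupport θ) :
    Tendsto (fun n => eLpNorm (fun x => θ x * moll μ n g x - θ x * g x) 2 μ) atTop (𝓝 0) := by
  obtain ⟨R, hR⟩ := hθc.isCompact.isBounded.subset_closedBall (0 : E)
  obtain ⟨M, hM⟩ := hθ.bounded_above_of_compact_support hθc
  -- The mollifier radii are at most 1, so truncating g to the ball of radius R + 1 changes neither
  -- g nor its mollification on the support of θ.
  set g' := (Metric.closedBall (0 : E) (R + 1)).indicator g with hg'
  have hle (n : ℕ) : eLpNorm (fun x => θ x * moll μ n g x - θ x * g x) 2 μ ≤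
      ENNReal.ofReal M * eLpNorm (fun x => moll μ n g' x - g' x) 2 μ := by
    refine eLpNorm_le_mul_eLpNorm_of_ae_le_mul (Eventually.of_forall fun x => ?_) 2
    by_cases hx : x ∈ tsupport θ
    · have hxR : ‖x‖ ≤ R := mem_closedBall_zero_iff.1 (hR hx)
      have e1 : g' x = g x := indicator_of_mem (mem_closedBall_zero_iff.2 (by linarith)) _
      have e2 : moll μ n g' x = moll μ n g x := by
        rw [moll_apply', moll_apply']
        congr 1; ext t
        by_cases ht : 1 / ((n : ℝ) + 1) ≤ ‖t‖
        · simp [mollKer_eq_zero μ ht]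
        · have hr1 : 1 / ((n : ℝ) + 1) ≤ 1 := by
            rw [div_le_one (by positivity)]; linarith [show (0 : ℝ) ≤ n by positivity]
          have h1 : ‖t‖ < 1 := lt_of_lt_of_le (not_le.1 ht) hr1
          have h2 : ‖x - t‖ ≤ R + 1 := (norm_sub_le x t).trans (by linarith)
          rw [hg', indicator_of_mem (mem_closedBall_zero_iff.2 h2)]
      rw [e1, e2, ← mul_sub, norm_mul]
      gcongr
      exact hM x
    · simp only [image_eq_zero_of_notMem_tsupport hx, zero_mul, sub_zero, norm_zero]
      have : 0 ≤ M := (norm_nonneg _).trans (hM 0)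
      positivity
  refine tendsto_of_tendsto_of_tendsto_of_le_of_le tendsto_const_nhds ?_ (fun n => zero_le) hle
  simpa using ENNReal.Tendsto.const_mul (tendsto_eLpNorm_moll_sub μ (hg2 (R + 1)))
    (Or.inr ENNReal.ofReal_ne_top)

end Moll

/-! ### The Sobolev inequality and approximation by test functions. -/

/-- Partial derivatives of functions on `ℝ³`. -/
def pd (i : Fin 3) (φ : E3 → ℝ) (x : E3) : ℝ := fderiv ℝ φ x (EuclideanSpace.single i 1)

lemma norm_clm_le_sum (L : E3 →L[ℝ] ℝ) : ‖L‖ ≤ ∑ i, ‖L (EuclideanSpace.single i 1)‖ := by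
  refine L.opNorm_le_bound (Finset.sum_nonneg fun i _ => norm_nonneg _) fun v => ?_
  have hv : v = ∑ i, v i • EuclideanSpace.single i (1 : ℝ) := by
    ext j
    simp [Pi.single_apply]
  conv_lhs => rw [hv, map_sum]
  rw [Finset.sum_mul]
  refine (norm_sum_le _ _).trans (Finset.sum_le_sum fun i _ => ?_)
  rw [map_smul, norm_smul, mul_comm]
  gcongr
  exact PiLp.norm_apply_le v i

lemma continuous_pd (i : Fin 3) {φ : E3 → ℝ} (hφ : ContDiff ℝ ∞ φ) : Continuous (pd i φ) :=
  (hφ.continuous_fderiv (by simp)).clm_apply continuous_const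

lemma contDiff_pd (i : Fin 3) {φ : E3 → ℝ} (hφ : ContDiff ℝ ∞ φ) : ContDiff ℝ ∞ (pd i φ) :=
  (hφ.fderiv_right (m := ∞) (by simp)).clm_apply contDiff_const

lemma hasCompactSupport_pd (i : Fin 3) {φ : E3 → ℝ} (hφ : HasCompactSupport φ) :
    HasCompactSupport (pd i φ) :=
  (hφ.fderiv (𝕜 := ℝ)).comp_left (g := fun L : E3 →L[ℝ] ℝ => L (EuclideanSpace.single i 1)) rfl

lemma IsTest.pd {φ : E3 → ℝ} (hφ : IsTest φ) (i : Fin 3) : IsTest (pd i φ) :=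
  ⟨contDiff_pd i hφ.1, hasCompactSupport_pd i hφ.2⟩

lemma pd_mul (i : Fin 3) {φ ψ : E3 → ℝ} (hφ : ContDiff ℝ ∞ φ) (hψ : ContDiff ℝ ∞ ψ) (x : E3) :
    pd i (fun y => φ y * ψ y) x = pd i φ x * ψ x + φ x * pd i ψ x := by
  have h1 := (hφ.differentiable (by simp)) x
  have h2 := (hψ.differentiable (by simp)) x
  rw [pd, fderiv_fun_mul h1 h2]
  simp only [add_apply, smul_apply, smul_eq_mul, pd]
  ring

lemma pd_sub (i : Fin 3) {φ ψ : E3 → ℝ} (hφ : ContDiff ℝ ∞ φ) (hψ : ContDiff ℝ ∞ ψ) (x : E3) :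
    pd i (fun y => φ y - ψ y) x = pd i φ x - pd i ψ x := by
  have h1 := (hφ.differentiable (by simp)) x
  have h2 := (hψ.differentiable (by simp)) x
  rw [pd, fderiv_fun_sub h1 h2]
  rfl

/-- The Sobolev inequality `‖W‖₆ ≤ C ‖∇W‖₂` for test functions. -/
lemma exists_eLpNorm_six_le : ∃ S : ℝ≥0, ∀ W : E3 → ℝ, IsTest W →
    eLpNorm W 6 volume ≤ S * ∑ i, eLpNorm (pd i W) 2 volume := by
  refine ⟨SNormLESNormFDerivOfEqConst ℝ (volume : Measure E3) 2, fun W hW => ?_⟩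
  have h := eLpNorm_le_eLpNorm_fderiv_of_eq (volume : Measure E3) (hW.1.of_le (by simp)) hW.2
    (p := 2) (p' := 6) (by norm_num) (by simp) (by
      rw [finrank_euclideanSpace_fin]; norm_num)
  refine h.trans (mul_le_mul_right ?_ _)
  calc eLpNorm (fderiv ℝ W) (2 : ℝ≥0) volume
      ≤ eLpNorm (fun x => ∑ i, ‖pd i W x‖) 2 volume :=
        eLpNorm_mono_real fun x => norm_clm_le_sum _
    _ ≤ ∑ i, eLpNorm (fun x => ‖pd i W x‖) 2 volume := by
        have := eLpNorm_sum_le (μ := (volume : Measure E3)) (p := 2) (s := Finset.univ)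
          (f := fun i x => ‖pd i W x‖)
          (fun i _ => (continuous_pd i hW.1).norm.aestronglyMeasurable) (by norm_num)
        refine le_trans (le_of_eq ?_) this
        congr 1
    _ = _ := by simp_rw [eLpNorm_norm]

/-- `D = ∇U` after regularization by the standard mollifiers. -/
def HasMollGrad (U : E3 → ℝ) (D : Fin 3 → E3 → ℝ) : Prop :=
  ∀ n i x, pd i (moll volume n U) x = moll volume n (D i) x

lemma aestronglyMeasurable_of_wt {a : ℝ} {g : E3 → ℝ}
    (hg : AEStronglyMeasurable (fun x => wt a x * g x) volume) : AEStronglyMeasurable g volume := by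
  refine ((continuous_wt (-a)).aestronglyMeasurable.mul hg).congr (Eventually.of_forall fun x => ?_)
  simp only [Pi.mul_apply]
  rw [← mul_assoc, wt_neg_mul_self, one_mul]

lemma memLp_indicator_of_memLp_wt {a : ℝ} (ha : 0 ≤ a) {p : ℝ≥0∞} {g : E3 → ℝ}
    (hg : MemLp (fun x => wt a x * g x) p volume) (R : ℝ) :
    MemLp ((Metric.closedBall (0 : E3) R).indicator g) p volume := by
  refine (hg.const_mul ((1 + |R|) ^ a)).mono
    ((aestronglyMeasurable_of_wt hg.1).indicator Metric.isClosed_closedBall.measurableSet)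
    (Eventually.of_forall fun x => ?_)
  by_cases hx : x ∈ Metric.closedBall (0 : E3) R
  · rw [indicator_of_mem hx, norm_mul, norm_mul, Real.norm_of_nonneg (wt_pos a x).le,
      Real.norm_of_nonneg (show 0 ≤ (1 + |R|) ^ a by positivity), ← mul_assoc]
    have h1 : jb x ≤ 1 + |R| := (sqrt_one_add_norm_sq_le x).trans
      (by linarith [mem_closedBall_zero_iff.1 hx, le_abs_self R])
    have h2 : 1 ≤ (1 + |R|) ^ a * wt a x := by
      rw [wt, Real.rpow_neg (jb_pos x).le, ← div_eq_mul_inv, one_le_div (Real.rpow_pos_of_pos (jb_pos x) a)]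
      exact Real.rpow_le_rpow (jb_pos x).le h1 ha
    exact le_mul_of_one_le_left (norm_nonneg _) h2
  · rw [indicator_of_notMem hx, norm_zero]
    exact norm_nonneg _

lemma locallyIntegrable_of_memLp_wt {a : ℝ} (ha : 0 ≤ a) {p : ℝ≥0∞} (hp : 1 ≤ p) {g : E3 → ℝ}
    (hg : MemLp (fun x => wt a x * g x) p volume) : LocallyIntegrable g volume := by
  rw [locallyIntegrable_iff]
  intro K hK
  obtain ⟨R, hR⟩ := hK.isBounded.subset_closedBall (0 : E3)
  have h := (memLp_indicator_of_memLp_wt ha hg R).locallyIntegrable hp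
  have h2 := h.integrableOn_isCompact (isCompact_closedBall (0 : E3) R)
  refine IntegrableOn.mono_set ?_ hR
  refine h2.congr_fun (fun x hx => indicator_of_mem hx _) Metric.isClosed_closedBall.measurableSet

/-- Approximation of `θ U` by test functions in `L²` and in `L⁶`, for `U` with gradient in `L²_loc`,
and the corresponding Sobolev inequality. -/
lemma exists_test_approx : ∃ S : ℝ≥0, ∀ (a : ℝ) (U : E3 → ℝ) (D : Fin 3 → E3 → ℝ) (θ : E3 → ℝ),
    0 ≤ a → MemLp (fun x => wt a x * U x) 2 volume → (∀ i, MemLp (fun x => wt a x * D i x) 2 volume) →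
    HasMollGrad U D → IsTest θ →
    eLpNorm (fun x => θ x * U x) 6 volume ≤
      S * ∑ i, eLpNorm (fun x => pd i θ x * U x + θ x * D i x) 2 volume ∧
    ∃ V : ℕ → E3 → ℝ, (∀ n, IsTest (V n)) ∧
      Tendsto (fun n => eLpNorm (fun x => V n x - θ x * U x) 2 volume) atTop (𝓝 0) ∧
      Tendsto (fun n => eLpNorm (fun x => V n x - θ x * U x) 6 volume) atTop (𝓝 0) := by
  obtain ⟨S, hS⟩ := exists_eLpNorm_six_le
  refine ⟨S, fun a U D θ ha hU hD hUD hθ => ?_⟩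
  have hUl := locallyIntegrable_of_memLp_wt ha (by norm_num) hU
  have hDl (i : Fin 3) := locallyIntegrable_of_memLp_wt ha (by norm_num) (hD i)
  have hUm := aestronglyMeasurable_of_wt hU.1
  have hDm (i : Fin 3) := aestronglyMeasurable_of_wt (hD i).1
  have hθc := hθ.1.continuous
  set V : ℕ → E3 → ℝ := fun n x => θ x * moll volume n U x with hV
  have hVt (n : ℕ) : IsTest (V n) := ⟨hθ.1.mul (contDiff_moll volume n hUl), hθ.2.mul_right⟩
  have hVae : ∀ᵐ x : E3, Tendsto (fun n => V n x) atTop (𝓝 (θ x * U x)) := by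
    filter_upwards [ae_tendsto_moll volume hUl] with x hx
    exact hx.const_mul _
  set G : Fin 3 → E3 → ℝ := fun i x => pd i θ x * U x + θ x * D i x with hG
  have hGm (i : Fin 3) : AEStronglyMeasurable (G i) volume :=
    ((continuous_pd i hθ.1).aestronglyMeasurable.mul hUm).add
      (hθc.aestronglyMeasurable.mul (hDm i))
  have hVm (n : ℕ) (i : Fin 3) : AEStronglyMeasurable (pd i (V n)) volume :=
    (continuous_pd i (hVt n).1).aestronglyMeasurable
  have hpd (n : ℕ) (i : Fin 3) (x : E3) : pd i (V n) x =
      pd i θ x * moll volume n U x + θ x * moll volume n (D i) x := by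
    rw [hV, pd_mul i hθ.1 (contDiff_moll volume n hUl), hUD]
  have hlim (i : Fin 3) : Tendsto (fun n => eLpNorm (fun x => pd i (V n) x - G i x) 2 volume)
      atTop (𝓝 0) := by
    have h1 := tendsto_eLpNorm_mul_moll_sub volume (memLp_indicator_of_memLp_wt ha hU)
      (continuous_pd i hθ.1) (hasCompactSupport_pd i hθ.2)
    have h2 := tendsto_eLpNorm_mul_moll_sub volume (memLp_indicator_of_memLp_wt ha (hD i))
      hθc hθ.2
    have h3 := h1.add h2
    rw [add_zero] at h3
    refine tendsto_of_tendsto_of_tendsto_of_le_of_le tendsto_const_nhds h3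
      (fun n => zero_le) (fun n => ?_)
    refine le_trans (le_of_eq ?_) (eLpNorm_add_le ?_ ?_ (by norm_num))
    · congr 1; ext x
      simp only [hpd, hG, Pi.add_apply]
      ring
    · exact ((continuous_pd i hθ.1).mul
        (contDiff_moll volume n hUl).continuous).aestronglyMeasurable.sub
        ((continuous_pd i hθ.1).aestronglyMeasurable.mul hUm)
    · exact (hθc.mul (contDiff_moll volume n (hDl i)).continuous).aestronglyMeasurable.sub
        (hθc.aestronglyMeasurable.mul (hDm i))
  have hsumlim : Tendsto (fun n => ∑ i, eLpNorm (fun x => pd i (V n) x - G i x) 2 volume)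
      atTop (𝓝 0) := by
    simpa using tendsto_finsetSum Finset.univ fun i _ => hlim i
  refine ⟨?_, V, hVt, ?_, ?_⟩
  -- The Sobolev inequality passes to the limit by Fatou on the left, from almost everywhere
  -- convergence, and by L² convergence of the gradients on the right.
  · have hbd : Tendsto (fun n => S * ∑ i, (eLpNorm (G i) 2 volume +
        eLpNorm (fun x => pd i (V n) x - G i x) 2 volume)) atTop
        (𝓝 (S * ∑ i, eLpNorm (G i) 2 volume)) := by
      refine ENNReal.Tendsto.const_mul ?_ (Or.inr ENNReal.coe_ne_top)
      refine tendsto_finsetSum _ fun i _ => ?_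
      simpa using (tendsto_const_nhds (x := eLpNorm (G i) 2 volume)).add (hlim i)
    have h1 := Lp.eLpNorm_lim_le_liminf_eLpNorm (p := 6)
      (fun n => (hVt n).1.continuous.aestronglyMeasurable) _ hVae
    refine h1.trans ?_
    rw [← hbd.liminf_eq]
    refine liminf_le_liminf (Eventually.of_forall fun n => ?_)
    refine (hS _ (hVt n)).trans ?_
    gcongr with i
    refine le_trans (le_of_eq ?_) (eLpNorm_add_le (hGm i) ((hVm n i).sub (hGm i)) (by norm_num))
    congr 1; ext x
    simp
  · exact tendsto_eLpNorm_mul_moll_sub volume (memLp_indicator_of_memLp_wt ha hU) hθc hθ.2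
  -- The sequence is Cauchy in L⁶ by Sobolev applied to V n - V m. Sending m to infinity with Fatou
  -- identifies the limit as θ U.
  · set d : ℕ → ℝ≥0∞ := fun n => ∑ i, eLpNorm (fun x => pd i (V n) x - G i x) 2 volume
    have hle (n : ℕ) : eLpNorm (fun x => V n x - θ x * U x) 6 volume ≤ S * d n := by
      have hbd : Tendsto (fun m => S * (d n + d m)) atTop (𝓝 (S * d n)) := by
        refine ENNReal.Tendsto.const_mul ?_ (Or.inr ENNReal.coe_ne_top)
        simpa using (tendsto_const_nhds (x := d n)).add hsumlim
      have h1 := Lp.eLpNorm_lim_le_liminf_eLpNorm (p := 6) (f := fun m x => V n x - V m x)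
        (fun m => ((hVt n).1.continuous.sub (hVt m).1.continuous).aestronglyMeasurable)
        (fun x => V n x - θ x * U x) (by
          filter_upwards [hVae] with x hx
          exact hx.const_sub _) (μ := (volume : Measure E3))
      refine h1.trans ?_
      rw [← hbd.liminf_eq]
      refine liminf_le_liminf (Eventually.of_forall fun m => ?_)
      refine (hS _ ⟨(hVt n).1.sub (hVt m).1, (hVt n).2.sub (hVt m).2⟩).trans ?_
      simp only [d]
      rw [← Finset.sum_add_distrib]
      gcongr with i
      have e : pd i (fun x => V n x - V m x) = (fun x => pd i (V n) x - G i x) -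
          fun x => pd i (V m) x - G i x := by
        ext x
        simp only [Pi.sub_apply, pd_sub i (hVt n).1 (hVt m).1]
        ring
      rw [e]
      exact eLpNorm_sub_le ((hVm n i).sub (hGm i)) ((hVm m i).sub (hGm i)) (by norm_num)
    refine tendsto_of_tendsto_of_tendsto_of_le_of_le tendsto_const_nhds ?_ (fun n => zero_le) hle
    simpa using ENNReal.Tendsto.const_mul hsumlim (Or.inr ENNReal.coe_ne_top)

/-- Duality for `R_i R_j` on `L^p_{w_{ap}}`, against limits of test functions. -/
lemma exists_enorm_integral_isRieszRiesz_le_of_tendsto {a σ : ℝ} {p q : ℝ≥0∞} (ha : 0 < a)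
    (ha2 : a ≤ 2) (hpq : p.toReal.HolderConjugate q.toReal) (hq2 : 2 ≤ q.toReal) (hσ : 0 < σ)
    (h1 : a + σ * p.toReal < 3) (h2 : a < σ * q.toReal) (h3 : σ * q.toReal < 3) :
    ∃ C : ℝ≥0, ∀ i j (f P V : E3 → ℝ) (W : ℕ → E3 → ℝ), IsRieszRiesz p (a * p.toReal) i j f P →
      MemLp (fun x => wt a x * f x) 2 volume → AEStronglyMeasurable V volume →
      (∀ n, IsTest (W n)) →
      Tendsto (fun n => eLpNorm (fun x => W n x - V x) 2 volume) atTop (𝓝 0) →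
      Tendsto (fun n => eLpNorm (fun x => W n x - V x) q volume) atTop (𝓝 0) →
      ‖∫ x, P x * (wt a x * V x)‖ₑ ≤
        eLpNorm (fun x => wt a x * f x) 2 volume * eLpNorm V 2 volume +
        C * eLpNorm (fun x => wt a x * f x) p volume * eLpNorm V q volume := by
  obtain ⟨C, hC⟩ := exists_enorm_integral_isRieszRiesz_le ha ha2 hpq hq2 hσ h1 h2 h3
  obtain ⟨hp0, hpt⟩ := HolderConjugate.ne_zero_ne_top hpq
  obtain ⟨hq0, hqt⟩ := HolderConjugate.ne_zero_ne_top hpq.symm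
  have hq1 : 1 ≤ q := by
    rw [← ENNReal.ofReal_toReal hqt, ← ENNReal.ofReal_one]
    exact ENNReal.ofReal_le_ofReal (by linarith)
  refine ⟨C, fun i j f P V W hfP hf2 hVm hW hL2 hLq => ?_⟩
  have hP := MemLp.wt_smul ha.le hp0 hpt hfP.2.1
  have hf := MemLp.wt_smul ha.le hp0 hpt hfP.1
  simp only [smul_eq_mul] at hP hf
  have hWm (n : ℕ) : AEStronglyMeasurable (W n) volume := (hW n).1.continuous.aestronglyMeasurable
  have hWL (n : ℕ) (r : ℝ≥0∞) : MemLp (W n) r volume :=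
    (hW n).1.continuous.memLp_of_hasCompactSupport (hW n).2
  have hnorm {r : ℝ≥0∞} (hr : 1 ≤ r)
      (hL : Tendsto (fun n => eLpNorm (fun x => W n x - V x) r volume) atTop (𝓝 0)) :
      eLpNorm V r volume ≠ ⊤ ∧ ∀ n, eLpNorm (W n) r volume ≤
        eLpNorm V r volume + eLpNorm (fun x => W n x - V x) r volume := by
    constructor
    · obtain ⟨n, hn⟩ := (hL.eventually (gt_mem_nhds one_pos)).exists
      have : eLpNorm (W n - fun x => W n x - V x) r volume < ⊤ :=
        (eLpNorm_sub_le (hWm n) ((hWm n).sub hVm) hr).trans_lt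
          (ENNReal.add_lt_top.2 ⟨(hWL n r).2, hn.trans ENNReal.one_lt_top⟩)
      have e : (W n - fun x => W n x - V x) = V := by ext x; simp
      rw [e] at this
      exact this.ne
    · intro n
      refine le_trans (le_of_eq ?_) (eLpNorm_add_le hVm ((hWm n).sub hVm) hr)
      congr 1; ext x; simp
  obtain ⟨hV2, hb2⟩ := hnorm (by norm_num) hL2
  obtain ⟨hVq, hbq⟩ := hnorm hq1 hLq
  have hint (K : E3 → ℝ) (hK : AEStronglyMeasurable K volume) :
      ∫⁻ x, ‖P x * (wt a x * K x)‖ₑ ≤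
        eLpNorm (fun x => wt a x * P x) p volume * eLpNorm K q volume := by
    refine le_trans (le_of_eq ?_) (lintegral_enorm_mul_le hpq hP.1 hK)
    congr 1; ext x
    rw [← enorm_mul]; ring_nf
  have hPm := aestronglyMeasurable_of_wt hP.1
  have hlim : Tendsto (fun n => ∫ x, P x * (wt a x * W n x)) atTop
      (𝓝 (∫ x, P x * (wt a x * V x))) := by
    refine tendsto_integral_of_L1 _ (hPm.mul ((continuous_wt a).aestronglyMeasurable.mul hVm))
      (Eventually.of_forall fun n => ⟨hPm.mul ((continuous_wt a).aestronglyMeasurable.mul (hWm n)),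
        (hint _ (hWm n)).trans_lt (ENNReal.mul_lt_top hP.2 (hWL n q).2)⟩) ?_
    have h0 := ENNReal.Tendsto.const_mul (a := eLpNorm (fun x => wt a x * P x) p volume) hLq
      (Or.inr hP.2.ne)
    rw [mul_zero] at h0
    refine tendsto_of_tendsto_of_tendsto_of_le_of_le tendsto_const_nhds h0
      (fun n => zero_le) (fun n => ?_)
    refine le_trans (le_of_eq ?_) (hint _ ((hWm n).sub hVm))
    congr 1; ext x
    simp only [Pi.mul_apply]
    ring_nf
  have hub : Tendsto (fun n => eLpNorm (fun x => wt a x * f x) 2 volume *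
      (eLpNorm V 2 volume + eLpNorm (fun x => W n x - V x) 2 volume) +
      C * eLpNorm (fun x => wt a x * f x) p volume *
      (eLpNorm V q volume + eLpNorm (fun x => W n x - V x) q volume)) atTop
      (𝓝 (eLpNorm (fun x => wt a x * f x) 2 volume * eLpNorm V 2 volume +
        C * eLpNorm (fun x => wt a x * f x) p volume * eLpNorm V q volume)) := by
    refine Tendsto.add (ENNReal.Tendsto.const_mul ?_ (Or.inr hf2.2.ne))
      (ENNReal.Tendsto.const_mul ?_ (Or.inr (ENNReal.mul_ne_top ENNReal.coe_ne_top hf.2.ne)))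
    · simpa using hL2.const_add (eLpNorm V 2 volume)
    · simpa using hLq.const_add (eLpNorm V q volume)
  refine le_of_tendsto_of_tendsto hlim.enorm hub (Eventually.of_forall fun n => ?_)
  refine (hC i j f P (W n) hfP (hW n)).trans ?_
  beta_reduce
  gcongr
  · exact hb2 n
  · exact hbq n

/-! ### Functions on the slab -/

lemma slab_integrable_of_le {T : ℝ} {G : ℝ × E3 → ℝ} {H : ℝ → ℝ≥0∞}
    (hG : AEStronglyMeasurable G (slab T))
    (hle : ∀ᵐ t ∂(volume.restrict (Ioo 0 T)), ∫⁻ x, ‖G (t, x)‖ₑ ≤ H t)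
    (hH : ∫⁻ t in Ioo 0 T, H t < ⊤) : Integrable G (slab T) := by
  refine ⟨hG, ?_⟩
  rw [HasFiniteIntegral, slab, lintegral_prod _ hG.enorm]
  exact (lintegral_mono_ae hle).trans_lt hH

lemma ae_aestronglyMeasurable_slice {V : Type*} [NormedAddCommGroup V] {T : ℝ} {f : ℝ → E3 → V}
    (hf : AEStronglyMeasurable (fun z : ℝ × E3 => f z.1 z.2) (slab T)) :
    ∀ᵐ t ∂(volume.restrict (Ioo 0 T)), AEStronglyMeasurable (f t) volume :=
  hf.prodMk_left

lemma slab_aestronglyMeasurable_comp_snd {T : ℝ} {g : E3 → ℝ} (hg : Continuous g) :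
    AEStronglyMeasurable (fun z : ℝ × E3 => g z.2) (slab T) :=
  (hg.comp continuous_snd).aestronglyMeasurable

lemma aemeasurable_eLpNorm_slice {V : Type*} [NormedAddCommGroup V] [NormedSpace ℝ V] {T : ℝ}
    {f : ℝ → E3 → V} (hf : AEStronglyMeasurable (fun z : ℝ × E3 => f z.1 z.2) (slab T)) (a : ℝ)
    {r : ℝ≥0∞} (hr0 : r ≠ 0) (hrt : r ≠ ⊤) :
    AEMeasurable (fun t => eLpNorm (fun x => wt a x • f t x) r volume)
      (volume.restrict (Ioo 0 T)) := by
  simp_rw [eLpNorm_eq_lintegral_rpow_enorm_toReal hr0 hrt]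
  refine AEMeasurable.pow_const ?_ _
  have h : AEStronglyMeasurable (fun z : ℝ × E3 => wt a z.2 • f z.1 z.2) (slab T) :=
    (slab_aestronglyMeasurable_comp_snd (continuous_wt a)).smul hf
  exact (h.enorm.pow_const _).lintegral_prod_right'

lemma MemLtLx.lintegral_lt_top {V : Type*} [NormedAddCommGroup V] [NormedSpace ℝ V] {T a : ℝ}
    {q r : ℝ≥0∞} {f : ℝ → E3 → V} (ha : 0 ≤ a) (hq0 : q ≠ 0) (hqt : q ≠ ⊤) (hr0 : r ≠ 0)
    (hrt : r ≠ ⊤) (hf : MemLtLx T q r (a * r.toReal) f) :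
    ∫⁻ t in Ioo 0 T, eLpNorm (fun x => wt a x • f t x) r volume ^ q.toReal < ⊤ := by
  have h := hf.2
  rw [eLpNorm_lt_top_iff_lintegral_rpow_enorm_lt_top hq0 hqt] at h
  simp only [enorm_eq_self] at h
  have hq : 0 ≤ q.toReal := ENNReal.toReal_nonneg
  refine (lintegral_mono (g := fun t => ENNReal.ofReal (√2 ^ a) ^ q.toReal *
    eLpNorm (f t) r (wMeasure (a * r.toReal)) ^ q.toReal) fun t => ?_).trans_lt ?_
  · beta_reduce
    rw [← ENNReal.mul_rpow_of_nonneg _ _ hq]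
    gcongr
    exact eLpNorm_wt_smul_le ha hr0 hrt _
  · rw [lintegral_const_mul' _ _ (ENNReal.rpow_ne_top_of_nonneg hq ENNReal.ofReal_ne_top)]
    exact ENNReal.mul_lt_top (ENNReal.rpow_lt_top_of_nonneg hq ENNReal.ofReal_ne_top) h

lemma MemLtLx.exists_bound {V : Type*} [NormedAddCommGroup V] [NormedSpace ℝ V] {T a : ℝ}
    {r : ℝ≥0∞} {f : ℝ → E3 → V} (ha : 0 ≤ a) (hr0 : r ≠ 0)
    (hrt : r ≠ ⊤) (hf : MemLtLx T ⊤ r (a * r.toReal) f) :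
    ∃ M : ℝ≥0, ∀ᵐ t ∂(volume.restrict (Ioo 0 T)),
      eLpNorm (fun x => wt a x • f t x) r volume ≤ M := by
  have h := hf.2
  rw [eLpNorm_exponent_top] at h
  refine ⟨(ENNReal.ofReal (√2 ^ a) * eLpNormEssSup
    (fun t => eLpNorm (f t) r (wMeasure (a * r.toReal))) (volume.restrict (Ioo 0 T))).toNNReal, ?_⟩
  rw [ENNReal.coe_toNNReal (ENNReal.mul_ne_top ENNReal.ofReal_ne_top h.ne)]
  filter_upwards [enorm_ae_le_eLpNormEssSup
    (fun t => eLpNorm (f t) r (wMeasure (a * r.toReal))) (volume.restrict (Ioo 0 T))] with t ht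
  rw [enorm_eq_self] at ht
  exact (eLpNorm_wt_smul_le ha hr0 hrt _).trans (by gcongr)

/-! ### Test functions in product form -/

section Product

variable {T : ℝ} {η : ℝ → ℝ} {ψ : E3 → ℝ}

lemma contDiff_prod_mul (hη : ContDiff ℝ ∞ η) (hψ : ContDiff ℝ ∞ ψ) :
    ContDiff ℝ ∞ (fun z : ℝ × E3 => η z.1 * ψ z.2) :=
  (hη.comp contDiff_fst).mul (hψ.comp contDiff_snd)

lemma isSlabTest_mul (hη : ContDiff ℝ ∞ η) (hηc : HasCompactSupport η)
    (hηT : tsupport η ⊆ Ioo 0 T) (hψ : IsTest ψ) :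
    IsSlabTest T (fun z : ℝ × E3 => η z.1 * ψ z.2) := by
  have hsub : tsupport (fun z : ℝ × E3 => η z.1 * ψ z.2) ⊆ tsupport η ×ˢ tsupport ψ := by
    refine closure_minimal ?_ ((isClosed_tsupport η).prod (isClosed_tsupport ψ))
    intro z hz
    rw [Function.mem_support] at hz
    exact ⟨subset_tsupport _ (left_ne_zero_of_mul hz), subset_tsupport _ (right_ne_zero_of_mul hz)⟩
  refine ⟨contDiff_prod_mul hη hψ.1, ?_, ?_⟩
  · exact (hηc.isCompact.prod hψ.2.isCompact).of_isClosed_subset (isClosed_tsupport _) hsub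
  · exact hsub.trans (prod_mono hηT (subset_univ _))

lemma hasFDerivAt_prod_mul (hη : ContDiff ℝ ∞ η) (hψ : ContDiff ℝ ∞ ψ) (z : ℝ × E3) :
    HasFDerivAt (fun z : ℝ × E3 => η z.1 * ψ z.2)
      (η z.1 • (fderiv ℝ ψ z.2).comp (ContinuousLinearMap.snd ℝ ℝ E3) +
        ψ z.2 • (fderiv ℝ η z.1).comp (ContinuousLinearMap.fst ℝ ℝ E3)) z := by
  have h1 : HasFDerivAt (fun z : ℝ × E3 => η z.1)
      ((fderiv ℝ η z.1).comp (ContinuousLinearMap.fst ℝ ℝ E3)) z :=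
    ((hη.differentiable (by simp)) z.1).hasFDerivAt.comp z hasFDerivAt_fst
  have h2 : HasFDerivAt (fun z : ℝ × E3 => ψ z.2)
      ((fderiv ℝ ψ z.2).comp (ContinuousLinearMap.snd ℝ ℝ E3)) z :=
    ((hψ.differentiable (by simp)) z.2).hasFDerivAt.comp z hasFDerivAt_snd
  exact h1.mul h2

lemma dt_mul (hη : ContDiff ℝ ∞ η) (hψ : ContDiff ℝ ∞ ψ) (z : ℝ × E3) :
    dt (fun z : ℝ × E3 => η z.1 * ψ z.2) z = deriv η z.1 * ψ z.2 := by
  rw [dt, (hasFDerivAt_prod_mul hη hψ z).fderiv]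
  simp
  ring

lemma dx_mul (hη : ContDiff ℝ ∞ η) (hψ : ContDiff ℝ ∞ ψ) (i : Fin 3) (z : ℝ × E3) :
    dx i (fun z : ℝ × E3 => η z.1 * ψ z.2) z = η z.1 * pd i ψ z.2 := by
  rw [dx, (hasFDerivAt_prod_mul hη hψ z).fderiv]
  simp [pd]

lemma lapl_mul (hη : ContDiff ℝ ∞ η) (hψ : ContDiff ℝ ∞ ψ) (z : ℝ × E3) :
    lapl (fun z : ℝ × E3 => η z.1 * ψ z.2) z = η z.1 * ∑ i, pd i (pd i ψ) z.2 := by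
  rw [lapl, Finset.mul_sum]
  refine Finset.sum_congr rfl fun i _ => ?_
  rw [show dx i (fun z : ℝ × E3 => η z.1 * ψ z.2) = fun z : ℝ × E3 => η z.1 * pd i ψ z.2 from
    funext (dx_mul hη hψ i), dx_mul hη (contDiff_pd i hψ)]

end Product

lemma integrable_slab_mul {T : ℝ} {G : ℝ × E3 → ℝ} (hG : Integrable G (slab T)) {η : ℝ → ℝ}
    (hη : Continuous η) (hηc : HasCompactSupport η) :
    Integrable (fun z : ℝ × E3 => η z.1 * G z) (slab T) := by
  obtain ⟨C, hC⟩ := hηc.exists_bound_of_continuous hη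
  exact hG.bdd_mul (c := C) (hη.comp continuous_fst).aestronglyMeasurable
    (Eventually.of_forall fun z => hC z.1)

lemma integral_slab_mul {T : ℝ} {G : ℝ × E3 → ℝ} (hG : Integrable G (slab T)) {η : ℝ → ℝ}
    (hη : Continuous η) (hηc : HasCompactSupport η) :
    ∫ z, η z.1 * G z ∂(slab T) = ∫ t in Ioo 0 T, η t * ∫ x, G (t, x) := by
  rw [slab, integral_prod _ (integrable_slab_mul hG hη hηc)]
  simp_rw [integral_const_mul]

/-- After Fubini, this is the fundamental lemma of the calculus of variations in time. -/
lemma ae_integral_slice_eq_zero {T : ℝ} {G : ℝ × E3 → ℝ} (hG : Integrable G (slab T))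
    (h : ∀ η : ℝ → ℝ, ContDiff ℝ ∞ η → HasCompactSupport η → tsupport η ⊆ Ioo 0 T →
      ∫ z, η z.1 * G z ∂(slab T) = 0) :
    ∀ᵐ t ∂(volume.restrict (Ioo 0 T)), ∫ x, G (t, x) = 0 := by
  have hA : IntegrableOn (fun t => ∫ x, G (t, x)) (Ioo 0 T) := hG.integral_prod_left
  refine (ae_restrict_iff' measurableSet_Ioo).2 ?_
  refine isOpen_Ioo.ae_eq_zero_of_integral_contDiff_smul_eq_zero hA.locallyIntegrableOn ?_
  intro η hη hηc hηT
  rw [← h η hη hηc hηT, integral_slab_mul hG hη.continuous hηc, setIntegral_eq_integral_of_forall_compl_eq_zero]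
  · rfl
  · intro t ht
    rw [image_eq_zero_of_notMem_tsupport (fun h => ht (hηT h)), zero_mul]

lemma lintegral_enorm_mul_test_le {a : ℝ} {f ψ : E3 → ℝ}
    (hf : AEStronglyMeasurable f volume) (hψ : Continuous ψ) :
    ∫⁻ x, ‖f x * ψ x‖ₑ ≤ eLpNorm (fun x => wt a x * f x) 2 volume *
      eLpNorm (fun x => wt (-a) x * ψ x) 2 volume := by
  have h := lintegral_enorm_mul_le (p := 2) (q := 2) (f := fun x => wt a x * f x)
    (g := fun x => wt (-a) x * ψ x) Real.HolderConjugate.two_two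
    ((continuous_wt a).aestronglyMeasurable.mul hf)
    ((continuous_wt (-a)).mul hψ).aestronglyMeasurable
  refine le_of_eq_of_le (lintegral_congr fun x => ?_) h
  rw [← enorm_mul]
  congr 1
  linear_combination (-(f x * ψ x)) * wt_neg_mul_self a x

lemma slab_integrable_mul_test {T a : ℝ} {f : ℝ → E3 → ℝ} {ψ : E3 → ℝ}
    (hf : AEStronglyMeasurable (fun z : ℝ × E3 => f z.1 z.2) (slab T))
    (h : ∫⁻ t in Ioo 0 T, eLpNorm (fun x => wt a x * f t x) 2 volume < ⊤) (hψ : IsTest ψ) :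
    Integrable (fun z : ℝ × E3 => f z.1 z.2 * ψ z.2) (slab T) := by
  refine slab_integrable_of_le (H := fun t => eLpNorm (fun x => wt a x * f t x) 2 volume *
    eLpNorm (fun x => wt (-a) x * ψ x) 2 volume)
    (hf.mul (slab_aestronglyMeasurable_comp_snd hψ.1.continuous)) ?_ ?_
  · filter_upwards [ae_aestronglyMeasurable_slice hf] with t ht
    exact lintegral_enorm_mul_test_le ht hψ.1.continuous
  · have hfin : eLpNorm (fun x => wt (-a) x * ψ x) 2 volume ≠ ⊤ :=
      (((continuous_wt (-a)).mul hψ.1.continuous).memLp_of_hasCompactSupport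
        (p := 2) hψ.2.mul_left).eLpNorm_ne_top
    rw [lintegral_mul_const' _ _ hfin]
    exact ENNReal.mul_lt_top h hfin.lt_top

lemma isTest_mollKer_sub (n : ℕ) (q : E3) : IsTest (fun y => mollKer volume n (q - y)) := by
  refine ⟨(contDiff_mollKer volume n).comp (contDiff_const.sub contDiff_id), ?_⟩
  exact (hasCompactSupport_mollKer volume n).comp_homeomorph (Homeomorph.subLeft q)

lemma pd_mollKer_sub (n : ℕ) (i : Fin 3) (q y : E3) :
    pd i (fun y => mollKer volume n (q - y)) y = - pd i (mollKer volume n) (q - y) := by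
  have h1 := ((contDiff_mollKer (volume : Measure E3) n).differentiable (by simp) (q - y)).hasFDerivAt
  have h2 : HasFDerivAt (fun y : E3 => q - y) (-ContinuousLinearMap.id ℝ E3) y :=
    (hasFDerivAt_id y).const_sub q
  have h3 := (h1.comp y h2).fderiv
  rw [pd, show (fun y => mollKer volume n (q - y)) = mollKer volume n ∘ fun y => q - y from rfl, h3]
  simp [pd]

lemma pd_moll (n : ℕ) (i : Fin 3) {g : E3 → ℝ} (hg : LocallyIntegrable g volume) (x : E3) :
    pd i (moll volume n g) x = ∫ y, pd i (mollKer volume n) (x - y) * g y := by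
  have h := (hasCompactSupport_mollKer (volume : Measure E3) n).hasFDerivAt_convolution_left
    (ContinuousLinearMap.lsmul ℝ ℝ) ((contDiff_mollKer volume n).of_le (by simp)) hg x
  have hex := ((hasCompactSupport_mollKer (volume : Measure E3) n).fderiv (𝕜 := ℝ)).convolutionExists_left
    ((ContinuousLinearMap.lsmul ℝ ℝ).precompL E3)
    ((contDiff_mollKer volume n).continuous_fderiv (by simp)) hg x
  rw [pd, moll, h.fderiv, convolution_def, ContinuousLinearMap.integral_apply hex,
    ← integral_sub_left_eq_self _ volume x]
  refine integral_congr_ae (Eventually.of_forall fun y => ?_)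
  simp [pd, ContinuousLinearMap.precompL_apply]

/-- The time slices of a weak gradient are weak gradients, tested against mollifiers. -/
lemma ae_hasMollGrad {T a : ℝ} (ha : 0 ≤ a) {u : ℝ → E3 → E3} {Du : ℝ → E3 → Tensor3}
    (hu : AEStronglyMeasurable (fun z : ℝ × E3 => u z.1 z.2) (slab T))
    (hDu : AEStronglyMeasurable (fun z : ℝ × E3 => Du z.1 z.2) (slab T))
    (hgrad : IsWeakGradient T u Du)
    (hu1 : ∀ j, ∫⁻ t in Ioo 0 T, eLpNorm (fun x => wt a x * u t x j) 2 volume < ⊤)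
    (hDu1 : ∀ k, ∫⁻ t in Ioo 0 T, eLpNorm (fun x => wt a x * Du t x k) 2 volume < ⊤)
    (hu2 : ∀ᵐ t ∂(volume.restrict (Ioo 0 T)), ∀ j, MemLp (fun x => wt a x * u t x j) 2 volume)
    (hDu2 : ∀ᵐ t ∂(volume.restrict (Ioo 0 T)), ∀ k, MemLp (fun x => wt a x * Du t x k) 2 volume) :
    ∀ᵐ t ∂(volume.restrict (Ioo 0 T)), ∀ j,
      HasMollGrad (fun x => u t x j) (fun i x => Du t x (i, j)) := by
  have huj (j : Fin 3) : AEStronglyMeasurable (fun z : ℝ × E3 => u z.1 z.2 j) (slab T) :=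
    (EuclideanSpace.proj (𝕜 := ℝ) j).continuous.comp_aestronglyMeasurable hu
  have hDuk (k : Fin 3 × Fin 3) : AEStronglyMeasurable (fun z : ℝ × E3 => Du z.1 z.2 k) (slab T) :=
    (EuclideanSpace.proj (𝕜 := ℝ) k).continuous.comp_aestronglyMeasurable hDu
  -- The family of test functions must be countable for one null set of times to serve all of them:
  -- the centres run over a dense sequence.
  have key : ∀ᵐ t ∂(volume.restrict (Ioo 0 T)), ∀ (n : ℕ) (i j : Fin 3) (m : ℕ),
      ∫ x, (u t x j * pd i (fun y => mollKer volume n (TopologicalSpace.denseSeq E3 m - y)) x +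
        Du t x (i, j) * mollKer volume n (TopologicalSpace.denseSeq E3 m - x)) = 0 := by
    simp only [ae_all_iff]
    intro n i j m
    set ψ := fun y => mollKer volume n (TopologicalSpace.denseSeq E3 m - y) with hψdef
    have hψ : IsTest ψ := isTest_mollKer_sub n _
    have hI1 := slab_integrable_mul_test (f := fun t x => u t x j) (huj j) (hu1 j) (hψ.pd i)
    have hI2 := slab_integrable_mul_test (f := fun t x => Du t x (i, j)) (hDuk (i, j)) (hDu1 (i, j)) hψ
    refine ae_integral_slice_eq_zero (G := fun z : ℝ × E3 => u z.1 z.2 j * pd i ψ z.2 +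
      Du z.1 z.2 (i, j) * ψ z.2) (hI1.add hI2) fun η hη hηc hηT => ?_
    have h := hgrad _ (isSlabTest_mul hη hηc hηT hψ) i j
    simp_rw [dx_mul hη hψ.1] at h
    have e1 := integrable_slab_mul hI1 hη.continuous hηc
    have e2 := integrable_slab_mul hI2 hη.continuous hηc
    simp_rw [mul_add]
    rw [integral_add e1 e2]
    rw [← sub_neg_eq_add, sub_eq_zero]
    refine Eq.trans (integral_congr_ae (Eventually.of_forall fun z => mul_left_comm _ _ _))
      (h.trans (congrArg Neg.neg
        (integral_congr_ae (Eventually.of_forall fun z => mul_left_comm _ _ _))))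
  filter_upwards [key, hu2, hDu2] with t ht h1 h2 j n i
  have hl1 := locallyIntegrable_of_memLp_wt ha one_le_two (h1 j)
  have hl2 := locallyIntegrable_of_memLp_wt ha one_le_two (h2 (i, j))
  have hfun : pd i (moll volume n fun x => u t x j) = moll volume n fun x => Du t x (i, j) := by
    -- Both sides are continuous in x, so equality at the dense centres is equality everywhere.
    refine Continuous.ext_on (TopologicalSpace.denseRange_denseSeq E3)
      (continuous_pd i (contDiff_moll volume n hl1)) (contDiff_moll volume n hl2).continuous ?_
    rintro _ ⟨m, rfl⟩
    have h := ht n i j m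
    have i1 : Integrable (fun x => u t x j *
        pd i (fun y => mollKer volume n (TopologicalSpace.denseSeq E3 m - y)) x) volume := by
      have := hl1.integrable_smul_right_of_hasCompactSupport
        (continuous_pd i (isTest_mollKer_sub n (TopologicalSpace.denseSeq E3 m)).1)
        (hasCompactSupport_pd i (isTest_mollKer_sub n (TopologicalSpace.denseSeq E3 m)).2)
      simpa only [smul_eq_mul] using this
    have i2 : Integrable (fun x => Du t x (i, j) *
        mollKer volume n (TopologicalSpace.denseSeq E3 m - x)) volume := by
      have := convolutionExists_moll volume n hl2 (TopologicalSpace.denseSeq E3 m)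
      simpa only [mul_comm] using this
    rw [integral_add i1 i2] at h
    simp_rw [pd_mollKer_sub, mul_neg, integral_neg] at h
    rw [pd_moll n i hl1, moll_apply]
    simp_rw [mul_comm (pd i _ _), mul_comm (mollKer _ _ _)]
    linarith
  exact congrFun hfun

/-! ### Symbol estimates and cut-off weights, uniform in the cutoff. -/

/-- Smooth functions of order `-a` at infinity, with two derivatives controlled. -/
structure IsSymbol (C a : ℝ) (φ : E3 → ℝ) : Prop where
  smooth : ContDiff ℝ ∞ φ
  bound : ∀ x, |φ x| ≤ C * wt a x
  bound_pd : ∀ i x, |pd i φ x| ≤ C * wt (a + 1) x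
  bound_pd_pd : ∀ i j x, |pd j (pd i φ) x| ≤ C * wt (a + 2) x

lemma pd_add (i : Fin 3) {φ ψ : E3 → ℝ} (hφ : ContDiff ℝ ∞ φ) (hψ : ContDiff ℝ ∞ ψ) (x : E3) :
    pd i (fun y => φ y + ψ y) x = pd i φ x + pd i ψ x := by
  have h1 := (hφ.differentiable (by simp)) x
  have h2 := (hψ.differentiable (by simp)) x
  rw [pd, fderiv_fun_add h1 h2]
  rfl

lemma IsSymbol.nonneg {C a : ℝ} {φ : E3 → ℝ} (h : IsSymbol C a φ) : 0 ≤ C := by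
  have := (abs_nonneg _).trans (h.bound 0)
  exact nonneg_of_mul_nonneg_left this (wt_pos a 0)

lemma abs_mul_le_wt {A B a b c s t : ℝ} (x : E3) (hc : a + b = c) (hs : |s| ≤ A * wt a x)
    (ht : |t| ≤ B * wt b x) : |s * t| ≤ A * B * wt c x := by
  rw [abs_mul, ← hc, wt_add]
  calc |s| * |t| ≤ (A * wt a x) * (B * wt b x) :=
        mul_le_mul hs ht (abs_nonneg _) ((abs_nonneg _).trans hs)
    _ = _ := by ring

/-- The constant 4 counts the terms of the second-order Leibniz formula. -/
lemma IsSymbol.mul {A B a b : ℝ} {φ ψ : E3 → ℝ} (hφ : IsSymbol A a φ) (hψ : IsSymbol B b ψ) :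
    IsSymbol (4 * (A * B)) (a + b) (fun x => φ x * ψ x) := by
  have hAB : 0 ≤ A * B := mul_nonneg hφ.nonneg hψ.nonneg
  refine ⟨hφ.smooth.mul hψ.smooth, fun x => ?_, fun i x => ?_, fun i j x => ?_⟩
  · refine (abs_mul_le_wt x rfl (hφ.bound x) (hψ.bound x)).trans ?_
    have := mul_nonneg hAB (wt_pos (a + b) x).le
    linarith
  · rw [pd_mul i hφ.smooth hψ.smooth]
    have h1 := abs_mul_le_wt (c := a + b + 1) x (by ring) (hφ.bound_pd i x) (hψ.bound x)
    have h2 := abs_mul_le_wt (c := a + b + 1) x (by ring) (hφ.bound x) (hψ.bound_pd i x)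
    have := mul_nonneg hAB (wt_pos (a + b + 1) x).le
    refine (abs_add_le _ _).trans ?_
    linarith
  · rw [show pd i (fun x => φ x * ψ x) = fun x => pd i φ x * ψ x + φ x * pd i ψ x from
      funext (pd_mul i hφ.smooth hψ.smooth),
      pd_add j ((contDiff_pd i hφ.smooth).mul hψ.smooth) (hφ.smooth.mul (contDiff_pd i hψ.smooth)),
      pd_mul j (contDiff_pd i hφ.smooth) hψ.smooth, pd_mul j hφ.smooth (contDiff_pd i hψ.smooth)]
    have h1 := abs_mul_le_wt (c := a + b + 2) x (by ring) (hφ.bound_pd_pd i j x) (hψ.bound x)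
    have h2 := abs_mul_le_wt (c := a + b + 2) x (by ring) (hφ.bound_pd i x) (hψ.bound_pd j x)
    have h3 := abs_mul_le_wt (c := a + b + 2) x (by ring) (hφ.bound_pd j x) (hψ.bound_pd i x)
    have h4 := abs_mul_le_wt (c := a + b + 2) x (by ring) (hφ.bound x) (hψ.bound_pd_pd i j x)
    refine (abs_add_le _ _).trans ((add_le_add (abs_add_le _ _) (abs_add_le _ _)).trans ?_)
    linarith

lemma pd_wt (a : ℝ) (i : Fin 3) (x : E3) : pd i (wt a) x = -a * (x i * wt (a + 2) x) := by
  have hpos : 0 < 1 + ‖x‖ ^ 2 := by positivity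
  have h0 : HasFDerivAt (fun y : E3 => 1 + ‖y‖ ^ 2) (2 • innerSL ℝ x) x :=
    (hasStrictFDerivAt_norm_sq x).hasFDerivAt.const_add 1
  have h1 := h0.sqrt hpos.ne'
  have h2 := h1.rpow_const (p := -a) (Or.inl (Real.sqrt_ne_zero'.2 hpos))
  rw [pd, show wt a = fun y => √(1 + ‖y‖ ^ 2) ^ (-a) from rfl, h2.fderiv]
  have hjb : √(1 + ‖x‖ ^ 2) = jb x := rfl
  have e : wt (a + 2) x = jb x ^ (-a - 1) * (jb x)⁻¹ := by
    rw [wt, ← Real.rpow_neg_one (jb x), ← Real.rpow_add (jb_pos x)]; ring_nf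
  rw [hjb, e]
  simp [EuclideanSpace.inner_single_right]
  field_simp

lemma abs_apply_le_wt (i : Fin 3) (x : E3) : |x i| ≤ 1 * wt (-1) x := by
  rw [wt, neg_neg, Real.rpow_one, one_mul]
  exact (PiLp.norm_apply_le x i).trans (norm_le_jb x)

lemma pd_coord (i j : Fin 3) (x : E3) : pd j (fun y : E3 => y i) x = if i = j then 1 else 0 := by
  rw [pd, show (fun y : E3 => y i) = EuclideanSpace.proj (𝕜 := ℝ) i from rfl,
    ContinuousLinearMap.fderiv]
  simp

lemma contDiff_coord (i : Fin 3) : ContDiff ℝ ∞ (fun y : E3 => y i) :=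
  (EuclideanSpace.proj (𝕜 := ℝ) i).contDiff

lemma abs_pd_wt_le (a : ℝ) (i : Fin 3) (x : E3) : |pd i (wt a) x| ≤ |a| * wt (a + 1) x := by
  rw [pd_wt, abs_mul, abs_neg]
  have := abs_mul_le_wt (c := a + 1) x (by ring) (abs_apply_le_wt i x)
    (t := wt (a + 2) x) (B := 1) (b := a + 2) (by rw [abs_of_pos (wt_pos _ _), one_mul])
  rw [one_mul, one_mul] at this
  gcongr

lemma isSymbol_wt (a : ℝ) : IsSymbol (1 + |a| * (1 + |a + 2|)) a (wt a) := by
  have h0 := abs_nonneg a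
  have h2 : 0 ≤ |a| * |a + 2| := by positivity
  refine ⟨contDiff_wt a, fun x => ?_, fun i x => ?_, fun i j x => ?_⟩
  · rw [abs_of_pos (wt_pos a x)]
    exact le_mul_of_one_le_left (wt_pos a x).le (by linarith)
  · refine (abs_pd_wt_le a i x).trans (mul_le_mul_of_nonneg_right (by linarith) (wt_pos _ _).le)
  · rw [show pd i (wt a) = fun x => -a * (x i * wt (a + 2) x) from funext (pd_wt a i)]
    have hs : ContDiff ℝ ∞ (fun x : E3 => x i * wt (a + 2) x) :=
      (contDiff_coord i).mul (contDiff_wt _)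
    rw [pd_mul j contDiff_const hs, pd_mul j (contDiff_coord i) (contDiff_wt _), pd_coord]
    have hc : pd j (fun _ : E3 => -a) x = 0 := by simp [pd]
    rw [hc, zero_mul, zero_add, abs_mul, abs_neg]
    have h1 := abs_mul_le_wt (c := a + 2) x (by ring) (abs_apply_le_wt i x) (abs_pd_wt_le (a + 2) j x)
    have h3 : |(if i = j then (1 : ℝ) else 0) * wt (a + 2) x| ≤ wt (a + 2) x := by
      split_ifs
      · rw [one_mul, abs_of_pos (wt_pos _ _)]
      · simp [(wt_pos _ _).le]
    have h4 := (abs_add_le _ _).trans (add_le_add h3 h1)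
    have h5 := (wt_pos (a + 2) x).le
    calc _ ≤ |a| * (wt (a + 2) x + 1 * |a + 2| * wt (a + 2) x) := by gcongr
      _ ≤ _ := by nlinarith

/-- Smooth cutoffs, equal to `1` on the ball of radius `n + 1`. -/
def cutoff (n : ℕ) (x : E3) : ℝ := freqBump (((n : ℝ) + 1)⁻¹ • x)

lemma pd_comp_smul (i : Fin 3) {φ : E3 → ℝ} (hφ : ContDiff ℝ ∞ φ) (c : ℝ) (x : E3) :
    pd i (fun y => φ (c • y)) x = c * pd i φ (c • x) := by
  have h1 := (hφ.differentiable (by simp) (c • x)).hasFDerivAt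
  have h2 : HasFDerivAt (fun y : E3 => c • y) (c • ContinuousLinearMap.id ℝ E3) x :=
    (hasFDerivAt_id x).const_smul c
  rw [pd, show (fun y => φ (c • y)) = φ ∘ fun y => c • y from rfl, (h1.comp x h2).fderiv]
  simp [pd]

lemma contDiff_cutoff (n : ℕ) : ContDiff ℝ ∞ (cutoff n) :=
  freqBump.contDiff.comp (contDiff_const_smul _)

lemma isTest_cutoff (n : ℕ) : IsTest (cutoff n) := by
  refine ⟨contDiff_cutoff n, ?_⟩
  exact freqBump.hasCompactSupport.comp_smul (by positivity)

lemma cutoff_nonneg (n : ℕ) (x : E3) : 0 ≤ cutoff n x := freqBump.nonneg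

lemma cutoff_le_one (n : ℕ) (x : E3) : cutoff n x ≤ 1 := freqBump.le_one

lemma tendsto_cutoff (x : E3) : Tendsto (fun n => cutoff n x) atTop (𝓝 1) := by
  refine tendsto_const_nhds.congr' ?_
  filter_upwards [eventually_ge_atTop ⌈‖x‖⌉₊] with n hn
  refine (freqBump.one_of_mem_closedBall ?_).symm
  rw [mem_closedBall_zero_iff, norm_smul, norm_inv, Real.norm_of_nonneg (by positivity)]
  change _ ≤ (1 : ℝ)
  rw [inv_mul_le_iff₀ (by positivity), mul_one]
  exact (Nat.le_ceil _).trans ((Nat.cast_le.2 hn).trans (by linarith))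

/-- Each derivative of a dilated cutoff costs 1/(n+1). On its support ‖x‖ ≤ 2(n+1), so the bracket
is at most 3(n+1) and that factor is converted into one order of decay in x, uniformly in n. -/
lemma inv_le_wt_one {n : ℕ} {x : E3} (h : ‖((n : ℝ) + 1)⁻¹ • x‖ ≤ 2) :
    ((n : ℝ) + 1)⁻¹ ≤ 3 * wt 1 x := by
  have hn : (0 : ℝ) < n + 1 := by positivity
  rw [norm_smul, norm_inv, Real.norm_of_nonneg hn.le, inv_mul_le_iff₀ hn] at h
  have h1 : jb x ≤ 1 + ‖x‖ := by
    rw [jb, Real.sqrt_le_left (by positivity)]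
    nlinarith [norm_nonneg x]
  rw [wt, Real.rpow_neg_one, ← div_eq_mul_inv, inv_eq_one_div, div_le_div_iff₀ hn (jb_pos x)]
  have : (0 : ℝ) ≤ n := by positivity
  linarith

lemma exists_isSymbol_cutoff : ∃ C, ∀ n, IsSymbol C 0 (cutoff n) := by
  have hb : IsTest (freqBump : E3 → ℝ) := ⟨freqBump.contDiff, freqBump.hasCompactSupport⟩
  have hsupp : tsupport (freqBump : E3 → ℝ) ⊆ Metric.closedBall 0 2 := by
    rw [freqBump.tsupport_eq]; rfl
  have hz1 (i : Fin 3) (y : E3) (hy : ¬ ‖y‖ ≤ 2) : pd i freqBump y = 0 := by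
    have : y ∉ tsupport (freqBump : E3 → ℝ) := fun h => hy (mem_closedBall_zero_iff.1 (hsupp h))
    rw [pd, fderiv_of_notMem_tsupport ℝ this]; rfl
  have hz2 (i j : Fin 3) (y : E3) (hy : ¬ ‖y‖ ≤ 2) : pd j (pd i freqBump) y = 0 := by
    have : y ∉ tsupport (freqBump : E3 → ℝ) := fun h => hy (mem_closedBall_zero_iff.1 (hsupp h))
    have h2 : y ∉ tsupport (pd i (freqBump : E3 → ℝ)) := fun h => this (by
      refine closure_minimal (fun z hz => ?_) (isClosed_tsupport _) h
      by_contra hz'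
      exact hz (by rw [pd, fderiv_of_notMem_tsupport ℝ hz']; rfl))
    rw [pd, fderiv_of_notMem_tsupport ℝ h2]; rfl
  have h1 (i : Fin 3) := (hb.pd i).2.exists_bound_of_continuous (hb.pd i).1.continuous
  have h2 (i j : Fin 3) := ((hb.pd i).pd j).2.exists_bound_of_continuous ((hb.pd i).pd j).1.continuous
  choose A hA using h1
  choose B hB using h2
  have hA0 (i : Fin 3) : 0 ≤ A i := (norm_nonneg _).trans (hA i 0)
  have hB0 (i j : Fin 3) : 0 ≤ B i j := (norm_nonneg _).trans (hB i j 0)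
  have hAs (i : Fin 3) : A i ≤ ∑ i, A i := Finset.single_le_sum (fun i _ => hA0 i) (Finset.mem_univ i)
  have hBs (i j : Fin 3) : B i j ≤ ∑ i, ∑ j, B i j :=
    (Finset.single_le_sum (fun j _ => hB0 i j) (Finset.mem_univ j)).trans
      (Finset.single_le_sum (f := fun i => ∑ j, B i j)
        (fun i _ => Finset.sum_nonneg fun j _ => hB0 i j) (Finset.mem_univ i))
  have hSA : 0 ≤ ∑ i, A i := Finset.sum_nonneg fun i _ => hA0 i
  have hSB : 0 ≤ ∑ i, ∑ j, B i j := Finset.sum_nonneg fun i _ => Finset.sum_nonneg fun j _ => hB0 i j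
  refine ⟨1 + 3 * ∑ i, A i + 9 * ∑ i, ∑ j, B i j, fun n => ⟨contDiff_cutoff n, fun x => ?_,
    fun i x => ?_, fun i j x => ?_⟩⟩
  · rw [wt_zero, abs_of_nonneg (cutoff_nonneg n x)]
    linarith [cutoff_le_one n x]
  · have hn : (0 : ℝ) ≤ ((n : ℝ) + 1)⁻¹ := by positivity
    rw [show cutoff n = fun x => freqBump (((n : ℝ) + 1)⁻¹ • x) from rfl,
      pd_comp_smul i freqBump.contDiff, abs_mul, abs_of_nonneg hn, zero_add]
    by_cases hx : ‖((n : ℝ) + 1)⁻¹ • x‖ ≤ 2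
    · calc _ ≤ (3 * wt 1 x) * ∑ i, A i :=
            mul_le_mul (inv_le_wt_one hx) ((hA i _).trans (hAs i)) (abs_nonneg _)
              (by have := (wt_pos 1 x).le; positivity)
        _ = (3 * ∑ i, A i) * wt 1 x := by ring
        _ ≤ _ := mul_le_mul_of_nonneg_right (by linarith) (wt_pos 1 x).le
    · rw [hz1 i _ hx, abs_zero, mul_zero]
      have := (wt_pos 1 x).le
      positivity
  · have hn : (0 : ℝ) ≤ ((n : ℝ) + 1)⁻¹ := by positivity
    have hs : ContDiff ℝ ∞ (fun x => pd i freqBump (((n : ℝ) + 1)⁻¹ • x)) :=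
      (hb.pd i).1.comp (contDiff_const_smul _)
    rw [show cutoff n = fun x => freqBump (((n : ℝ) + 1)⁻¹ • x) from rfl,
      show pd i (fun x => freqBump (((n : ℝ) + 1)⁻¹ • x)) =
        fun x => ((n : ℝ) + 1)⁻¹ * pd i freqBump (((n : ℝ) + 1)⁻¹ • x) from
        funext (pd_comp_smul i freqBump.contDiff _),
      pd_mul j contDiff_const hs,
      pd_comp_smul j (hb.pd i).1]
    have hc : pd j (fun _ : E3 => ((n : ℝ) + 1)⁻¹) x = 0 := by simp [pd]
    rw [hc, zero_mul, zero_add, ← mul_assoc, abs_mul, abs_of_nonneg (mul_nonneg hn hn), zero_add]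
    by_cases hx : ‖((n : ℝ) + 1)⁻¹ • x‖ ≤ 2
    · have hw := (wt_pos 1 x).le
      have h2 : wt 2 x = wt 1 x * wt 1 x := by rw [← wt_add]; norm_num
      calc _ ≤ ((3 * wt 1 x) * (3 * wt 1 x)) * ∑ i, ∑ j, B i j :=
            mul_le_mul (mul_le_mul (inv_le_wt_one hx) (inv_le_wt_one hx) hn (by positivity))
              ((hB i j _).trans (hBs i j)) (abs_nonneg _) (by positivity)
        _ = (9 * ∑ i, ∑ j, B i j) * wt 2 x := by rw [h2]; ring
        _ ≤ _ := mul_le_mul_of_nonneg_right (by linarith) (wt_pos 2 x).le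
    · rw [hz2 i j _ hx, abs_zero, mul_zero]
      have := (wt_pos 2 x).le
      positivity

/-- The cut-off weights. -/
def cutWt (a : ℝ) (n : ℕ) (x : E3) : ℝ := cutoff n x * wt a x

/-- The constant does not depend on n, so every estimate made with a cut-off weight survives the
removal of the cutoff. -/
lemma exists_isSymbol_cutWt (a : ℝ) : ∃ C, ∀ n, IsSymbol C a (cutWt a n) := by
  obtain ⟨C, hC⟩ := exists_isSymbol_cutoff
  refine ⟨4 * (C * (1 + |a| * (1 + |a + 2|))), fun n => ?_⟩
  have h := (hC n).mul (isSymbol_wt a)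
  rw [zero_add] at h
  exact h

lemma isTest_cutWt (a : ℝ) (n : ℕ) : IsTest (cutWt a n) :=
  ⟨(contDiff_cutoff n).mul (contDiff_wt a), (isTest_cutoff n).2.mul_right⟩

lemma cutWt_nonneg (a : ℝ) (n : ℕ) (x : E3) : 0 ≤ cutWt a n x :=
  mul_nonneg (cutoff_nonneg n x) (wt_pos a x).le

lemma cutWt_le (a : ℝ) (n : ℕ) (x : E3) : cutWt a n x ≤ wt a x :=
  mul_le_of_le_one_left (wt_pos a x).le (cutoff_le_one n x)

lemma tendsto_cutWt (a : ℝ) (x : E3) : Tendsto (fun n => cutWt a n x) atTop (𝓝 (wt a x)) := by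
  simpa [cutWt] using (tendsto_cutoff x).mul_const (wt a x)

lemma eLpNorm_mul_le_of_abs_le {A a : ℝ} {θ U : E3 → ℝ} (h : ∀ x, |θ x| ≤ A * wt a x)
    (p : ℝ≥0∞) : eLpNorm (fun x => θ x * U x) p volume ≤
      ENNReal.ofReal A * eLpNorm (fun x => wt a x * U x) p volume := by
  refine eLpNorm_le_mul_eLpNorm_of_ae_le_mul (Eventually.of_forall fun x => ?_) p
  rw [norm_mul, norm_mul, Real.norm_of_nonneg (wt_pos a x).le, ← mul_assoc]
  exact mul_le_mul_of_nonneg_right (h x) (norm_nonneg _)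

/-- The weighted Sobolev inequality. -/
lemma exists_eLpNorm_wt_six_le {a : ℝ} (ha : 0 ≤ a) : ∃ C : ℝ≥0, ∀ (U : E3 → ℝ) (D : Fin 3 → E3 → ℝ),
    MemLp (fun x => wt a x * U x) 2 volume → (∀ i, MemLp (fun x => wt a x * D i x) 2 volume) →
    HasMollGrad U D → eLpNorm (fun x => wt a x * U x) 6 volume ≤
      C * ∑ i, (eLpNorm (fun x => wt a x * U x) 2 volume +
        eLpNorm (fun x => wt a x * D i x) 2 volume) := by
  obtain ⟨S, hS⟩ := exists_test_approx
  obtain ⟨A, hA⟩ := exists_isSymbol_cutWt a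
  have hA0 := (hA 0).nonneg
  refine ⟨S * (A.toNNReal + 1), fun U D hU hD hUD => ?_⟩
  have hUm := aestronglyMeasurable_of_wt hU.1
  have hn (n : ℕ) : eLpNorm (fun x => cutWt a n x * U x) 6 volume ≤
      ↑(S * (A.toNNReal + 1)) * ∑ i, (eLpNorm (fun x => wt a x * U x) 2 volume +
        eLpNorm (fun x => wt a x * D i x) 2 volume) := by
    refine ((hS a U D (cutWt a n) ha hU hD hUD (isTest_cutWt a n)).1).trans ?_
    rw [ENNReal.coe_mul, mul_assoc, Finset.mul_sum (a := ((A.toNNReal + 1 : ℝ≥0) : ℝ≥0∞))]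
    gcongr with i
    have m1 : AEStronglyMeasurable (fun x => pd i (cutWt a n) x * U x) volume :=
      ((isTest_cutWt a n).pd i).1.continuous.aestronglyMeasurable.mul hUm
    have m2 : AEStronglyMeasurable (fun x => cutWt a n x * D i x) volume :=
      (isTest_cutWt a n).1.continuous.aestronglyMeasurable.mul (aestronglyMeasurable_of_wt (hD i).1)
    refine (eLpNorm_add_le m1 m2 one_le_two).trans ?_
    have b1 := eLpNorm_mul_le_of_abs_le (U := U) (fun x => ((hA n).bound_pd i x).trans
      (mul_le_mul_of_nonneg_left (wt_anti (by linarith : a ≤ a + 1) x) hA0)) 2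
    have b2 := eLpNorm_mul_le_of_abs_le (U := D i) (A := 1) (θ := cutWt a n) (a := a) (fun x => by
      rw [abs_of_nonneg (cutWt_nonneg a n x), one_mul]; exact cutWt_le a n x) 2
    rw [ENNReal.ofReal_one, one_mul] at b2
    refine (add_le_add b1 b2).trans ?_
    rw [mul_add, ENNReal.coe_add, ENNReal.coe_one]
    refine add_le_add ?_ ?_
    · gcongr
      exact le_self_add
    · exact le_mul_of_one_le_left' le_add_self
  refine (Lp.eLpNorm_lim_le_liminf_eLpNorm (f := fun n x => cutWt a n x * U x)
    (fun n => (isTest_cutWt a n).1.continuous.aestronglyMeasurable.mul hUm) _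
    (Eventually.of_forall fun x => (tendsto_cutWt a x).mul_const (U x))).trans ?_
  exact liminf_le_of_le (by isBoundedDefault) fun b hb => by
    obtain ⟨n, h⟩ := hb.exists
    exact h.trans (hn n)

/-! ### Estimates of the energy balance at a fixed time. -/

/-- The norm of `wt a • f` in `L^p`. -/
def wn {V : Type*} [NormedAddCommGroup V] [NormedSpace ℝ V] (a : ℝ) (p : ℝ≥0∞) (f : E3 → V) : ℝ≥0∞ :=
  eLpNorm (fun x => wt a x • f x) p volume

section

variable {V W : Type*} [NormedAddCommGroup V] [NormedSpace ℝ V] [NormedAddCommGroup W]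
  [NormedSpace ℝ W]

lemma norm_wt_smul (a : ℝ) (x : E3) (v : V) : ‖wt a x • v‖ = wt a x * ‖v‖ := by
  rw [norm_smul, Real.norm_of_nonneg (wt_pos a x).le]

lemma wn_mono {a : ℝ} {p : ℝ≥0∞} {f : E3 → V} {g : E3 → W} (h : ∀ x, ‖f x‖ ≤ ‖g x‖) :
    wn a p f ≤ wn a p g :=
  eLpNorm_mono fun x => by
    rw [norm_wt_smul, norm_wt_smul]
    exact mul_le_mul_of_nonneg_left (h x) (wt_pos a x).le

lemma aestronglyMeasurable_of_wt_smul {a : ℝ} {f : E3 → V}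
    (hf : AEStronglyMeasurable (fun x => wt a x • f x) volume) : AEStronglyMeasurable f volume := by
  refine ((continuous_wt (-a)).aestronglyMeasurable.smul hf).congr (Eventually.of_forall fun x => ?_)
  simp only [Pi.smul_apply']
  rw [smul_smul, wt_neg_mul_self, one_smul]

lemma lintegral_enorm_le_wn {p q : ℝ≥0∞} (h : p.toReal.HolderConjugate q.toReal) {a b C : ℝ}
    {X : E3 → V} {Y : E3 → W} {g : E3 → ℝ} (hX : AEStronglyMeasurable X volume)
    (hY : AEStronglyMeasurable Y volume)
    (hg : ∀ x, |g x| ≤ C * ((wt a x * ‖X x‖) * (wt b x * ‖Y x‖))) :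
    ∫⁻ x, ‖g x‖ₑ ≤ ENNReal.ofReal C * (wn a p X * wn b q Y) := by
  have h1 := lintegral_enorm_mul_le h ((continuous_wt a).aestronglyMeasurable.smul hX)
    ((continuous_wt b).aestronglyMeasurable.smul hY)
  refine le_trans ?_ (mul_le_mul_right h1 _)
  rw [← lintegral_const_mul' _ _ ENNReal.ofReal_ne_top]
  refine lintegral_mono fun x => ?_
  rw [← ofReal_norm, ← ofReal_norm, ← ofReal_norm, ← ENNReal.ofReal_mul (norm_nonneg _),
    ← ENNReal.ofReal_mul' (by positivity)]
  refine ENNReal.ofReal_le_ofReal ((hg x).trans (le_of_eq ?_))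
  simp only [Pi.smul_apply', norm_wt_smul]

end

/-- The data of the problem at a given time, with the pressure `∑ (P i j - Q i j)`. -/
structure IsSlice (γ : ℝ) (U B : E3 → E3) (D F : E3 → Tensor3) (P Q : Fin 3 → Fin 3 → E3 → ℝ) :
    Prop where
  U_mem : MemLp (fun x => wt (γ / 2) x • U x) 2 volume
  D_mem : MemLp (fun x => wt (γ / 2) x • D x) 2 volume
  F_mem : MemLp (fun x => wt (γ / 2) x • F x) 2 volume
  B_mem : MemLp (fun x => wt (γ / 2) x • B x) 3 volume
  grad : ∀ j, HasMollGrad (fun x => U x j) (fun i x => D x (i, j))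
  hP : ∀ i j, IsRieszRiesz (6 / 5) (6 * γ / 5) i j (fun x => B x i * U x j) (P i j)
  hQ : ∀ i j, IsRieszRiesz 2 γ i j (fun x => F x (i, j)) (Q i j)

lemma abs_sum_three_le {f : Fin 3 → ℝ} {c : ℝ} (h : ∀ i, |f i| ≤ c) : |∑ i, f i| ≤ 3 * c := by
  refine (Finset.abs_sum_le_sum_abs _ _).trans ((Finset.sum_le_card_nsmul _ _ c fun i _ => h i).trans ?_)
  simp

lemma memLp_wt_mul_apply {ι : Type*} [Fintype ι] {a : ℝ} {p : ℝ≥0∞} {f : E3 → EuclideanSpace ℝ ι}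
    (hf : MemLp (fun x => wt a x • f x) p volume) (i : ι) :
    MemLp (fun x => wt a x * f x i) p volume := by
  refine hf.mono ((EuclideanSpace.proj (𝕜 := ℝ) i).continuous.comp_aestronglyMeasurable hf.1)
    (Eventually.of_forall fun x => ?_)
  rw [norm_wt_smul, norm_mul, Real.norm_of_nonneg (wt_pos a x).le]
  exact mul_le_mul_of_nonneg_left (PiLp.norm_apply_le (f x) i) (wt_pos a x).le

lemma eLpNorm_wt_mul_apply_le {ι : Type*} [Fintype ι] (a : ℝ) (p : ℝ≥0∞)
    (f : E3 → EuclideanSpace ℝ ι) (i : ι) :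
    eLpNorm (fun x => wt a x * f x i) p volume ≤ wn a p f :=
  wn_mono (f := fun x => f x i) fun x => PiLp.norm_apply_le (f x) i

lemma aestronglyMeasurable_apply {ι : Type*} [Fintype ι] {f : E3 → EuclideanSpace ℝ ι}
    (hf : AEStronglyMeasurable f volume) (i : ι) : AEStronglyMeasurable (fun x => f x i) volume :=
  (EuclideanSpace.proj (𝕜 := ℝ) i).continuous.comp_aestronglyMeasurable hf

/-- The weighted Sobolev inequality for a slice. -/
lemma exists_wn_six_le {γ : ℝ} (hγ : 0 < γ) : ∃ C : ℝ≥0, ∀ U B D F P Q, IsSlice γ U B D F P Q →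
    wn (γ / 2) 6 U ≤ C * (wn (γ / 2) 2 U + wn (γ / 2) 2 D) := by
  obtain ⟨C, hC⟩ := exists_eLpNorm_wt_six_le (a := γ / 2) (by positivity)
  refine ⟨9 * C, fun U B D F P Q h => ?_⟩
  have hU := aestronglyMeasurable_of_wt_smul h.U_mem.1
  have h1 : wn (γ / 2) 6 U ≤ ∑ j, eLpNorm (fun x => wt (γ / 2) x * U x j) 6 volume := by
    have hm (j : Fin 3) : AEStronglyMeasurable (fun x => ‖wt (γ / 2) x * U x j‖) volume :=
      ((continuous_wt _).aestronglyMeasurable.mul (aestronglyMeasurable_apply hU j)).norm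
    calc wn (γ / 2) 6 U ≤ eLpNorm (∑ j, fun x => ‖wt (γ / 2) x * U x j‖) 6 volume := by
          refine eLpNorm_mono_real fun x => ?_
          rw [norm_wt_smul, Finset.sum_apply]
          simp_rw [norm_mul, Real.norm_of_nonneg (wt_pos (γ / 2) x).le]
          rw [← Finset.mul_sum]
          refine mul_le_mul_of_nonneg_left ?_ (wt_pos _ x).le
          have hv : U x = ∑ i, U x i • EuclideanSpace.single i (1 : ℝ) := by
            ext j; simp [Pi.single_apply]
          conv_lhs => rw [hv]
          refine (norm_sum_le _ _).trans (le_of_eq ?_)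
          simp [norm_smul]
      _ ≤ ∑ j, eLpNorm (fun x => ‖wt (γ / 2) x * U x j‖) 6 volume :=
          eLpNorm_sum_le (fun j _ => hm j) (by norm_num)
      _ = _ := by simp_rw [eLpNorm_norm]
  have h2 (j : Fin 3) : eLpNorm (fun x => wt (γ / 2) x * U x j) 6 volume ≤
      C * (3 * (wn (γ / 2) 2 U + wn (γ / 2) 2 D)) := by
    refine (hC _ _ (memLp_wt_mul_apply h.U_mem j) (fun i => memLp_wt_mul_apply h.D_mem (i, j))
      (h.grad j)).trans ?_
    gcongr
    refine (Finset.sum_le_card_nsmul _ _ (wn (γ / 2) 2 U + wn (γ / 2) 2 D) fun i _ => ?_).trans ?_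
    · exact add_le_add (eLpNorm_wt_mul_apply_le _ _ _ _) (eLpNorm_wt_mul_apply_le _ _ _ _)
    · simp [mul_add]
  refine h1.trans ((Finset.sum_le_card_nsmul _ _ _ fun j _ => h2 j).trans (le_of_eq ?_))
  simp only [Finset.card_univ, Fintype.card_fin, nsmul_eq_mul]
  push_cast
  ring

section Terms

variable {γ A : ℝ} {ψ : E3 → ℝ} {U B : E3 → E3} {D F : E3 → Tensor3}

/-- The order γ + 1 of the gradient is at least 3γ/2 because γ ≤ 2. The drift term and the pressure
term from b⊗u are trilinear in u and b, and each factor takes one half weight. -/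
lemma IsSymbol.abs_pd_le (hψ : IsSymbol A γ ψ) (hγ2 : γ ≤ 2) (i : Fin 3) (x : E3) :
    |pd i ψ x| ≤ A * (wt (γ / 2) x * wt (γ / 2) x * wt (γ / 2) x) := by
  refine (hψ.bound_pd i x).trans (mul_le_mul_of_nonneg_left ?_ hψ.nonneg)
  rw [← wt_add, ← wt_add]
  exact wt_anti (by linarith) x

lemma IsSymbol.abs_pd_le' (hψ : IsSymbol A γ ψ) (i : Fin 3) (x : E3) :
    |pd i ψ x| ≤ A * (wt (γ / 2) x * wt (γ / 2) x) := by
  refine (hψ.bound_pd i x).trans (mul_le_mul_of_nonneg_left ?_ hψ.nonneg)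
  rw [← wt_add]
  exact wt_anti (by linarith) x

lemma abs_sum_apply_mul_pd_le {c : ℝ} (V : E3 → E3) (x : E3) (h : ∀ i, |pd i ψ x| ≤ c) :
    |∑ i, V x i * pd i ψ x| ≤ 3 * (‖V x‖ * c) := by
  refine abs_sum_three_le fun i => ?_
  rw [abs_mul]
  exact mul_le_mul (PiLp.norm_apply_le (V x) i) (h i) (abs_nonneg _) (norm_nonneg _)

lemma holderConjugate_two_two : (2 : ℝ≥0∞).toReal.HolderConjugate (2 : ℝ≥0∞).toReal := by
  simpa using Real.HolderConjugate.two_two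

lemma holderConjugate_six_fifths_six :
    (6 / 5 : ℝ≥0∞).toReal.HolderConjugate (6 : ℝ≥0∞).toReal := by
  rw [Real.holderConjugate_iff]
  norm_num

lemma lintegral_lapl_term_le (hψ : IsSymbol A γ ψ) (hU : AEStronglyMeasurable U volume) :
    ∫⁻ x, ‖‖U x‖ ^ 2 / 2 * ∑ i, pd i (pd i ψ) x‖ₑ ≤
      ENNReal.ofReal (3 * A) * (wn (γ / 2) 2 U * wn (γ / 2) 2 U) := by
  refine lintegral_enorm_le_wn holderConjugate_two_two hU hU fun x => ?_
  have h : |∑ i, pd i (pd i ψ) x| ≤ 3 * (A * (wt (γ / 2) x * wt (γ / 2) x)) := by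
    refine abs_sum_three_le fun i => (hψ.bound_pd_pd i i x).trans
      (mul_le_mul_of_nonneg_left ?_ hψ.nonneg)
    rw [← wt_add]
    exact wt_anti (by linarith) x
  have h0 := hψ.nonneg
  have hw := wt_pos (γ / 2) x
  rw [abs_mul, abs_of_nonneg (by positivity : 0 ≤ ‖U x‖ ^ 2 / 2)]
  calc _ ≤ ‖U x‖ ^ 2 * (3 * (A * (wt (γ / 2) x * wt (γ / 2) x))) := by
        refine mul_le_mul ?_ h (abs_nonneg _) (by positivity)
        linarith [sq_nonneg ‖U x‖]
    _ = _ := by ring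

lemma lintegral_sq_term_le {V : Type*} [NormedAddCommGroup V] [NormedSpace ℝ V] {D : E3 → V}
    (hψ : IsSymbol A γ ψ) (hD : AEStronglyMeasurable D volume) :
    ∫⁻ x, ‖‖D x‖ ^ 2 * ψ x‖ₑ ≤ ENNReal.ofReal A * (wn (γ / 2) 2 D * wn (γ / 2) 2 D) := by
  refine lintegral_enorm_le_wn holderConjugate_two_two hD hD fun x => ?_
  rw [abs_mul, abs_of_nonneg (by positivity : 0 ≤ ‖D x‖ ^ 2)]
  refine (mul_le_mul_of_nonneg_left (hψ.bound x) (by positivity)).trans (le_of_eq ?_)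
  rw [show γ = γ / 2 + γ / 2 by ring, wt_add]
  ring_nf

/-- Hölder with 1/3 + 1/6 = 1/2. It places the product of b and u in weighted L², where R_i R_j is a
contraction. -/
lemma wn_mul_two_le (hB : AEStronglyMeasurable B volume) (hU : AEStronglyMeasurable U volume) :
    wn γ 2 (fun x => ‖B x‖ * ‖U x‖) ≤ wn (γ / 2) 3 B * wn (γ / 2) 6 U := by
  have : ENNReal.HolderTriple 3 6 2 := ⟨by
    rw [← ENNReal.toReal_eq_toReal_iff' (by simp) (by simp), ENNReal.toReal_add (by simp) (by simp)]
    norm_num⟩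
  have h := eLpNorm_smul_le_mul_eLpNorm (p := 3) (q := 6) (r := 2) (μ := volume)
    ((continuous_wt (γ / 2)).aestronglyMeasurable.smul hU).norm
    ((continuous_wt (γ / 2)).aestronglyMeasurable.smul hB).norm
  rw [eLpNorm_norm, eLpNorm_norm] at h
  refine le_of_eq_of_le (congrArg (fun f => eLpNorm f 2 volume) (funext fun x => ?_)) h
  simp only [Pi.smul_apply', smul_eq_mul, norm_wt_smul]
  rw [show wt γ x = wt (γ / 2) x * wt (γ / 2) x by rw [← wt_add, add_halves]]
  ring

/-- Hölder with 1/3 + 1/2 = 5/6. This is the norm of the product that enters the commutator part,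
against an L⁶ norm of u. -/
lemma wn_mul_six_fifths_le (hB : AEStronglyMeasurable B volume)
    (hU : AEStronglyMeasurable U volume) :
    wn γ (6 / 5) (fun x => ‖B x‖ * ‖U x‖) ≤ wn (γ / 2) 3 B * wn (γ / 2) 2 U := by
  have : ENNReal.HolderTriple 3 2 (6 / 5) := ⟨by
    have h65 : (6 / 5 : ℝ≥0∞) ≠ 0 := by simp
    rw [← ENNReal.toReal_eq_toReal_iff' (by simp) (by simp), ENNReal.toReal_add (by simp) (by simp)]
    norm_num⟩
  have h := eLpNorm_smul_le_mul_eLpNorm (p := 3) (q := 2) (r := 6 / 5) (μ := volume)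
    ((continuous_wt (γ / 2)).aestronglyMeasurable.smul hU).norm
    ((continuous_wt (γ / 2)).aestronglyMeasurable.smul hB).norm
  rw [eLpNorm_norm, eLpNorm_norm] at h
  refine le_of_eq_of_le (congrArg (fun f => eLpNorm f (6 / 5) volume) (funext fun x => ?_)) h
  simp only [Pi.smul_apply', smul_eq_mul, norm_wt_smul]
  rw [show wt γ x = wt (γ / 2) x * wt (γ / 2) x by rw [← wt_add, add_halves]]
  ring

lemma lintegral_drift_term_le (hψ : IsSymbol A γ ψ) (hγ2 : γ ≤ 2)
    (hU : AEStronglyMeasurable U volume) (hB : AEStronglyMeasurable B volume) :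
    ∫⁻ x, ‖‖U x‖ ^ 2 / 2 * ∑ i, B x i * pd i ψ x‖ₑ ≤
      ENNReal.ofReal (3 * A) * (wn (γ / 2) 3 B * wn (γ / 2) 6 U * wn (γ / 2) 2 U) := by
  have h := lintegral_enorm_le_wn (a := γ) (b := γ / 2) (C := 3 * A) holderConjugate_two_two
    (X := fun x => ‖B x‖ * ‖U x‖) (Y := U)
    (g := fun x => ‖U x‖ ^ 2 / 2 * ∑ i, B x i * pd i ψ x) (hB.norm.mul hU.norm) hU fun x => ?_
  · refine h.trans ?_
    gcongr
    exact wn_mul_two_le hB hU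
  have h := abs_sum_apply_mul_pd_le B x fun i => hψ.abs_pd_le hγ2 i x
  have h0 := hψ.nonneg
  have hw := wt_pos (γ / 2) x
  rw [abs_mul, abs_of_nonneg (by positivity : 0 ≤ ‖U x‖ ^ 2 / 2)]
  calc _ ≤ ‖U x‖ ^ 2 *
        (3 * (‖B x‖ * (A * (wt (γ / 2) x * wt (γ / 2) x * wt (γ / 2) x)))) := by
        refine mul_le_mul ?_ h (abs_nonneg _) (by positivity)
        linarith [sq_nonneg ‖U x‖]
    _ = _ := by
        rw [show wt γ x = wt (γ / 2) x * wt (γ / 2) x by rw [← wt_add, add_halves],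
          norm_mul, norm_norm, norm_norm]
        ring

/-- This bound involves a norm of the pressure itself, and so serves only for integrability. The
quantitative estimate comes from duality. -/
lemma lintegral_pressure_term_le (hψ : IsSymbol A γ ψ) (hγ2 : γ ≤ 2) {S : E3 → ℝ}
    (hU : AEStronglyMeasurable U volume) (hS : AEStronglyMeasurable S volume) :
    ∫⁻ x, ‖S x * ∑ i, U x i * pd i ψ x‖ₑ ≤
      ENNReal.ofReal (3 * A) * (wn γ (6 / 5) S * wn (γ / 2) 6 U) := by
  refine lintegral_enorm_le_wn holderConjugate_six_fifths_six hS hU fun x => ?_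
  have h := abs_sum_apply_mul_pd_le U x fun i => hψ.abs_pd_le hγ2 i x
  rw [abs_mul]
  refine (mul_le_mul_of_nonneg_left h (abs_nonneg _)).trans (le_of_eq ?_)
  rw [show wt γ x = wt (γ / 2) x * wt (γ / 2) x by rw [← wt_add, add_halves], Real.norm_eq_abs]
  ring

lemma lintegral_pressure_term_le' (hψ : IsSymbol A γ ψ) {S : E3 → ℝ}
    (hU : AEStronglyMeasurable U volume) (hS : AEStronglyMeasurable S volume) :
    ∫⁻ x, ‖S x * ∑ i, U x i * pd i ψ x‖ₑ ≤
      ENNReal.ofReal (3 * A) * (wn (γ / 2) 2 S * wn (γ / 2) 2 U) := by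
  refine lintegral_enorm_le_wn holderConjugate_two_two hS hU fun x => ?_
  have h := abs_sum_apply_mul_pd_le U x fun i => hψ.abs_pd_le' i x
  rw [abs_mul]
  refine (mul_le_mul_of_nonneg_left h (abs_nonneg _)).trans (le_of_eq ?_)
  rw [Real.norm_eq_abs]
  ring

lemma lintegral_force_term_le (hψ : IsSymbol A γ ψ) (hU : AEStronglyMeasurable U volume)
    (hF : AEStronglyMeasurable F volume) :
    ∫⁻ x, ‖∑ i, ∑ j, F x (i, j) * U x j * pd i ψ x‖ₑ ≤
      ENNReal.ofReal (9 * A) * (wn (γ / 2) 2 F * wn (γ / 2) 2 U) := by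
  refine lintegral_enorm_le_wn holderConjugate_two_two hF hU fun x => ?_
  have h : |∑ i, ∑ j, F x (i, j) * U x j * pd i ψ x| ≤
      3 * (3 * (‖F x‖ * ‖U x‖ * (A * (wt (γ / 2) x * wt (γ / 2) x)))) := by
    refine abs_sum_three_le fun i => abs_sum_three_le fun j => ?_
    rw [abs_mul, abs_mul]
    exact mul_le_mul (mul_le_mul (PiLp.norm_apply_le (F x) (i, j)) (PiLp.norm_apply_le (U x) j)
      (abs_nonneg _) (norm_nonneg _)) (hψ.abs_pd_le' i x) (abs_nonneg _) (by positivity)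
  exact h.trans (le_of_eq (by ring))

lemma lintegral_force_grad_term_le (hψ : IsSymbol A γ ψ) (hD : AEStronglyMeasurable D volume)
    (hF : AEStronglyMeasurable F volume) :
    ∫⁻ x, ‖(∑ i, ∑ j, F x (i, j) * D x (i, j)) * ψ x‖ₑ ≤
      ENNReal.ofReal (9 * A) * (wn (γ / 2) 2 F * wn (γ / 2) 2 D) := by
  refine lintegral_enorm_le_wn holderConjugate_two_two hF hD fun x => ?_
  have h : |∑ i, ∑ j, F x (i, j) * D x (i, j)| ≤ 3 * (3 * (‖F x‖ * ‖D x‖)) := by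
    refine abs_sum_three_le fun i => abs_sum_three_le fun j => ?_
    rw [abs_mul]
    exact mul_le_mul (PiLp.norm_apply_le (F x) (i, j)) (PiLp.norm_apply_le (D x) (i, j))
      (abs_nonneg _) (norm_nonneg _)
  rw [abs_mul]
  refine (mul_le_mul h (hψ.bound x) (abs_nonneg _) (by positivity)).trans (le_of_eq ?_)
  rw [show wt γ x = wt (γ / 2) x * wt (γ / 2) x by rw [← wt_add, add_halves]]
  ring

end Terms

variable {γ : ℝ} {U B : E3 → E3} {D F : E3 → Tensor3} {P Q : Fin 3 → Fin 3 → E3 → ℝ}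

lemma IsSlice.aestronglyMeasurable (h : IsSlice γ U B D F P Q) :
    AEStronglyMeasurable U volume ∧ AEStronglyMeasurable B volume ∧
      AEStronglyMeasurable D volume ∧ AEStronglyMeasurable F volume :=
  ⟨aestronglyMeasurable_of_wt_smul h.U_mem.1, aestronglyMeasurable_of_wt_smul h.B_mem.1,
    aestronglyMeasurable_of_wt_smul h.D_mem.1, aestronglyMeasurable_of_wt_smul h.F_mem.1⟩

lemma toReal_six_fifths : (6 / 5 : ℝ≥0∞).toReal = 6 / 5 := by simp

lemma IsSlice.memLp_P (hγ : 0 < γ) (h : IsSlice γ U B D F P Q) (i j : Fin 3) :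
    MemLp (fun x => wt γ x • P i j x) (6 / 5) volume :=
  MemLp.wt_smul hγ.le (by simp) (by finiteness) (by
    rw [toReal_six_fifths, show γ * (6 / 5) = 6 * γ / 5 by ring]; exact (h.hP i j).2.1)

lemma IsSlice.memLp_Q (hγ : 0 < γ) (h : IsSlice γ U B D F P Q) (i j : Fin 3) :
    MemLp (fun x => wt (γ / 2) x • Q i j x) 2 volume :=
  MemLp.wt_smul (by positivity) (by simp) (by simp) (by
    rw [ENNReal.toReal_ofNat, div_mul_cancel₀ _ two_ne_zero]; exact (h.hQ i j).2.1)

lemma wn_lt_top_of_sobolev (hγ : 0 < γ) (h : IsSlice γ U B D F P Q) : wn (γ / 2) 6 U < ⊤ := by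
  obtain ⟨C, hC⟩ := exists_wn_six_le hγ
  exact (hC U B D F P Q h).trans_lt (ENNReal.mul_lt_top ENNReal.coe_lt_top
    (ENNReal.add_lt_top.2 ⟨h.U_mem.2, h.D_mem.2⟩))

lemma abs_wt_neg_mul_le {a b A c : ℝ} (x : E3) (h : |c| ≤ A * (wt a x * wt b x)) :
    |wt (-a) x * c| ≤ A * wt b x := by
  rw [abs_mul, abs_of_pos (wt_pos _ x)]
  refine (mul_le_mul_of_nonneg_left h (wt_pos _ x).le).trans (le_of_eq ?_)
  linear_combination (A * wt b x) * wt_neg_mul_self a x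

lemma IsSlice.exists_test_tendsto {θ : E3 → ℝ} {k : Fin 3} (hγ : 0 < γ)
    (h : IsSlice γ U B D F P Q) (hθ : IsTest θ) :
    ∃ W : ℕ → E3 → ℝ, (∀ n, IsTest (W n)) ∧
      Tendsto (fun n => eLpNorm (fun x => W n x - θ x * U x k) 2 volume) atTop (𝓝 0) ∧
      Tendsto (fun n => eLpNorm (fun x => W n x - θ x * U x k) 6 volume) atTop (𝓝 0) := by
  obtain ⟨S, hS⟩ := exists_test_approx
  exact (hS (γ / 2) (fun x => U x k) (fun i x => D x (i, k)) θ (by positivity)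
    (memLp_wt_mul_apply h.U_mem k) (fun i => memLp_wt_mul_apply h.D_mem (i, k)) (h.grad k) hθ).2

/-- Duality is applied with V = w_{-γ} ∂_kψ U_k, which is bounded by the half weight times |U|. The
leading part costs L² norms of w b u and V, the commutator L^(6/5) and L⁶ norms. Both give the same
product of norms of b and u. -/
lemma exists_enorm_integral_P_le (hγ : 0 < γ) (hγ2 : γ ≤ 2) : ∃ C : ℝ≥0, ∀ A ψ U B D F P Q,
    IsSlice γ U B D F P Q → IsTest ψ → IsSymbol A γ ψ → ∀ i j k,
    ‖∫ x, P i j x * (U x k * pd k ψ x)‖ₑ ≤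
      C * ENNReal.ofReal A * (wn (γ / 2) 3 B * wn (γ / 2) 6 U * wn (γ / 2) 2 U) := by
  -- With σ = 5/12 one has σ p = 1/2 and σ q = 5/2. The conditions γ + 1/2 < 3 and γ < 5/2 < 3 hold
  -- for every γ ≤ 2.
  obtain ⟨C, hC⟩ := exists_enorm_integral_isRieszRiesz_le_of_tendsto (a := γ) (σ := 5 / 12)
    (p := 6 / 5) (q := 6) hγ hγ2 holderConjugate_six_fifths_six (by norm_num) (by norm_num)
    (by norm_num; linarith) (by norm_num; linarith) (by norm_num)
  refine ⟨1 + C, fun A ψ U B D F P Q h hψt hψ i j k => ?_⟩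
  obtain ⟨hU, hB, -, -⟩ := h.aestronglyMeasurable
  have hθ : IsTest (fun x => wt (-γ) x * pd k ψ x) := (hψt.pd k).mul_left (contDiff_wt _)
  obtain ⟨W, hW, hW2, hW6⟩ := IsSlice.exists_test_tendsto (k := k) hγ h hθ
  have hP := h.hP i j
  rw [show 6 * γ / 5 = γ * (6 / 5 : ℝ≥0∞).toReal by rw [toReal_six_fifths]; ring] at hP
  have hbu (x : E3) : ‖B x i * U x j‖ ≤ ‖‖B x‖ * ‖U x‖‖ := by
    rw [norm_mul, norm_mul, norm_norm, norm_norm]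
    exact mul_le_mul (PiLp.norm_apply_le (B x) i) (PiLp.norm_apply_le (U x) j) (norm_nonneg _)
      (norm_nonneg _)
  have b2 : eLpNorm (fun x => wt γ x * (B x i * U x j)) 2 volume ≤
      wn (γ / 2) 3 B * wn (γ / 2) 6 U := (wn_mono hbu).trans (wn_mul_two_le hB hU)
  have b65 : eLpNorm (fun x => wt γ x * (B x i * U x j)) (6 / 5) volume ≤
      wn (γ / 2) 3 B * wn (γ / 2) 2 U := (wn_mono hbu).trans (wn_mul_six_fifths_le hB hU)
  have hθb (x : E3) : |wt (-γ) x * pd k ψ x| ≤ A * wt (γ / 2) x :=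
    abs_wt_neg_mul_le x ((hψ.abs_pd_le hγ2 k x).trans (le_of_eq (by
      rw [show wt γ x = wt (γ / 2) x * wt (γ / 2) x by rw [← wt_add, add_halves]])))
  have v (p : ℝ≥0∞) : eLpNorm (fun x => wt (-γ) x * pd k ψ x * U x k) p volume ≤
      ENNReal.ofReal A * wn (γ / 2) p U :=
    (eLpNorm_mul_le_of_abs_le (U := fun x => U x k) hθb p).trans
      (mul_le_mul_right (eLpNorm_wt_mul_apply_le _ _ _ _) _)
  have hm : MemLp (fun x => wt γ x * (B x i * U x j)) 2 volume :=
    ⟨(continuous_wt γ).aestronglyMeasurable.mul ((aestronglyMeasurable_apply hB i).mul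
      (aestronglyMeasurable_apply hU j)),
      b2.trans_lt (ENNReal.mul_lt_top h.B_mem.2 (wn_lt_top_of_sobolev hγ h))⟩
  have key := hC i j _ (P i j) (fun x => wt (-γ) x * pd k ψ x * U x k) W hP hm
    (hθ.1.continuous.aestronglyMeasurable.mul (aestronglyMeasurable_apply hU k)) hW hW2 hW6
  have e : ∫ x, P i j x * (U x k * pd k ψ x) =
      ∫ x, P i j x * (wt γ x * (wt (-γ) x * pd k ψ x * U x k)) := by
    congr 1; ext x
    linear_combination (-(P i j x * U x k * pd k ψ x)) * wt_neg_mul_self γ x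
  rw [e]
  refine key.trans ?_
  calc _ ≤ wn (γ / 2) 3 B * wn (γ / 2) 6 U * (ENNReal.ofReal A * wn (γ / 2) 2 U) +
        C * (wn (γ / 2) 3 B * wn (γ / 2) 2 U) * (ENNReal.ofReal A * wn (γ / 2) 6 U) := by
        gcongr
        · exact v 2
        · exact v 6
    _ = _ := by push_cast; ring

lemma exists_enorm_integral_Q_le (hγ : 0 < γ) (hγ2 : γ ≤ 2) : ∃ C : ℝ≥0, ∀ A ψ U B D F P Q,
    IsSlice γ U B D F P Q → IsTest ψ → IsSymbol A γ ψ → ∀ i j k,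
    ‖∫ x, Q i j x * (U x k * pd k ψ x)‖ₑ ≤
      C * ENNReal.ofReal A * (wn (γ / 2) 2 F * wn (γ / 2) 2 U) := by
  -- Here σ p = σ q = 3/2, and γ/2 ≤ 1 leaves room in all three conditions.
  obtain ⟨C, hC⟩ := exists_enorm_integral_isRieszRiesz_le_of_tendsto (a := γ / 2) (σ := 3 / 4)
    (p := 2) (q := 2) (by positivity) (by linarith) holderConjugate_two_two (by norm_num)
    (by norm_num) (by norm_num; linarith) (by norm_num; linarith) (by norm_num)
  refine ⟨1 + C, fun A ψ U B D F P Q h hψt hψ i j k => ?_⟩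
  obtain ⟨hU, -, -, -⟩ := h.aestronglyMeasurable
  have hθ : IsTest (fun x => wt (-(γ / 2)) x * pd k ψ x) := (hψt.pd k).mul_left (contDiff_wt _)
  obtain ⟨W, hW, hW2, -⟩ := IsSlice.exists_test_tendsto (k := k) hγ h hθ
  have hQ := h.hQ i j
  rw [show γ = γ / 2 * (2 : ℝ≥0∞).toReal by rw [ENNReal.toReal_ofNat]; ring] at hQ
  have b2 : eLpNorm (fun x => wt (γ / 2) x * F x (i, j)) 2 volume ≤ wn (γ / 2) 2 F :=
    eLpNorm_wt_mul_apply_le _ _ _ _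
  have hθb (x : E3) : |wt (-(γ / 2)) x * pd k ψ x| ≤ A * wt (γ / 2) x :=
    abs_wt_neg_mul_le x (hψ.abs_pd_le' k x)
  have v : eLpNorm (fun x => wt (-(γ / 2)) x * pd k ψ x * U x k) 2 volume ≤
      ENNReal.ofReal A * wn (γ / 2) 2 U :=
    (eLpNorm_mul_le_of_abs_le (U := fun x => U x k) hθb 2).trans
      (mul_le_mul_right (eLpNorm_wt_mul_apply_le _ _ _ _) _)
  have key := hC i j _ (Q i j) (fun x => wt (-(γ / 2)) x * pd k ψ x * U x k) W hQ
    (memLp_wt_mul_apply h.F_mem (i, j))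
    (hθ.1.continuous.aestronglyMeasurable.mul (aestronglyMeasurable_apply hU k)) hW hW2 hW2
  have e : ∫ x, Q i j x * (U x k * pd k ψ x) =
      ∫ x, Q i j x * (wt (γ / 2) x * (wt (-(γ / 2)) x * pd k ψ x * U x k)) := by
    congr 1; ext x
    linear_combination (-(Q i j x * U x k * pd k ψ x)) * wt_neg_mul_self (γ / 2) x
  rw [e]
  refine key.trans ?_
  calc _ ≤ wn (γ / 2) 2 F * (ENNReal.ofReal A * wn (γ / 2) 2 U) +
        C * wn (γ / 2) 2 F * (ENNReal.ofReal A * wn (γ / 2) 2 U) := by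
        gcongr
    _ = _ := by push_cast; ring

lemma integrable_pressure_mul {A : ℝ} {ψ : E3 → ℝ} (hγ : 0 < γ) (hγ2 : γ ≤ 2)
    (h : IsSlice γ U B D F P Q) (hψt : IsTest ψ) (hψ : IsSymbol A γ ψ) (i j k : Fin 3) :
    Integrable (fun x => P i j x * (U x k * pd k ψ x)) volume ∧
      Integrable (fun x => Q i j x * (U x k * pd k ψ x)) volume := by
  obtain ⟨hU, -, -, -⟩ := h.aestronglyMeasurable
  have hUψ : AEStronglyMeasurable (fun x => U x k * pd k ψ x) volume :=
    (aestronglyMeasurable_apply hU k).mul (hψt.pd k).1.continuous.aestronglyMeasurable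
  have hP := h.memLp_P hγ i j
  have hQ := h.memLp_Q hγ i j
  have hPm := aestronglyMeasurable_of_wt_smul hP.1
  have hQm := aestronglyMeasurable_of_wt_smul hQ.1
  have hk (x : E3) := PiLp.norm_apply_le (U x) k
  refine ⟨⟨hPm.mul hUψ, ?_⟩, ⟨hQm.mul hUψ, ?_⟩⟩
  · refine (lintegral_enorm_le_wn (a := γ) (b := γ / 2) (C := A) holderConjugate_six_fifths_six hPm hU
      fun x => ?_).trans_lt (ENNReal.mul_lt_top ENNReal.ofReal_lt_top
        (ENNReal.mul_lt_top hP.2 (wn_lt_top_of_sobolev hγ h)))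
    rw [abs_mul, abs_mul]
    refine (mul_le_mul_of_nonneg_left (mul_le_mul (hk x) (hψ.abs_pd_le hγ2 k x) (abs_nonneg _)
      (norm_nonneg _)) (abs_nonneg _)).trans (le_of_eq ?_)
    rw [show wt γ x = wt (γ / 2) x * wt (γ / 2) x by rw [← wt_add, add_halves], Real.norm_eq_abs]
    ring
  · refine (lintegral_enorm_le_wn (a := γ / 2) (b := γ / 2) (C := A) holderConjugate_two_two hQm hU
      fun x => ?_).trans_lt (ENNReal.mul_lt_top ENNReal.ofReal_lt_top
        (ENNReal.mul_lt_top hQ.2 h.U_mem.2))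
    rw [abs_mul, abs_mul]
    refine (mul_le_mul_of_nonneg_left (mul_le_mul (hk x) (hψ.abs_pd_le' k x) (abs_nonneg _)
      (norm_nonneg _)) (abs_nonneg _)).trans (le_of_eq ?_)
    rw [Real.norm_eq_abs]
    ring

lemma exists_enorm_integral_pressure_le (hγ : 0 < γ) (hγ2 : γ ≤ 2) : ∃ C : ℝ≥0,
    ∀ A ψ U B D F P Q, IsSlice γ U B D F P Q → IsTest ψ → IsSymbol A γ ψ →
    ‖∫ x, (∑ i, ∑ j, (P i j x - Q i j x)) * ∑ k, U x k * pd k ψ x‖ₑ ≤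
      C * ENNReal.ofReal A * (wn (γ / 2) 3 B * wn (γ / 2) 6 U * wn (γ / 2) 2 U +
        wn (γ / 2) 2 F * wn (γ / 2) 2 U) := by
  obtain ⟨C, hC⟩ := exists_enorm_integral_P_le hγ hγ2
  obtain ⟨C', hC'⟩ := exists_enorm_integral_Q_le hγ hγ2
  refine ⟨27 * (C + C'), fun A ψ U B D F P Q h hψt hψ => ?_⟩
  have hi (i j k : Fin 3) := integrable_pressure_mul hγ hγ2 h hψt hψ i j k
  have e : ∫ x, (∑ i, ∑ j, (P i j x - Q i j x)) * ∑ k, U x k * pd k ψ x =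
      ∑ i, ∑ j, ∑ k, ((∫ x, P i j x * (U x k * pd k ψ x)) - ∫ x, Q i j x * (U x k * pd k ψ x)) := by
    have hs (i j k : Fin 3) : Integrable (fun x => P i j x * (U x k * pd k ψ x) -
        Q i j x * (U x k * pd k ψ x)) volume := (hi i j k).1.sub (hi i j k).2
    calc _ = ∫ x, ∑ i, ∑ j, ∑ k, (P i j x * (U x k * pd k ψ x) - Q i j x * (U x k * pd k ψ x)) := by
          simp_rw [Finset.sum_mul, Finset.mul_sum, sub_mul]
      _ = _ := by
          rw [integral_finsetSum _ fun i _ => integrable_finsetSum _ fun j _ =>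
            integrable_finsetSum _ fun k _ => hs i j k]
          refine Finset.sum_congr rfl fun i _ => ?_
          rw [integral_finsetSum _ fun j _ => integrable_finsetSum _ fun k _ => hs i j k]
          refine Finset.sum_congr rfl fun j _ => ?_
          rw [integral_finsetSum _ fun k _ => hs i j k]
          exact Finset.sum_congr rfl fun k _ => integral_sub (hi i j k).1 (hi i j k).2
  rw [e]
  set X := wn (γ / 2) 3 B * wn (γ / 2) 6 U * wn (γ / 2) 2 U
  set Y := wn (γ / 2) 2 F * wn (γ / 2) 2 U
  have hb (i j k : Fin 3) : ‖(∫ x, P i j x * (U x k * pd k ψ x)) -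
      ∫ x, Q i j x * (U x k * pd k ψ x)‖ₑ ≤ (C + C') * ENNReal.ofReal A * (X + Y) := by
    refine enorm_sub_le.trans ((add_le_add (hC A ψ U B D F P Q h hψt hψ i j k)
      (hC' A ψ U B D F P Q h hψt hψ i j k)).trans ?_)
    calc _ ≤ C * ENNReal.ofReal A * (X + Y) + C' * ENNReal.ofReal A * (X + Y) := by
          gcongr
          · exact le_self_add
          · exact le_add_self
      _ = _ := by ring
  have hsum {f : Fin 3 → ℝ} {c : ℝ≥0∞} (hf : ∀ i, ‖f i‖ₑ ≤ c) : ‖∑ i, f i‖ₑ ≤ 3 * c := by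
    refine (enorm_sum_le _ _).trans ((Finset.sum_le_card_nsmul _ _ c fun i _ => hf i).trans ?_)
    simp
  refine (hsum fun i => hsum fun j => hsum fun k => hb i j k).trans (le_of_eq ?_)
  push_cast
  ring

lemma lintegral_enorm_five_le {f₁ f₂ f₃ f₄ f₅ : E3 → ℝ} (h₁ : AEStronglyMeasurable f₁ volume)
    (h₂ : AEStronglyMeasurable f₂ volume) (h₃ : AEStronglyMeasurable f₃ volume)
    (h₄ : AEStronglyMeasurable f₄ volume) :
    ∫⁻ x, ‖f₁ x + f₂ x + f₃ x - f₄ x - f₅ x‖ₑ ≤ (∫⁻ x, ‖f₁ x‖ₑ) + (∫⁻ x, ‖f₂ x‖ₑ) +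
      (∫⁻ x, ‖f₃ x‖ₑ) + (∫⁻ x, ‖f₄ x‖ₑ) + ∫⁻ x, ‖f₅ x‖ₑ := by
  have e : (∫⁻ x, ‖f₁ x‖ₑ) + (∫⁻ x, ‖f₂ x‖ₑ) + (∫⁻ x, ‖f₃ x‖ₑ) + (∫⁻ x, ‖f₄ x‖ₑ) +
      (∫⁻ x, ‖f₅ x‖ₑ) = ∫⁻ x, (‖f₁ x‖ₑ + ‖f₂ x‖ₑ + ‖f₃ x‖ₑ + ‖f₄ x‖ₑ + ‖f₅ x‖ₑ) := by
    have m2 : AEMeasurable (fun x => ‖f₁ x‖ₑ + ‖f₂ x‖ₑ) volume := h₁.enorm.add h₂.enorm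
    have m3 : AEMeasurable (fun x => ‖f₁ x‖ₑ + ‖f₂ x‖ₑ + ‖f₃ x‖ₑ) volume := m2.add h₃.enorm
    have m4 : AEMeasurable (fun x => ‖f₁ x‖ₑ + ‖f₂ x‖ₑ + ‖f₃ x‖ₑ + ‖f₄ x‖ₑ) volume :=
      m3.add h₄.enorm
    rw [lintegral_add_left' m4, lintegral_add_left' m3, lintegral_add_left' m2,
      lintegral_add_left' h₁.enorm]
  rw [e]
  exact lintegral_mono fun x => enorm_sub_le.trans (add_le_add (enorm_sub_le.trans (add_le_add
    ((enorm_add_le _ _).trans (add_le_add (enorm_add_le _ _) le_rfl)) le_rfl)) le_rfl)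

lemma enorm_integral_five_le {f₁ f₂ f₃ f₄ f₅ : E3 → ℝ} (h₁ : Integrable f₁ volume)
    (h₂ : Integrable f₂ volume) (h₃ : Integrable f₃ volume) (h₄ : Integrable f₄ volume)
    (h₅ : Integrable f₅ volume) :
    ‖∫ x, (f₁ x + f₂ x + f₃ x - f₄ x - f₅ x)‖ₑ ≤ ‖∫ x, f₁ x‖ₑ + ‖∫ x, f₂ x‖ₑ +
      ‖∫ x, f₃ x‖ₑ + ‖∫ x, f₄ x‖ₑ + ‖∫ x, f₅ x‖ₑ := by
  have h12 : Integrable (fun x => f₁ x + f₂ x) volume := h₁.add h₂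
  have h123 : Integrable (fun x => f₁ x + f₂ x + f₃ x) volume := h12.add h₃
  have h1234 : Integrable (fun x => f₁ x + f₂ x + f₃ x - f₄ x) volume := h123.sub h₄
  rw [integral_sub h1234 h₅, integral_sub h123 h₄, integral_add h12 h₃, integral_add h₁ h₂]
  exact enorm_sub_le.trans (add_le_add (enorm_sub_le.trans (add_le_add
    ((enorm_add_le _ _).trans (add_le_add (enorm_add_le _ _) le_rfl)) le_rfl)) le_rfl)

/-- The spatial terms of the energy balance tested against `ψ`, apart from the dissipation. -/
def energyFlux (ψ : E3 → ℝ) (U B : E3 → E3) (D F : E3 → Tensor3) (S : E3 → ℝ) (x : E3) : ℝ :=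
  ‖U x‖ ^ 2 / 2 * ∑ i, pd i (pd i ψ) x + ‖U x‖ ^ 2 / 2 * ∑ i, B x i * pd i ψ x +
    S x * ∑ i, U x i * pd i ψ x - ∑ i, ∑ j, F x (i, j) * U x j * pd i ψ x -
    (∑ i, ∑ j, F x (i, j) * D x (i, j)) * ψ x

/-- Two bounds with different roles. The first controls the absolute value, uses the pressure norms,
and provides integrability in space and time. The second controls only the integral, through the
cancellation in the duality argument, and is free of the pressure; it alone drives the energy
estimate. -/
lemma exists_energyFlux_le (hγ : 0 < γ) (hγ2 : γ ≤ 2) : ∃ C : ℝ≥0, ∀ n U B D F P Q (S : E3 → ℝ),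
    IsSlice γ U B D F P Q → (S =ᵐ[volume] fun x => ∑ i, ∑ j, (P i j x - Q i j x)) →
    ∫⁻ x, ‖energyFlux (cutWt γ n) U B D F S x‖ₑ ≤
      C * (wn (γ / 2) 2 U * wn (γ / 2) 2 U + wn (γ / 2) 3 B * wn (γ / 2) 6 U * wn (γ / 2) 2 U +
        wn γ (6 / 5) (fun x => ∑ i, ∑ j, P i j x) * wn (γ / 2) 6 U +
        wn (γ / 2) 2 (fun x => ∑ i, ∑ j, Q i j x) * wn (γ / 2) 2 U +
        wn (γ / 2) 2 F * wn (γ / 2) 2 U + wn (γ / 2) 2 F * wn (γ / 2) 2 D) ∧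
    ‖∫ x, energyFlux (cutWt γ n) U B D F S x‖ₑ ≤
      C * (wn (γ / 2) 2 U * wn (γ / 2) 2 U + wn (γ / 2) 3 B * wn (γ / 2) 6 U * wn (γ / 2) 2 U +
        wn (γ / 2) 2 F * wn (γ / 2) 2 U + wn (γ / 2) 2 F * wn (γ / 2) 2 D) := by
  obtain ⟨C, hC⟩ := exists_enorm_integral_pressure_le hγ hγ2
  obtain ⟨A, hA⟩ := exists_isSymbol_cutWt γ
  have hA0 := (hA 0).nonneg
  set a := A.toNNReal with ha
  have haA (c : ℝ) (hc : 0 ≤ c) : ENNReal.ofReal (c * A) = ENNReal.ofReal c * a :=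
    ENNReal.ofReal_mul hc
  refine ⟨(9 + C) * a, fun n U B D F P Q S h hS => ?_⟩
  set ψ := cutWt γ n
  have hψ : IsSymbol A γ ψ := hA n
  have hψt : IsTest ψ := isTest_cutWt γ n
  obtain ⟨hU, hB, hD, hF⟩ := h.aestronglyMeasurable
  have hPm (i j : Fin 3) := aestronglyMeasurable_of_wt_smul (h.memLp_P hγ i j).1
  have hQm (i j : Fin 3) := aestronglyMeasurable_of_wt_smul (h.memLp_Q hγ i j).1
  have hSP : AEStronglyMeasurable (fun x => ∑ i, ∑ j, P i j x) volume :=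
    Finset.aestronglyMeasurable_fun_sum _ fun i _ =>
      Finset.aestronglyMeasurable_fun_sum _ fun j _ => hPm i j
  have hSQ : AEStronglyMeasurable (fun x => ∑ i, ∑ j, Q i j x) volume :=
    Finset.aestronglyMeasurable_fun_sum _ fun i _ =>
      Finset.aestronglyMeasurable_fun_sum _ fun j _ => hQm i j
  have hS' : S =ᵐ[volume] fun x => ∑ i, ∑ j, P i j x - ∑ i, ∑ j, Q i j x :=
    hS.trans (Eventually.of_forall fun x => by simp only [Finset.sum_sub_distrib])
  have hSm : AEStronglyMeasurable S volume := (hSP.sub hSQ).congr hS'.symm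
  have hpd (i : Fin 3) : AEStronglyMeasurable (pd i ψ) volume :=
    (hψt.pd i).1.continuous.aestronglyMeasurable
  have hsumU (V : E3 → E3) (hV : AEStronglyMeasurable V volume) :
      AEStronglyMeasurable (fun x => ∑ i, V x i * pd i ψ x) volume :=
    Finset.aestronglyMeasurable_fun_sum _ fun i _ => (aestronglyMeasurable_apply hV i).mul (hpd i)
  have hU2 : AEStronglyMeasurable (fun x => ‖U x‖ ^ 2 / 2) volume :=
    ((hU.norm.pow 2).mul_const 2⁻¹)
  have l1 := lintegral_lapl_term_le hψ hU
  have l2 := lintegral_drift_term_le hψ hγ2 hU hB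
  have l4 := lintegral_force_term_le hψ hU hF
  have l5 := lintegral_force_grad_term_le hψ hD hF
  have l3 : ∫⁻ x, ‖S x * ∑ i, U x i * pd i ψ x‖ₑ ≤ ENNReal.ofReal (3 * A) *
      (wn γ (6 / 5) (fun x => ∑ i, ∑ j, P i j x) * wn (γ / 2) 6 U) + ENNReal.ofReal (3 * A) *
      (wn (γ / 2) 2 (fun x => ∑ i, ∑ j, Q i j x) * wn (γ / 2) 2 U) := by
    refine le_trans ?_ (add_le_add (lintegral_pressure_term_le hψ hγ2 hU hSP)
      (lintegral_pressure_term_le' hψ hU hSQ))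
    refine le_trans (lintegral_mono_ae ?_)
      (lintegral_add_left' (f := fun x => ‖(∑ i, ∑ j, P i j x) * ∑ i, U x i * pd i ψ x‖ₑ)
        (hSP.mul (hsumU U hU)).enorm _).le
    filter_upwards [hS'] with x hx
    rw [hx, sub_mul]
    exact enorm_sub_le
  have m1 : AEStronglyMeasurable (fun x => ‖U x‖ ^ 2 / 2 * ∑ i, pd i (pd i ψ) x) volume :=
    hU2.mul (Finset.aestronglyMeasurable_fun_sum _ fun i _ =>
      ((hψt.pd i).pd i).1.continuous.aestronglyMeasurable)
  have m2 : AEStronglyMeasurable (fun x => ‖U x‖ ^ 2 / 2 * ∑ i, B x i * pd i ψ x) volume :=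
    hU2.mul (hsumU B hB)
  have m3 : AEStronglyMeasurable (fun x => S x * ∑ i, U x i * pd i ψ x) volume :=
    hSm.mul (hsumU U hU)
  have m4 : AEStronglyMeasurable (fun x => ∑ i, ∑ j, F x (i, j) * U x j * pd i ψ x) volume :=
    Finset.aestronglyMeasurable_fun_sum _ fun i _ =>
      Finset.aestronglyMeasurable_fun_sum _ fun j _ =>
        ((aestronglyMeasurable_apply hF (i, j)).mul (aestronglyMeasurable_apply hU j)).mul (hpd i)
  have m5 : AEStronglyMeasurable (fun x => (∑ i, ∑ j, F x (i, j) * D x (i, j)) * ψ x) volume :=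
    (Finset.aestronglyMeasurable_fun_sum _ fun i _ =>
      Finset.aestronglyMeasurable_fun_sum _ fun j _ =>
        (aestronglyMeasurable_apply hF (i, j)).mul (aestronglyMeasurable_apply hD (i, j))).mul
      hψt.1.continuous.aestronglyMeasurable
  rw [haA 3 (by norm_num)] at l1 l2 l3
  rw [haA 9 (by norm_num)] at l4 l5
  set N := wn (γ / 2) 2 U with hN
  set G := wn (γ / 2) 2 D with hG
  set H := wn (γ / 2) 3 B with hH
  set K := wn (γ / 2) 2 F with hK
  set M := wn (γ / 2) 6 U with hM
  set X := wn γ (6 / 5) (fun x => ∑ i, ∑ j, P i j x) with hX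
  set Y := wn (γ / 2) 2 (fun x => ∑ i, ∑ j, Q i j x) with hY
  have c3 : ENNReal.ofReal 3 = 3 := by simp
  have c9 : ENNReal.ofReal 9 = 9 := by simp
  rw [c3] at l1 l2 l3
  rw [c9] at l4 l5
  have h39 : (3 : ℝ≥0∞) ≤ 9 := by norm_num
  constructor
  · refine (lintegral_enorm_five_le m1 m2 m3 m4).trans ((add_le_add (add_le_add (add_le_add
      (add_le_add l1 l2) l3) l4) l5).trans ?_)
    calc _ ≤ 9 * a * (N * N) + 9 * a * (H * M * N) + (9 * a * (X * M) + 9 * a * (Y * N)) +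
          9 * a * (K * N) + 9 * a * (K * G) := by gcongr
      _ = 9 * a * (N * N + H * M * N + X * M + Y * N + K * N + K * G) := by ring
      _ ≤ _ := by
        push_cast
        gcongr
        exact le_self_add
  · have hfin : N < ⊤ := h.U_mem.2
    have hG' : G < ⊤ := h.D_mem.2
    have hH' : H < ⊤ := h.B_mem.2
    have hK' : K < ⊤ := h.F_mem.2
    have hM' : M < ⊤ := wn_lt_top_of_sobolev hγ h
    have i1 : Integrable _ volume := ⟨m1, l1.trans_lt (by finiteness)⟩
    have i2 : Integrable _ volume := ⟨m2, l2.trans_lt (by finiteness)⟩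
    have i4 : Integrable _ volume := ⟨m4, l4.trans_lt (by finiteness)⟩
    have i5 : Integrable _ volume := ⟨m5, l5.trans_lt (by finiteness)⟩
    have i3 : Integrable (fun x => S x * ∑ i, U x i * pd i ψ x) volume := by
      have : Integrable (fun x => ∑ i, ∑ j, ∑ k,
          (P i j x * (U x k * pd k ψ x) - Q i j x * (U x k * pd k ψ x))) volume :=
        integrable_finsetSum _ fun i _ => integrable_finsetSum _ fun j _ =>
          integrable_finsetSum _ fun k _ =>
            (integrable_pressure_mul hγ hγ2 h hψt hψ i j k).1.sub
              (integrable_pressure_mul hγ hγ2 h hψt hψ i j k).2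
      refine this.congr ?_
      filter_upwards [hS] with x hx
      rw [hx]
      simp_rw [Finset.sum_mul, Finset.mul_sum, sub_mul]
    -- The only term whose absolute value is not integrated: duality is used in place of `l3`.
    have e3 : ‖∫ x, S x * ∑ i, U x i * pd i ψ x‖ₑ ≤ C * a * (H * M * N + K * N) := by
      refine le_of_eq_of_le ?_ (hC A ψ U B D F P Q h hψt hψ)
      congr 1
      refine integral_congr_ae ?_
      filter_upwards [hS] with x hx
      rw [hx]
    refine (enorm_integral_five_le i1 i2 i3 i4 i5).trans ?_
    refine (add_le_add (add_le_add (add_le_add (add_le_add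
      ((enorm_integral_le_lintegral_enorm _).trans l1)
      ((enorm_integral_le_lintegral_enorm _).trans l2)) e3)
      ((enorm_integral_le_lintegral_enorm _).trans l4))
      ((enorm_integral_le_lintegral_enorm _).trans l5)).trans ?_
    calc _ ≤ (9 + C) * a * (N * N) + 9 * a * (H * M * N) + C * a * (H * M * N + K * N) +
          9 * a * (K * N) + (9 + C) * a * (K * G) := by
          gcongr
          · exact h39.trans le_self_add
          · exact le_self_add
      _ = _ := by push_cast; ring

/-! ### Integrating a distributional inequality in time. -/

/-- Smooth approximations of the indicator function of `(s, t]`. -/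
def smoothStep (s t : ℝ) (n : ℕ) : ℝ → ℝ := moll volume n ((Ioc s t).indicator fun _ => (1 : ℝ))

section Step

variable {s t : ℝ}

lemma integrable_indicator_Ioc_one (s t : ℝ) :
    Integrable ((Ioc s t).indicator fun _ => (1 : ℝ)) volume :=
  (integrable_indicator_iff measurableSet_Ioc).2 (integrableOn_const (by simp))

lemma contDiff_smoothStep (n : ℕ) : ContDiff ℝ ∞ (smoothStep s t n) :=
  contDiff_moll volume n (integrable_indicator_Ioc_one s t).locallyIntegrable

lemma smoothStep_nonneg (n : ℕ) (r : ℝ) : 0 ≤ smoothStep s t n r := by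
  rw [smoothStep, moll_apply]
  exact integral_nonneg fun y => mul_nonneg (mollKer_nonneg _ n _)
    (indicator_nonneg (fun _ _ => zero_le_one) y)

lemma smoothStep_le_one (n : ℕ) (r : ℝ) : smoothStep s t n r ≤ 1 := by
  have hk : Integrable (fun y => mollKer (volume : Measure ℝ) n (r - y)) volume :=
    ((contDiff_mollKer volume n).continuous.integrable_of_hasCompactSupport
      (hasCompactSupport_mollKer volume n)).comp_sub_left r
  have h1 : ∫ y, mollKer (volume : Measure ℝ) n (r - y) = 1 := by
    rw [integral_sub_left_eq_self (mollKer (volume : Measure ℝ) n) volume r, integral_mollKer]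
  rw [smoothStep, moll_apply]
  refine le_of_le_of_eq ?_ h1
  refine integral_mono (convolutionExists_moll volume n
    (integrable_indicator_Ioc_one s t).locallyIntegrable r) hk fun y => ?_
  refine mul_le_of_le_one_right (mollKer_nonneg _ n _) ?_
  exact indicator_le_self' (f := fun _ => (1 : ℝ)) (fun _ _ => zero_le_one) y

lemma support_smoothStep_subset (n : ℕ) :
    tsupport (smoothStep s t n) ⊆ Icc (s - 1 / ((n : ℝ) + 1)) (t + 1 / ((n : ℝ) + 1)) := by
  refine closure_minimal (fun r hr => ?_) isClosed_Icc
  by_contra hr'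
  refine hr ?_
  rw [smoothStep, moll_apply]
  refine integral_eq_zero_of_ae (Eventually.of_forall fun y => ?_)
  beta_reduce
  by_cases hy : y ∈ Ioc s t
  · rw [mollKer_eq_zero volume, zero_mul, Pi.zero_apply]
    rw [mem_Icc, not_and_or, not_le, not_le] at hr'
    rw [Real.norm_eq_abs, le_abs]
    rcases hr' with h | h
    · right; linarith [hy.1]
    · left; linarith [hy.2]
  · rw [indicator_of_notMem hy, mul_zero, Pi.zero_apply]

/-- The derivative is a difference of mollifiers centred at the two endpoints, so pairing it with a
function returns the mollifications of that function there. -/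
lemma hasDerivAt_smoothStep (hst : s ≤ t) (n : ℕ) (r : ℝ) :
    HasDerivAt (smoothStep s t n)
      (mollKer (volume : Measure ℝ) n (r - s) - mollKer (volume : Measure ℝ) n (r - t)) r := by
  have hc := (contDiff_mollKer (volume : Measure ℝ) n).continuous
  have hi (a b : ℝ) : IntervalIntegrable (mollKer (volume : Measure ℝ) n) volume a b :=
    hc.intervalIntegrable a b
  have e : smoothStep s t n = fun r => (∫ x in (0 : ℝ)..(r - s), mollKer (volume : Measure ℝ) n x) -
      ∫ x in (0 : ℝ)..(r - t), mollKer (volume : Measure ℝ) n x := by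
    ext r
    rw [intervalIntegral.integral_interval_sub_left (hi _ _) (hi _ _),
      ← intervalIntegral.integral_comp_sub_left (fun x => mollKer (volume : Measure ℝ) n x) r,
      intervalIntegral.integral_of_le hst, smoothStep, moll_apply, ← integral_indicator measurableSet_Ioc]
    congr 1; ext y
    by_cases hy : y ∈ Ioc s t <;> simp [hy]
  have hd (c : ℝ) : HasDerivAt (fun r => ∫ x in (0 : ℝ)..(r - c), mollKer (volume : Measure ℝ) n x)
      (mollKer (volume : Measure ℝ) n (r - c)) r := by
    have h1 := intervalIntegral.integral_hasDerivAt_right (hi 0 (r - c))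
      hc.stronglyMeasurable.stronglyMeasurableAtFilter hc.continuousAt
    have h2 := h1.comp r ((hasDerivAt_id r).sub_const c)
    rw [mul_one] at h2
    exact h2
  rw [e]
  exact (hd s).sub (hd t)

end Step

lemma mollKer_neg (n : ℕ) (x : ℝ) :
    mollKer (volume : Measure ℝ) n (-x) = mollKer (volume : Measure ℝ) n x :=
  (mollBump ℝ n).normed_neg x

/-- A distributional differential inequality on `(0, T)` can be integrated. -/
lemma exists_forall_le_add_integral {T : ℝ} {A B : ℝ → ℝ} (hA : IntegrableOn A (Ioo 0 T))
    (hB : IntegrableOn B (Ioo 0 T))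
    (h : ∀ η : ℝ → ℝ, ContDiff ℝ ∞ η → HasCompactSupport η → tsupport η ⊆ Ioo 0 T → (∀ t, 0 ≤ η t) →
      - ∫ t in Ioo 0 T, deriv η t * A t ≤ ∫ t in Ioo 0 T, η t * B t) :
    ∀ᵐ s ∂(volume.restrict (Ioo 0 T)), ∀ᵐ t ∂(volume.restrict (Ioo 0 T)), s < t →
      A t ≤ A s + ∫ r in Ioc s t, B r := by
  set A₀ := (Ioo 0 T).indicator A
  set B₀ := (Ioo 0 T).indicator B
  have hA₀ : Integrable A₀ volume := hA.integrable_indicator measurableSet_Ioo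
  have hB₀ : Integrable B₀ volume := hB.integrable_indicator measurableSet_Ioo
  have hind (f g : ℝ → ℝ) : ∫ t in Ioo 0 T, f t * g t = ∫ t, f t * (Ioo 0 T).indicator g t := by
    rw [← integral_indicator measurableSet_Ioo]
    congr 1; ext r
    by_cases hr : r ∈ Ioo 0 T <;> simp [hr]
  -- The admissible times are those at which the mollifications of A converge to A.
  have hae : ∀ᵐ t ∂(volume.restrict (Ioo 0 T)), t ∈ Ioo 0 T ∧
      Tendsto (fun n => moll volume n A₀ t) atTop (𝓝 (A t)) := by
    filter_upwards [ae_restrict_mem measurableSet_Ioo,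
      ae_restrict_of_ae (ae_tendsto_moll volume hA₀.locallyIntegrable)] with t ht h
    rw [show A₀ t = A t from indicator_of_mem ht A] at h
    exact ⟨ht, h⟩
  filter_upwards [hae] with s hs
  filter_upwards [hae] with t ht hst
  have hev : ∀ᶠ n : ℕ in atTop, moll volume n A₀ t - moll volume n A₀ s ≤
      ∫ r, smoothStep s t n r * B₀ r := by
    have hδ := tendsto_one_div_add_atTop_nhds_zero_nat (𝕜 := ℝ)
    filter_upwards [hδ.eventually (gt_mem_nhds hs.1.1),
      hδ.eventually (gt_mem_nhds (sub_pos.2 ht.1.2))] with n h1 h2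
    have hsub : tsupport (smoothStep s t n) ⊆ Ioo 0 T :=
      (support_smoothStep_subset n).trans fun r hr => ⟨by linarith [hr.1], by linarith [hr.2]⟩
    have h3 := h (smoothStep s t n) (contDiff_smoothStep n)
      (isCompact_Icc.of_isClosed_subset (isClosed_tsupport _) (support_smoothStep_subset n)) hsub
      (smoothStep_nonneg n)
    rw [hind, hind] at h3
    refine le_trans (le_of_eq ?_) h3
    -- Since the mollifier is even, minus the pairing of A with the derivative of the smooth step is
    -- the mollified A at t minus that at s.
    rw [moll_apply, moll_apply, ← integral_sub (convolutionExists_moll volume n hA₀.locallyIntegrable t)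
      (convolutionExists_moll volume n hA₀.locallyIntegrable s), ← integral_neg]
    congr 1; ext r
    rw [(hasDerivAt_smoothStep hst.le n r).deriv, ← mollKer_neg n (r - s), ← mollKer_neg n (r - t),
      neg_sub, neg_sub]
    ring
  have hlim : Tendsto (fun n => ∫ r, smoothStep s t n r * B₀ r) atTop (𝓝 (∫ r in Ioc s t, B r)) := by
    have e : ∫ r in Ioc s t, B r = ∫ r, (Ioc s t).indicator (fun _ => (1 : ℝ)) r * B₀ r := by
      rw [← integral_indicator measurableSet_Ioc]
      congr 1; ext r
      by_cases hr : r ∈ Ioc s t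
      · rw [indicator_of_mem hr, indicator_of_mem hr, one_mul,
          show B₀ r = B r from indicator_of_mem
            (show r ∈ Ioo 0 T from ⟨hs.1.1.trans hr.1, hr.2.trans_lt ht.1.2⟩) B]
      · rw [indicator_of_notMem hr, indicator_of_notMem hr, zero_mul]
    rw [e]
    refine tendsto_integral_of_dominated_convergence (fun r => ‖B₀ r‖)
      (fun n => (contDiff_smoothStep n).continuous.aestronglyMeasurable.mul hB₀.1) hB₀.norm
      (fun n => Eventually.of_forall fun r => ?_) ?_
    · rw [norm_mul, Real.norm_of_nonneg (smoothStep_nonneg n r)]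
      exact mul_le_of_le_one_left (norm_nonneg _) (smoothStep_le_one n r)
    · filter_upwards [ae_tendsto_moll volume
        (integrable_indicator_Ioc_one s t).locallyIntegrable] with r hr
      exact hr.mul_const _
  have := le_of_tendsto_of_tendsto (ht.2.sub hs.2) hlim hev
  linarith

/-! ### Time integrability of the weighted norms and the localized energy inequality. -/

lemma MemLtLx.ae_memLp_slice {V : Type*} [NormedAddCommGroup V] [NormedSpace ℝ V] {T a : ℝ}
    {q r : ℝ≥0∞} {f : ℝ → E3 → V} (ha : 0 ≤ a) (hq0 : q ≠ 0) (hqt : q ≠ ⊤) (hr0 : r ≠ 0)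
    (hrt : r ≠ ⊤) (hf : MemLtLx T q r (a * r.toReal) f) :
    ∀ᵐ t ∂(volume.restrict (Ioo 0 T)), MemLp (fun x => wt a x • f t x) r volume := by
  have h := hf.lintegral_lt_top ha hq0 hqt hr0 hrt
  filter_upwards [ae_aestronglyMeasurable_slice hf.1, ae_lt_top'
    ((aemeasurable_eLpNorm_slice hf.1 a hr0 hrt).pow_const _) h.ne] with t ht h1
  refine ⟨(continuous_wt a).aestronglyMeasurable.smul ht, ?_⟩
  exact (ENNReal.rpow_lt_top_iff_of_pos (ENNReal.toReal_pos hq0 hqt)).1 h1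

section Time

variable {T : ℝ} {f g : ℝ → ℝ≥0∞}

lemma lintegral_mul_lt_top_of_sq (hf : AEMeasurable f (volume.restrict (Ioo 0 T)))
    (hf2 : ∫⁻ t in Ioo 0 T, f t ^ 2 < ⊤) (hg2 : ∫⁻ t in Ioo 0 T, g t ^ 2 < ⊤) :
    ∫⁻ t in Ioo 0 T, f t * g t < ⊤ := by
  refine (lintegral_mono (g := fun t => f t ^ 2 + g t ^ 2) fun t => ?_).trans_lt ?_
  · rcases le_total (f t) (g t) with h | h
    · exact (mul_le_mul_left h _).trans ((sq (g t)).symm.le.trans le_add_self)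
    · exact (mul_le_mul_right h _).trans ((sq (f t)).symm.le.trans le_self_add)
  · rw [lintegral_add_left' (hf.pow_const 2)]
    exact ENNReal.add_lt_top.2 ⟨hf2, hg2⟩

lemma lintegral_sq_lt_top_of_bound {c : ℝ≥0} (hf : ∀ᵐ t ∂(volume.restrict (Ioo 0 T)), f t ≤ c) :
    ∫⁻ t in Ioo 0 T, f t ^ 2 < ⊤ := by
  refine (lintegral_mono_ae (g := fun _ => (c : ℝ≥0∞) ^ 2) ?_).trans_lt ?_
  · filter_upwards [hf] with t ht
    gcongr
  · rw [setLIntegral_const]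
    exact ENNReal.mul_lt_top (by finiteness) (by simp)

/-- On an interval of finite length f² ≤ 1 + f³. Square integrability is all that is needed of the
L³ quantities. -/
lemma lintegral_sq_lt_top_of_cube (hf : ∫⁻ t in Ioo 0 T, f t ^ 3 < ⊤) :
    ∫⁻ t in Ioo 0 T, f t ^ 2 < ⊤ := by
  refine (lintegral_mono (g := fun t => 1 + f t ^ 3) fun t => ?_).trans_lt ?_
  · rcases le_total (f t) 1 with h | h
    · exact (pow_le_one' h 2).trans le_self_add
    · exact (pow_le_pow_right₀ h (by norm_num)).trans le_add_self
  · rw [lintegral_add_left measurable_const, setLIntegral_const]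
    refine ENNReal.add_lt_top.2 ⟨by simp, hf⟩

end Time

/-- The weighted norms in space of the data, as functions of time, are square integrable. -/
structure IsSquareIntegrable (T : ℝ) (f : ℝ → ℝ≥0∞) : Prop where
  aemeasurable : AEMeasurable f (volume.restrict (Ioo 0 T))
  lintegral_lt_top : ∫⁻ t in Ioo 0 T, f t ^ 2 < ⊤

lemma IsSquareIntegrable.mul {T : ℝ} {f g : ℝ → ℝ≥0∞} (hf : IsSquareIntegrable T f)
    (hg : IsSquareIntegrable T g) : ∫⁻ t in Ioo 0 T, f t * g t < ⊤ :=
  lintegral_mul_lt_top_of_sq hf.aemeasurable hf.lintegral_lt_top hg.lintegral_lt_top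

lemma IsSquareIntegrable.lintegral {T : ℝ} {f : ℝ → ℝ≥0∞} (hf : IsSquareIntegrable T f) :
    ∫⁻ t in Ioo 0 T, f t < ⊤ := by
  simpa using hf.mul (g := fun _ => 1) ⟨aemeasurable_const, by simp⟩

lemma isSquareIntegrable_add {T : ℝ} {f g : ℝ → ℝ≥0∞} (hf : IsSquareIntegrable T f)
    (hg : IsSquareIntegrable T g) : IsSquareIntegrable T (fun t => f t + g t) := by
  refine ⟨hf.aemeasurable.add hg.aemeasurable, ?_⟩
  have e (t : ℝ) : (f t + g t) ^ 2 = f t ^ 2 + g t ^ 2 + 2 * (f t * g t) := by ring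
  simp_rw [e]
  have hm : AEMeasurable (fun t => f t ^ 2 + g t ^ 2) (volume.restrict (Ioo 0 T)) :=
    (hf.aemeasurable.pow_const 2).add (hg.aemeasurable.pow_const 2)
  rw [lintegral_add_left' hm, lintegral_add_left' (hf.aemeasurable.pow_const 2), lintegral_const_mul' _ _ (by simp)]
  exact ENNReal.add_lt_top.2 ⟨ENNReal.add_lt_top.2 ⟨hf.lintegral_lt_top, hg.lintegral_lt_top⟩,
    ENNReal.mul_lt_top (by simp) (hf.mul hg)⟩

section Solution

variable {γ T : ℝ} {u₀ : E3 → E3} {F : ℝ → E3 → Tensor3} {b u : ℝ → E3 → E3}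
  {Du : ℝ → E3 → Tensor3} {p : ℝ → E3 → ℝ}

lemma half_mul_two (γ : ℝ) : γ / 2 * (2 : ℝ≥0∞).toReal = γ := by
  rw [ENNReal.toReal_ofNat, div_mul_cancel₀ _ two_ne_zero]

lemma isSquareIntegrable_of_memLtLx {V : Type*} [NormedAddCommGroup V] [NormedSpace ℝ V] {a : ℝ}
    {r : ℝ≥0∞} {f : ℝ → E3 → V} (ha : 0 ≤ a) (hr0 : r ≠ 0) (hrt : r ≠ ⊤)
    (hf : MemLtLx T 2 r (a * r.toReal) f) : IsSquareIntegrable T (fun t => wn a r (f t)) := by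
  refine ⟨aemeasurable_eLpNorm_slice hf.1 a hr0 hrt, ?_⟩
  simpa [wn] using hf.lintegral_lt_top ha two_ne_zero ENNReal.ofNat_ne_top hr0 hrt

lemma isSquareIntegrable_of_memLtLx_three {V : Type*} [NormedAddCommGroup V] [NormedSpace ℝ V]
    {a : ℝ} {r : ℝ≥0∞} {f : ℝ → E3 → V} (ha : 0 ≤ a) (hr0 : r ≠ 0) (hrt : r ≠ ⊤)
    (hf : MemLtLx T 3 r (a * r.toReal) f) : IsSquareIntegrable T (fun t => wn a r (f t)) := by
  refine ⟨aemeasurable_eLpNorm_slice hf.1 a hr0 hrt, lintegral_sq_lt_top_of_cube ?_⟩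
  have h := hf.lintegral_lt_top ha three_ne_zero ENNReal.ofNat_ne_top hr0 hrt
  have e : (3 : ℝ≥0∞).toReal = ((3 : ℕ) : ℝ) := by simp
  simp_rw [e, ENNReal.rpow_natCast] at h
  exact h

lemma IsADSolution.exists_bound (h : IsADSolution γ T u₀ F b u Du p) (hγ : 0 < γ) :
    ∃ c : ℝ≥0, ∀ᵐ t ∂(volume.restrict (Ioo 0 T)), wn (γ / 2) 2 (u t) ≤ c := by
  have h' := h.u_mem
  rw [← half_mul_two γ] at h'
  exact h'.exists_bound (by positivity) two_ne_zero ENNReal.ofNat_ne_top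

lemma IsADSolution.isSquareIntegrable_u (h : IsADSolution γ T u₀ F b u Du p) (hγ : 0 < γ) :
    IsSquareIntegrable T (fun t => wn (γ / 2) 2 (u t)) := by
  obtain ⟨c, hc⟩ := h.exists_bound hγ
  exact ⟨aemeasurable_eLpNorm_slice h.u_mem.1 _ two_ne_zero ENNReal.ofNat_ne_top,
    lintegral_sq_lt_top_of_bound hc⟩

lemma IsADSolution.isSquareIntegrable_Du (h : IsADSolution γ T u₀ F b u Du p) (hγ : 0 < γ) :
    IsSquareIntegrable T (fun t => wn (γ / 2) 2 (Du t)) :=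
  isSquareIntegrable_of_memLtLx (by positivity) two_ne_zero ENNReal.ofNat_ne_top
    (by rw [half_mul_two]; exact h.Du_mem)

lemma IsADSolution.isSquareIntegrable_F (h : IsADSolution γ T u₀ F b u Du p) (hγ : 0 < γ) :
    IsSquareIntegrable T (fun t => wn (γ / 2) 2 (F t)) :=
  isSquareIntegrable_of_memLtLx (by positivity) two_ne_zero ENNReal.ofNat_ne_top
    (by rw [half_mul_two]; exact h.F_mem)

lemma half_mul_three (γ : ℝ) : γ / 2 * (3 : ℝ≥0∞).toReal = 3 * γ / 2 := by
  rw [ENNReal.toReal_ofNat]; ring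

lemma IsADSolution.isSquareIntegrable_b (h : IsADSolution γ T u₀ F b u Du p) (hγ : 0 < γ) :
    IsSquareIntegrable T (fun t => wn (γ / 2) 3 (b t)) :=
  isSquareIntegrable_of_memLtLx_three (by positivity) three_ne_zero ENNReal.ofNat_ne_top
    (by rw [half_mul_three]; exact h.b_mem)

/-- At almost every time, the data form a slice. -/
lemma IsADSolution.exists_isSlice (h : IsADSolution γ T u₀ F b u Du p) (hγ : 0 < γ) :
    ∃ P Q : Fin 3 → Fin 3 → ℝ → E3 → ℝ,
      (∀ᵐ t ∂(volume.restrict (Ioo 0 T)),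
        IsSlice γ (u t) (b t) (Du t) (F t) (fun i j => P i j t) (fun i j => Q i j t)) ∧
      (∀ᵐ t ∂(volume.restrict (Ioo 0 T)), p t =ᵐ[volume] fun x => ∑ i, ∑ j, (P i j t x - Q i j t x)) ∧
      AEStronglyMeasurable (fun z : ℝ × E3 => p z.1 z.2) (slab T) ∧
      IsSquareIntegrable T (fun t => wn γ (6 / 5) (fun x => ∑ i, ∑ j, P i j t x)) ∧
      IsSquareIntegrable T (fun t => wn (γ / 2) 2 (fun x => ∑ i, ∑ j, Q i j t x)) := by
  obtain ⟨P, Q, hP, hQ, hSP, hSQ, hp⟩ := h.pressure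
  have hγ2 : 0 ≤ γ / 2 := by positivity
  refine ⟨P, Q, ?_, Measure.ae_ae_of_ae_prod hp, ?_, ?_, ?_⟩
  · have hu : ∀ᵐ t ∂(volume.restrict (Ioo 0 T)),
        MemLp (fun x => wt (γ / 2) x • u t x) 2 volume := by
      filter_upwards [ae_restrict_mem measurableSet_Ioo] with t ht
      refine MemLp.wt_smul hγ2 two_ne_zero ENNReal.ofNat_ne_top ?_
      rw [half_mul_two]
      exact h.slice_mem t ⟨ht.1.le, ht.2⟩
    have hD := MemLtLx.ae_memLp_slice (a := γ / 2) hγ2 two_ne_zero ENNReal.ofNat_ne_top two_ne_zero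
      ENNReal.ofNat_ne_top (by rw [half_mul_two]; exact h.Du_mem)
    have hF := MemLtLx.ae_memLp_slice (a := γ / 2) hγ2 two_ne_zero ENNReal.ofNat_ne_top two_ne_zero
      ENNReal.ofNat_ne_top (by rw [half_mul_two]; exact h.F_mem)
    have hb := MemLtLx.ae_memLp_slice (a := γ / 2) hγ2 three_ne_zero ENNReal.ofNat_ne_top
      three_ne_zero ENNReal.ofNat_ne_top (by rw [half_mul_three]; exact h.b_mem)
    have hgrad := ae_hasMollGrad (a := γ / 2) hγ2 h.u_mem.1 h.Du_mem.1 h.Du_grad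
      (fun j => (lintegral_mono fun t => eLpNorm_wt_mul_apply_le _ _ _ j).trans_lt
        (h.isSquareIntegrable_u hγ).lintegral)
      (fun k => (lintegral_mono fun t => eLpNorm_wt_mul_apply_le _ _ _ k).trans_lt
        (h.isSquareIntegrable_Du hγ).lintegral)
      (hu.mono fun t ht j => memLp_wt_mul_apply ht j) (hD.mono fun t ht k => memLp_wt_mul_apply ht k)
    have hP' : ∀ᵐ t ∂(volume.restrict (Ioo 0 T)), ∀ i j, IsRieszRiesz (6 / 5) (6 * γ / 5) i j
        (fun x => b t x i * u t x j) (P i j t) := by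
      simp only [ae_all_iff]; exact hP
    have hQ' : ∀ᵐ t ∂(volume.restrict (Ioo 0 T)), ∀ i j, IsRieszRiesz 2 γ i j
        (fun x => F t x (i, j)) (Q i j t) := by
      simp only [ae_all_iff]; exact hQ
    filter_upwards [hu, hD, hF, hb, hgrad, hP', hQ'] with t h1 h2 h3 h4 h5 h6 h7
    exact ⟨h1, h2, h3, h4, h5, h6, h7⟩
  · refine (hSP.1.sub hSQ.1).congr ?_
    filter_upwards [hp] with z hz
    rw [hz]
    simp [Finset.sum_sub_distrib]
  · refine isSquareIntegrable_of_memLtLx_three hγ.le (by simp) (by finiteness) ?_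
    rw [toReal_six_fifths, show γ * (6 / 5) = 6 * γ / 5 by ring]
    exact hSP
  · refine isSquareIntegrable_of_memLtLx hγ2 two_ne_zero ENNReal.ofNat_ne_top ?_
    rw [half_mul_two]
    exact hSQ

lemma IsADSolution.isSquareIntegrable_six (h : IsADSolution γ T u₀ F b u Du p) (hγ : 0 < γ) :
    IsSquareIntegrable T (fun t => wn (γ / 2) 6 (u t)) := by
  obtain ⟨P, Q, hs, -⟩ := h.exists_isSlice hγ
  obtain ⟨C, hC⟩ := exists_wn_six_le hγ
  have h2 := isSquareIntegrable_add (h.isSquareIntegrable_u hγ) (h.isSquareIntegrable_Du hγ)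
  refine ⟨aemeasurable_eLpNorm_slice h.u_mem.1 _ (by norm_num) ENNReal.ofNat_ne_top, ?_⟩
  refine (lintegral_mono_ae (g := fun t => (C : ℝ≥0∞) ^ 2 *
    (wn (γ / 2) 2 (u t) + wn (γ / 2) 2 (Du t)) ^ 2) ?_).trans_lt ?_
  · filter_upwards [hs] with t ht
    rw [← mul_pow]
    exact pow_le_pow_left' (hC _ _ _ _ _ _ ht) 2
  · rw [lintegral_const_mul' _ _ (by finiteness)]
    exact ENNReal.mul_lt_top (by finiteness) h2.lintegral_lt_top

end Solution

/-- Superadditivity of the lower limit. It allows Fatou to be applied separately to the energy and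
to the dissipation. -/
lemma liminf_add_liminf_le {a b : ℕ → ℝ≥0∞} {R : ℝ≥0∞} (h : ∀ᶠ n in atTop, a n + b n ≤ R) :
    liminf a atTop + liminf b atTop ≤ R := by
  obtain ⟨m, hm⟩ := eventually_atTop.1 h
  rw [liminf_eq_iSup_iInf_of_nat, liminf_eq_iSup_iInf_of_nat]
  have mono (c : ℕ → ℝ≥0∞) : Monotone fun n => ⨅ i, ⨅ (_ : i ≥ n), c i := fun n k hnk =>
    le_iInf₂ fun i hi => iInf₂_le i (hnk.trans hi)
  rw [ENNReal.iSup_add_iSup_of_monotone (mono a) (mono b)]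
  refine iSup_le fun n => ?_
  exact (add_le_add (iInf₂_le (max n m) (le_max_left _ _)) (iInf₂_le (max n m) (le_max_left _ _))).trans
    (hm _ (le_max_right _ _))

section Solution

variable {γ T : ℝ} {u₀ : E3 → E3} {F : ℝ → E3 → Tensor3} {b u : ℝ → E3 → E3}
  {Du : ℝ → E3 → Tensor3} {p : ℝ → E3 → ℝ}

lemma slab_apply {ι : Type*} [Fintype ι] {f : ℝ → E3 → EuclideanSpace ℝ ι}
    (hf : AEStronglyMeasurable (fun z : ℝ × E3 => f z.1 z.2) (slab T)) (i : ι) :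
    AEStronglyMeasurable (fun z : ℝ × E3 => f z.1 z.2 i) (slab T) :=
  (EuclideanSpace.proj (𝕜 := ℝ) i).continuous.comp_aestronglyMeasurable hf

lemma slab_energyFlux {ψ : E3 → ℝ} (hψ : IsTest ψ)
    (hu : AEStronglyMeasurable (fun z : ℝ × E3 => u z.1 z.2) (slab T))
    (hb : AEStronglyMeasurable (fun z : ℝ × E3 => b z.1 z.2) (slab T))
    (hD : AEStronglyMeasurable (fun z : ℝ × E3 => Du z.1 z.2) (slab T))
    (hF : AEStronglyMeasurable (fun z : ℝ × E3 => F z.1 z.2) (slab T))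
    (hp : AEStronglyMeasurable (fun z : ℝ × E3 => p z.1 z.2) (slab T)) :
    AEStronglyMeasurable (fun z : ℝ × E3 =>
      energyFlux ψ (u z.1) (b z.1) (Du z.1) (F z.1) (p z.1) z.2) (slab T) := by
  have hpd (i : Fin 3) : AEStronglyMeasurable (fun z : ℝ × E3 => pd i ψ z.2) (slab T) :=
    slab_aestronglyMeasurable_comp_snd (hψ.pd i).1.continuous
  have hpd2 (i : Fin 3) : AEStronglyMeasurable (fun z : ℝ × E3 => pd i (pd i ψ) z.2) (slab T) :=
    slab_aestronglyMeasurable_comp_snd ((hψ.pd i).pd i).1.continuous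
  have hu2 : AEStronglyMeasurable (fun z : ℝ × E3 => ‖u z.1 z.2‖ ^ 2 / 2) (slab T) :=
    (hu.norm.pow 2).mul_const 2⁻¹
  simp only [energyFlux]
  refine ((((hu2.mul ?_).add (hu2.mul ?_)).add (hp.mul ?_)).sub ?_).sub
    (AEStronglyMeasurable.mul ?_ (slab_aestronglyMeasurable_comp_snd hψ.1.continuous))
  · exact Finset.aestronglyMeasurable_fun_sum _ fun i _ => hpd2 i
  · exact Finset.aestronglyMeasurable_fun_sum _ fun i _ => (slab_apply hb i).mul (hpd i)
  · exact Finset.aestronglyMeasurable_fun_sum _ fun i _ => (slab_apply hu i).mul (hpd i)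
  · exact Finset.aestronglyMeasurable_fun_sum _ fun i _ =>
      Finset.aestronglyMeasurable_fun_sum _ fun j _ =>
        ((slab_apply hF (i, j)).mul (slab_apply hu j)).mul (hpd i)
  · exact Finset.aestronglyMeasurable_fun_sum _ fun i _ =>
      Finset.aestronglyMeasurable_fun_sum _ fun j _ =>
        (slab_apply hF (i, j)).mul (slab_apply hD (i, j))

lemma slab_integrable_sq_mul {V : Type*} [NormedAddCommGroup V] [NormedSpace ℝ V] {f : ℝ → E3 → V}
    (hf : AEStronglyMeasurable (fun z : ℝ × E3 => f z.1 z.2) (slab T))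
    (hf2 : IsSquareIntegrable T (fun t => wn (γ / 2) 2 (f t))) (n : ℕ) :
    Integrable (fun z : ℝ × E3 => ‖f z.1 z.2‖ ^ 2 * cutWt γ n z.2) (slab T) := by
  obtain ⟨A, hA⟩ := exists_isSymbol_cutWt γ
  refine slab_integrable_of_le ((hf.norm.pow 2).mul
    (slab_aestronglyMeasurable_comp_snd (isTest_cutWt γ n).1.continuous))
    (H := fun t => ENNReal.ofReal A * (wn (γ / 2) 2 (f t) * wn (γ / 2) 2 (f t))) ?_ ?_
  · filter_upwards [ae_aestronglyMeasurable_slice hf] with t ht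
    exact lintegral_sq_term_le (hA n) ht
  · rw [lintegral_const_mul' _ _ ENNReal.ofReal_ne_top]
    exact ENNReal.mul_lt_top ENNReal.ofReal_lt_top (hf2.mul hf2)

lemma IsADSolution.slab_integrable_energyFlux (h : IsADSolution γ T u₀ F b u Du p) (hγ : 0 < γ)
    (hγ2 : γ ≤ 2) (n : ℕ) : Integrable (fun z : ℝ × E3 =>
      energyFlux (cutWt γ n) (u z.1) (b z.1) (Du z.1) (F z.1) (p z.1) z.2) (slab T) := by
  obtain ⟨P, Q, hs, hp, hpm, hP, hQ⟩ := h.exists_isSlice hγ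
  obtain ⟨C, hC⟩ := exists_energyFlux_le hγ hγ2
  obtain ⟨c, hc⟩ := h.exists_bound hγ
  have hN := h.isSquareIntegrable_u hγ
  have hG := h.isSquareIntegrable_Du hγ
  have hH := h.isSquareIntegrable_b hγ
  have hK := h.isSquareIntegrable_F hγ
  have hM := h.isSquareIntegrable_six hγ
  refine slab_integrable_of_le (slab_energyFlux (isTest_cutWt γ n) h.u_mem.1 h.b_mem.1 h.Du_mem.1
    h.F_mem.1 hpm) (H := fun t => C * (wn (γ / 2) 2 (u t) * wn (γ / 2) 2 (u t) +
      wn (γ / 2) 3 (b t) * wn (γ / 2) 6 (u t) * wn (γ / 2) 2 (u t) +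
      wn γ (6 / 5) (fun x => ∑ i, ∑ j, P i j t x) * wn (γ / 2) 6 (u t) +
      wn (γ / 2) 2 (fun x => ∑ i, ∑ j, Q i j t x) * wn (γ / 2) 2 (u t) +
      wn (γ / 2) 2 (F t) * wn (γ / 2) 2 (u t) + wn (γ / 2) 2 (F t) * wn (γ / 2) 2 (Du t))) ?_ ?_
  · filter_upwards [hs, hp] with t h1 h2
    exact (hC n _ _ _ _ _ _ _ h1 h2).1
  rw [lintegral_const_mul' _ _ ENNReal.coe_ne_top]
  refine ENNReal.mul_lt_top ENNReal.coe_lt_top ?_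
  have m1 := hN.aemeasurable.mul hN.aemeasurable
  have m2 := (hH.aemeasurable.mul hM.aemeasurable).mul hN.aemeasurable
  have m3 := hP.aemeasurable.mul hM.aemeasurable
  have m4 := hQ.aemeasurable.mul hN.aemeasurable
  have m5 := hK.aemeasurable.mul hN.aemeasurable
  -- Of the three factors, two are square integrable in time and the third is bounded, by the L^∞ in
  -- time hypothesis on u.
  have b2 : ∫⁻ t in Ioo 0 T, wn (γ / 2) 3 (b t) * wn (γ / 2) 6 (u t) * wn (γ / 2) 2 (u t) < ⊤ := by
    refine (lintegral_mono_ae (g := fun t => wn (γ / 2) 3 (b t) * wn (γ / 2) 6 (u t) * c)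
      ?_).trans_lt ?_
    · filter_upwards [hc] with t ht
      exact mul_le_mul_right ht _
    · rw [lintegral_mul_const' _ _ ENNReal.coe_ne_top]
      exact ENNReal.mul_lt_top (hH.mul hM) ENNReal.coe_lt_top
  have key {f₁ f₂ : ℝ → ℝ≥0∞} (hm : AEMeasurable f₁ (volume.restrict (Ioo 0 T)))
      (h1 : ∫⁻ t in Ioo 0 T, f₁ t < ⊤) (h2 : ∫⁻ t in Ioo 0 T, f₂ t < ⊤) :
      ∫⁻ t in Ioo 0 T, (f₁ t + f₂ t) < ⊤ := by
    rw [lintegral_add_left' hm]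
    exact ENNReal.add_lt_top.2 ⟨h1, h2⟩
  exact key ((((m1.add m2).add m3).add m4).add m5) (key (((m1.add m2).add m3).add m4)
    (key ((m1.add m2).add m3) (key (m1.add m2) (key m1 (hN.mul hN) b2) (hP.mul hM)) (hQ.mul hN))
    (hK.mul hN)) (hK.mul hG)

/-- The local energy inequality, integrated in time between almost all times. -/
lemma IsADSolution.localized_energy (h : IsADSolution γ T u₀ F b u Du p) (hγ : 0 < γ)
    (hγ2 : γ ≤ 2) (n : ℕ) :
    ∀ᵐ s ∂(volume.restrict (Ioo 0 T)), ∀ᵐ t ∂(volume.restrict (Ioo 0 T)), s < t →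
      (∫ x, ‖u t x‖ ^ 2 * cutWt γ n x) + 2 * (∫ r in Ioc s t, ∫ x, ‖Du r x‖ ^ 2 * cutWt γ n x) ≤
      (∫ x, ‖u s x‖ ^ 2 * cutWt γ n x) + 2 * ∫ r in Ioc s t, ∫ x,
        energyFlux (cutWt γ n) (u r) (b r) (Du r) (F r) (p r) x := by
  set ψ := cutWt γ n with hψdef
  have hψ : IsTest ψ := isTest_cutWt γ n
  obtain ⟨μ, -, hμ⟩ := h.energy
  have I1 := slab_integrable_sq_mul (γ := γ) h.u_mem.1 (h.isSquareIntegrable_u hγ) n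
  have I2 := h.slab_integrable_energyFlux hγ hγ2 n
  have I3 := slab_integrable_sq_mul (γ := γ) h.Du_mem.1 (h.isSquareIntegrable_Du hγ) n
  have J1 : IntegrableOn (fun t => ∫ x, ‖u t x‖ ^ 2 * ψ x) (Ioo 0 T) := I1.integral_prod_left
  have J2 : IntegrableOn (fun t => ∫ x, energyFlux ψ (u t) (b t) (Du t) (F t) (p t) x) (Ioo 0 T) :=
    I2.integral_prod_left
  have J3 : IntegrableOn (fun t => ∫ x, ‖Du t x‖ ^ 2 * ψ x) (Ioo 0 T) := I3.integral_prod_left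
  have J : IntegrableOn (fun t => 2 * (∫ x, energyFlux ψ (u t) (b t) (Du t) (F t) (p t) x) -
      2 * ∫ x, ‖Du t x‖ ^ 2 * ψ x) (Ioo 0 T) := (J2.const_mul 2).sub (J3.const_mul 2)
  have key := exists_forall_le_add_integral J1 J fun η hη hηc hηT hη0 => by
    have hηd : Continuous (deriv η) := hη.continuous_deriv (by simp)
    have e := hμ _ (isSlabTest_mul hη hηc hηT hψ)
    -- The sign of the measure turns the balance into an inequality.
    have hμ0 : 0 ≤ ∫ z : ℝ × E3, η z.1 * ψ z.2 ∂μ :=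
      integral_nonneg fun z => mul_nonneg (hη0 z.1) (cutWt_nonneg γ n z.2)
    simp_rw [dt_mul hη hψ.1, dx_mul hη hψ.1, lapl_mul hη hψ.1] at e
    have e1 : ∫ z, ‖u z.1 z.2‖ ^ 2 / 2 * (deriv η z.1 * ψ z.2) ∂(slab T) =
        2⁻¹ * ∫ t in Ioo 0 T, deriv η t * ∫ x, ‖u t x‖ ^ 2 * ψ x := by
      rw [← integral_slab_mul I1 hηd hηc.deriv, ← integral_const_mul]
      refine integral_congr_ae (Eventually.of_forall fun z => ?_)
      ring
    -- For a product test function every spatial term carries the factor η(t), so Fubini leaves η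
    -- paired with functions of time alone.
    have e2 : ∫ z, (‖u z.1 z.2‖ ^ 2 / 2 * (η z.1 * ∑ i, pd i (pd i ψ) z.2)
        - ‖Du z.1 z.2‖ ^ 2 * (η z.1 * ψ z.2)
        + ‖u z.1 z.2‖ ^ 2 / 2 * (∑ i, b z.1 z.2 i * (η z.1 * pd i ψ z.2))
        + p z.1 z.2 * (∑ i, u z.1 z.2 i * (η z.1 * pd i ψ z.2))
        - (∑ i, ∑ j, F z.1 z.2 (i, j) * u z.1 z.2 j * (η z.1 * pd i ψ z.2))
        - (∑ i, ∑ j, F z.1 z.2 (i, j) * Du z.1 z.2 (i, j)) * (η z.1 * ψ z.2)) ∂(slab T) =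
        (∫ t in Ioo 0 T, η t * ∫ x, energyFlux ψ (u t) (b t) (Du t) (F t) (p t) x) -
        ∫ t in Ioo 0 T, η t * ∫ x, ‖Du t x‖ ^ 2 * ψ x := by
      rw [← integral_slab_mul I2 hη.continuous hηc, ← integral_slab_mul I3 hη.continuous hηc,
        ← integral_sub (integrable_slab_mul I2 hη.continuous hηc)
          (integrable_slab_mul I3 hη.continuous hηc)]
      refine integral_congr_ae (Eventually.of_forall fun z => ?_)
      simp only [energyFlux, Fin.sum_univ_three]
      ring
    rw [e1, e2] at e
    have e3 : ∫ t in Ioo 0 T, η t * (2 * (∫ x, energyFlux ψ (u t) (b t) (Du t) (F t) (p t) x) -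
        2 * ∫ x, ‖Du t x‖ ^ 2 * ψ x) =
        2 * ((∫ t in Ioo 0 T, η t * ∫ x, energyFlux ψ (u t) (b t) (Du t) (F t) (p t) x) -
        ∫ t in Ioo 0 T, η t * ∫ x, ‖Du t x‖ ^ 2 * ψ x) := by
      obtain ⟨C, hC⟩ := hηc.exists_bound_of_continuous hη.continuous
      have i2 : IntegrableOn (fun t => η t *
          ∫ x, energyFlux ψ (u t) (b t) (Du t) (F t) (p t) x) (Ioo 0 T) :=
        J2.bdd_mul hη.continuous.aestronglyMeasurable (Eventually.of_forall hC)
      have i3 : IntegrableOn (fun t => η t * ∫ x, ‖Du t x‖ ^ 2 * ψ x) (Ioo 0 T) :=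
        J3.bdd_mul hη.continuous.aestronglyMeasurable (Eventually.of_forall hC)
      rw [← integral_sub i2 i3, ← integral_const_mul]
      refine integral_congr_ae (Eventually.of_forall fun t => ?_)
      beta_reduce
      ring
    rw [e3]
    linarith
  filter_upwards [key, ae_restrict_mem measurableSet_Ioo] with s hs hsT
  filter_upwards [hs, ae_restrict_mem measurableSet_Ioo] with t ht htT hst
  have hsub : Ioc s t ⊆ Ioo 0 T := fun r hr => ⟨hsT.1.trans hr.1, hr.2.trans_lt htT.2⟩
  have h1 := ht hst
  rw [integral_sub ((J2.mono_set hsub).const_mul 2) ((J3.mono_set hsub).const_mul 2),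
    integral_const_mul, integral_const_mul] at h1
  linarith

end Solution

/-! ### Removing the cutoff: the global energy inequality. -/

section

variable {V : Type*} [NormedAddCommGroup V] [NormedSpace ℝ V] {γ : ℝ}

lemma lintegral_sq_mul_wt (γ : ℝ) (f : E3 → V) :
    ∫⁻ x, ENNReal.ofReal (‖f x‖ ^ 2 * wt γ x) = wn (γ / 2) 2 f ^ 2 := by
  have h := eLpNorm_nnreal_pow_eq_lintegral (f := fun x => wt (γ / 2) x • f x) (μ := volume)
    (p := 2) two_ne_zero
  rw [wn]
  simp only [ENNReal.coe_ofNat, NNReal.coe_ofNat, ENNReal.rpow_ofNat] at h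
  rw [h]
  refine lintegral_congr fun x => ?_
  rw [← ofReal_norm, norm_wt_smul, ← ENNReal.ofReal_pow (by have := wt_pos (γ / 2) x; positivity),
    mul_pow, sq (wt _ _), ← wt_add, add_halves, mul_comm]

lemma lintegral_sq_mul_cutWt_le (n : ℕ) (f : E3 → V) :
    ∫⁻ x, ENNReal.ofReal (‖f x‖ ^ 2 * cutWt γ n x) ≤ wn (γ / 2) 2 f ^ 2 := by
  rw [← lintegral_sq_mul_wt]
  refine lintegral_mono fun x => ENNReal.ofReal_le_ofReal ?_
  exact mul_le_mul_of_nonneg_left (cutWt_le γ n x) (by positivity)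

lemma wn_sq_le_liminf {f : E3 → V} (hf : AEStronglyMeasurable f volume) :
    wn (γ / 2) 2 f ^ 2 ≤
      liminf (fun n => ∫⁻ x, ENNReal.ofReal (‖f x‖ ^ 2 * cutWt γ n x)) atTop := by
  rw [← lintegral_sq_mul_wt]
  refine le_trans (le_of_eq (lintegral_congr fun x => ?_)) (lintegral_liminf_le' fun n =>
    ((hf.norm.pow 2).mul
      (isTest_cutWt γ n).1.continuous.aestronglyMeasurable).aemeasurable.ennreal_ofReal)
  exact ((ENNReal.continuous_ofReal.tendsto _).comp
    ((tendsto_cutWt γ x).const_mul (‖f x‖ ^ 2))).liminf_eq.symm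

end

/-- The quantity controlling the growth of the energy. -/
def energyRate (γ : ℝ) (F : ℝ → E3 → Tensor3) (b u : ℝ → E3 → E3) (Du : ℝ → E3 → Tensor3)
    (t : ℝ) : ℝ≥0∞ :=
  wn (γ / 2) 2 (u t) * wn (γ / 2) 2 (u t) +
    wn (γ / 2) 3 (b t) * wn (γ / 2) 6 (u t) * wn (γ / 2) 2 (u t) +
    wn (γ / 2) 2 (F t) * wn (γ / 2) 2 (u t) + wn (γ / 2) 2 (F t) * wn (γ / 2) 2 (Du t)

/-- The right-hand side is bounded uniformly in the cutoff, and the left-hand side passes to the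
limit by Fatou. The time integral on the right starts from 0 instead of s, so that it does not move
when s tends to 0. -/
lemma exists_energy_step {γ : ℝ} (hγ : 0 < γ) (hγ2 : γ ≤ 2) : ∃ C : ℝ≥0, ∀ T u₀ F b u Du p,
    IsADSolution γ T u₀ F b u Du p →
    ∀ᵐ s ∂(volume.restrict (Ioo 0 T)), ∀ᵐ t ∂(volume.restrict (Ioo 0 T)), s < t →
      wn (γ / 2) 2 (u t) ^ 2 + ∫⁻ r in Ioc s t, wn (γ / 2) 2 (Du r) ^ 2 ≤
        wn (γ / 2) 2 (u s) ^ 2 + C * ∫⁻ r in Ioo 0 t, energyRate γ F b u Du r := by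
  obtain ⟨C, hC⟩ := exists_energyFlux_le hγ hγ2
  refine ⟨2 * C, fun T u₀ F b u Du p h => ?_⟩
  obtain ⟨P, Q, hs, hp, -, -, -⟩ := h.exists_isSlice hγ
  have I1 := slab_integrable_sq_mul (γ := γ) h.u_mem.1 (h.isSquareIntegrable_u hγ)
  have I3 := slab_integrable_sq_mul (γ := γ) h.Du_mem.1 (h.isSquareIntegrable_Du hγ)
  have hflux : ∀ᵐ r ∂(volume.restrict (Ioo 0 T)), ∀ n,
      ‖∫ x, energyFlux (cutWt γ n) (u r) (b r) (Du r) (F r) (p r) x‖ₑ ≤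
        C * energyRate γ F b u Du r := by
    filter_upwards [hs, hp] with r h1 h2 n
    exact (hC n _ _ _ _ _ _ _ h1 h2).2
  have i1 : ∀ᵐ t ∂(volume.restrict (Ioo 0 T)), ∀ n,
      Integrable (fun x => ‖u t x‖ ^ 2 * cutWt γ n x) volume :=
    ae_all_iff.2 fun n => (I1 n).prod_right_ae
  have i3 : ∀ᵐ t ∂(volume.restrict (Ioo 0 T)), ∀ n,
      Integrable (fun x => ‖Du t x‖ ^ 2 * cutWt γ n x) volume :=
    ae_all_iff.2 fun n => (I3 n).prod_right_ae
  have hnn {W : Type} [NormedAddCommGroup W] (n : ℕ) (f : E3 → W) (x : E3) :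
      0 ≤ ‖f x‖ ^ 2 * cutWt γ n x := mul_nonneg (by positivity) (cutWt_nonneg γ n x)
  have key : ∀ᵐ s ∂(volume.restrict (Ioo 0 T)), ∀ n, ∀ᵐ t ∂(volume.restrict (Ioo 0 T)), s < t →
      (∫ x, ‖u t x‖ ^ 2 * cutWt γ n x) + 2 * (∫ r in Ioc s t, ∫ x, ‖Du r x‖ ^ 2 * cutWt γ n x) ≤
      (∫ x, ‖u s x‖ ^ 2 * cutWt γ n x) + 2 * ∫ r in Ioc s t, ∫ x,
        energyFlux (cutWt γ n) (u r) (b r) (Du r) (F r) (p r) x :=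
    ae_all_iff.2 fun n => h.localized_energy hγ hγ2 n
  filter_upwards [key, ae_restrict_mem measurableSet_Ioo, i1] with s hs1 hsT i1s
  filter_upwards [ae_all_iff.2 hs1, ae_restrict_mem measurableSet_Ioo, i1,
    ae_aestronglyMeasurable_slice h.u_mem.1] with t ht htT i1t hut hst
  have hsub : Ioc s t ⊆ Ioo 0 T := fun r hr => ⟨hsT.1.trans hr.1, hr.2.trans_lt htT.2⟩
  have hres : volume.restrict (Ioc s t) ≤ volume.restrict (Ioo 0 T) :=
    Measure.restrict_mono hsub le_rfl
  have hmeas (n : ℕ) : AEMeasurable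
      (fun r => ∫⁻ x, ENNReal.ofReal (‖Du r x‖ ^ 2 * cutWt γ n x)) (volume.restrict (Ioc s t)) :=
    ((I3 n).aemeasurable.ennreal_ofReal.lintegral_prod_right').mono_measure hres
  have hn (n : ℕ) : (∫⁻ x, ENNReal.ofReal (‖u t x‖ ^ 2 * cutWt γ n x)) +
      ∫⁻ r in Ioc s t, ∫⁻ x, ENNReal.ofReal (‖Du r x‖ ^ 2 * cutWt γ n x) ≤
      wn (γ / 2) 2 (u s) ^ 2 + ↑(2 * C) * ∫⁻ r in Ioo 0 t, energyRate γ F b u Du r := by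
    have J3 : IntegrableOn (fun t => ∫ x, ‖Du t x‖ ^ 2 * cutWt γ n x) (Ioc s t) :=
      (I3 n).integral_prod_left.mono_measure hres
    have e1 : ∫⁻ x, ENNReal.ofReal (‖u t x‖ ^ 2 * cutWt γ n x) =
        ENNReal.ofReal (∫ x, ‖u t x‖ ^ 2 * cutWt γ n x) :=
      (ofReal_integral_eq_lintegral_ofReal (i1t n) (Eventually.of_forall (hnn n _))).symm
    have e2 : ∫⁻ r in Ioc s t, ∫⁻ x, ENNReal.ofReal (‖Du r x‖ ^ 2 * cutWt γ n x) =
        ENNReal.ofReal (∫ r in Ioc s t, ∫ x, ‖Du r x‖ ^ 2 * cutWt γ n x) := by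
      rw [ofReal_integral_eq_lintegral_ofReal J3
        (Eventually.of_forall fun r => integral_nonneg (hnn n _))]
      refine lintegral_congr_ae ?_
      filter_upwards [ae_mono hres i3] with r hr
      exact (ofReal_integral_eq_lintegral_ofReal (hr n) (Eventually.of_forall (hnn n _))).symm
    have e3 : ENNReal.ofReal (∫ x, ‖u s x‖ ^ 2 * cutWt γ n x) ≤ wn (γ / 2) 2 (u s) ^ 2 := by
      rw [ofReal_integral_eq_lintegral_ofReal (i1s n) (Eventually.of_forall (hnn n _))]
      exact lintegral_sq_mul_cutWt_le n _
    have e4 : ENNReal.ofReal (∫ r in Ioc s t, ∫ x,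
        energyFlux (cutWt γ n) (u r) (b r) (Du r) (F r) (p r) x) ≤
        C * ∫⁻ r in Ioo 0 t, energyRate γ F b u Du r := by
      refine (ENNReal.ofReal_le_ofReal (le_abs_self _)).trans ?_
      rw [← Real.norm_eq_abs, ofReal_norm]
      refine (enorm_integral_le_lintegral_enorm _).trans ?_
      rw [← lintegral_const_mul' _ _ ENNReal.coe_ne_top, setLIntegral_congr Ioo_ae_eq_Ioc]
      refine (lintegral_mono_ae (ae_mono hres (hflux.mono fun r hr => hr n))).trans ?_
      exact lintegral_mono_set (Ioc_subset_Ioc_left hsT.1.le)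
    have hD0 : 0 ≤ ∫ r in Ioc s t, ∫ x, ‖Du r x‖ ^ 2 * cutWt γ n x :=
      integral_nonneg fun r => integral_nonneg (hnn n _)
    rw [e1, e2, ← ENNReal.ofReal_add (integral_nonneg (hnn n _)) hD0]
    calc _ ≤ ENNReal.ofReal ((∫ x, ‖u s x‖ ^ 2 * cutWt γ n x) + 2 * ∫ r in Ioc s t, ∫ x,
          energyFlux (cutWt γ n) (u r) (b r) (Du r) (F r) (p r) x) := by
          -- One of the two copies of the dissipation is discarded, as it is non-negative.
          refine ENNReal.ofReal_le_ofReal ?_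
          have := ht n hst
          linarith
      _ ≤ _ := by
          refine ENNReal.ofReal_add_le.trans (add_le_add e3 ?_)
          rw [ENNReal.ofReal_mul zero_le_two, ENNReal.coe_mul, mul_assoc]
          refine mul_le_mul' (by simp) e4
  refine le_trans (add_le_add (wn_sq_le_liminf hut) ?_) (liminf_add_liminf_le (Eventually.of_forall hn))
  refine le_trans (lintegral_mono_ae ?_) (lintegral_liminf_le' hmeas)
  filter_upwards [ae_mono hres (ae_aestronglyMeasurable_slice h.Du_mem.1)] with r hr
  exact wn_sq_le_liminf hr

lemma exists_mem_Ioo_of_ae {T a b : ℝ} (ha : 0 ≤ a) (hab : a < b) (hb : b ≤ T) {p : ℝ → Prop}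
    (h : ∀ᵐ s ∂(volume.restrict (Ioo 0 T)), p s) : ∃ s ∈ Ioo a b, p s := by
  have h1 : ∀ᵐ s ∂(volume.restrict (Ioo a b)), p s :=
    ae_mono (Measure.restrict_mono (Ioo_subset_Ioo ha hb) le_rfl) h
  have : NeZero (volume.restrict (Ioo a b)) := ⟨by
    rw [Ne, Measure.restrict_eq_zero, Real.volume_Ioo, ENNReal.ofReal_eq_zero, not_le]
    linarith⟩
  exact ((ae_restrict_mem measurableSet_Ioo).and h1).exists

lemma lintegral_Ioo_le_of_forall_Ioc {f : ℝ → ℝ≥0∞} {t : ℝ} {a R : ℝ≥0∞}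
    (h : ∀ s ∈ Ioo 0 t, a + ∫⁻ r in Ioc s t, f r ≤ R) (ht : 0 < t) :
    a + ∫⁻ r in Ioo 0 t, f r ≤ R := by
  -- The denominator m + 2 keeps the left endpoint strictly between 0 and t already for m = 0.
  have hU : Ioo 0 t ⊆ ⋃ m : ℕ, Ioc (t / (m + 2)) t := fun r hr => by
    obtain ⟨m, hm⟩ := exists_nat_gt (t / r)
    refine mem_iUnion.2 ⟨m, ?_, hr.2.le⟩
    rw [div_lt_iff₀ (by positivity)]
    rw [div_lt_iff₀ hr.1] at hm
    nlinarith [hr.1]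
  have hdir : Directed (· ⊆ ·) fun m : ℕ => Ioc (t / (m + 2)) t := by
    refine Monotone.directed_le fun m k hmk => Ioc_subset_Ioc_left ?_
    gcongr
  refine (add_le_add le_rfl (lintegral_mono_set hU)).trans ?_
  rw [setLIntegral_iUnion_of_directed _ hdir, ENNReal.add_iSup]
  refine iSup_le fun m => h _ ⟨by positivity, ?_⟩
  exact div_lt_self ht (by linarith [show (0 : ℝ) ≤ m by positivity])

/-- The global energy inequality. -/
lemma exists_energy_inequality {γ : ℝ} (hγ : 0 < γ) (hγ2 : γ ≤ 2) : ∃ C : ℝ≥0, ∀ T u₀ F b u Du p,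
    0 < T → IsADSolution γ T u₀ F b u Du p →
    ∀ᵐ t ∂(volume.restrict (Ioo 0 T)),
      wn (γ / 2) 2 (u t) ^ 2 + ∫⁻ r in Ioo 0 t, wn (γ / 2) 2 (Du r) ^ 2 ≤
        wn (γ / 2) 2 u₀ ^ 2 + C * ∫⁻ r in Ioo 0 t, energyRate γ F b u Du r := by
  obtain ⟨C, hC⟩ := exists_energy_step hγ hγ2
  refine ⟨C, fun T u₀ F b u Du p hT h => ?_⟩
  -- Admissible starting times have full measure, so a sequence of them tends to 0. Strong
  -- continuity at time 0 then replaces u(s_k) by u₀ in the limit.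
  have hs (k : ℕ) := exists_mem_Ioo_of_ae le_rfl
    (lt_min hT (Nat.one_div_pos_of_nat (α := ℝ) (n := k))) (min_le_left _ _) (hC T u₀ F b u Du p h)
  choose s hsm hs using hs
  have hs0 : Tendsto s atTop (𝓝[>] 0) := by
    refine tendsto_nhdsWithin_iff.2 ⟨?_, Eventually.of_forall fun k => (hsm k).1⟩
    exact squeeze_zero (fun k => (hsm k).1.le)
      (fun k => (hsm k).2.le.trans (min_le_right _ _)) tendsto_one_div_add_atTop_nhds_zero_nat
  have hγ' : 0 ≤ γ / 2 := by positivity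
  have hu₀m : MemLp (fun x => wt (γ / 2) x • u₀ x) 2 volume :=
    MemLp.wt_smul hγ' two_ne_zero ENNReal.ofNat_ne_top (by rw [half_mul_two]; exact h.u₀_mem)
  have hum (k : ℕ) : MemLp (fun x => wt (γ / 2) x • u (s k) x) 2 volume :=
    MemLp.wt_smul hγ' two_ne_zero ENNReal.ofNat_ne_top (by
      rw [half_mul_two]
      exact h.slice_mem _ ⟨(hsm k).1.le, (hsm k).2.trans_le (min_le_left _ _)⟩)
  have hlim0 : Tendsto (fun k => wn (γ / 2) 2 (fun x => u (s k) x - u₀ x)) atTop (𝓝 0) := by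
    have h1 := ENNReal.Tendsto.const_mul (a := ENNReal.ofReal (√2 ^ (γ / 2)))
      (h.strong_cont.comp hs0) (Or.inr ENNReal.ofReal_ne_top)
    rw [mul_zero] at h1
    refine tendsto_of_tendsto_of_tendsto_of_le_of_le tendsto_const_nhds h1 (fun _ => zero_le)
      fun k => ?_
    have h2 := eLpNorm_wt_smul_le hγ' two_ne_zero ENNReal.ofNat_ne_top
      (fun x => u (s k) x - u₀ x)
    rw [half_mul_two] at h2
    exact h2
  have hle (k : ℕ) : wn (γ / 2) 2 (u (s k)) ≤
      wn (γ / 2) 2 u₀ + wn (γ / 2) 2 (fun x => u (s k) x - u₀ x) := by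
    refine le_trans (le_of_eq ?_) (eLpNorm_add_le hu₀m.1 ((hum k).1.sub hu₀m.1 |>.congr
      (Eventually.of_forall fun x => by simp only [Pi.sub_apply, smul_sub])) one_le_two)
    rw [wn]
    congr 1; ext1 x
    simp [smul_sub]
  filter_upwards [ae_all_iff.2 hs, ae_restrict_mem measurableSet_Ioo] with t ht htT
  refine lintegral_Ioo_le_of_forall_Ioc (fun σ hσ => ?_) htT.1
  have hlim : Tendsto (fun k => (wn (γ / 2) 2 u₀ + wn (γ / 2) 2 (fun x => u (s k) x - u₀ x)) ^ 2 +
      C * ∫⁻ r in Ioo 0 t, energyRate γ F b u Du r) atTop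
      (𝓝 (wn (γ / 2) 2 u₀ ^ 2 + C * ∫⁻ r in Ioo 0 t, energyRate γ F b u Du r)) := by
    have := ((ENNReal.continuous_pow 2).tendsto _).comp (hlim0.const_add (wn (γ / 2) 2 u₀))
    rw [add_zero] at this
    exact this.add_const _
  refine ge_of_tendsto hlim ?_
  -- For fixed σ > 0 the starting times are eventually below σ, so the dissipation on (σ, t] is
  -- controlled. Letting σ tend to 0 recovers all of (0, t).
  filter_upwards [(tendsto_nhdsWithin_iff.1 hs0).1.eventually (gt_mem_nhds hσ.1)] with k hk
  refine le_trans (add_le_add le_rfl (lintegral_mono_set (Ioc_subset_Ioc_left hk.le)))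
    ((ht k (hk.trans hσ.2)).trans ?_)
  gcongr
  exact hle k

/-! ### Absorption by the dissipation and the continuity argument. -/

/-- Interpolation: Hölder with 1/2 + 1/6 = 2/3 applied to the square, whose L^(3/2) norm is the
square of the L³ norm. -/
lemma wn_three_sq_le {a : ℝ} {U : E3 → E3} (hU : AEStronglyMeasurable U volume) :
    wn a 3 U ^ 2 ≤ wn a 2 U * wn a 6 U := by
  have : ENNReal.HolderTriple 2 6 (3 / 2) := ⟨by
    have h32 : (3 / 2 : ℝ≥0∞) ≠ 0 := by simp
    rw [← ENNReal.toReal_eq_toReal_iff' (by simp) (by simp), ENNReal.toReal_add (by simp) (by simp)]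
    norm_num⟩
  have hm : AEStronglyMeasurable (fun x => ‖wt a x • U x‖) volume :=
    ((continuous_wt a).aestronglyMeasurable.smul hU).norm
  have h := eLpNorm_smul_le_mul_eLpNorm (p := 2) (q := 6) (r := 3 / 2) hm hm
  rw [eLpNorm_norm, eLpNorm_norm] at h
  refine le_of_eq_of_le ?_ h
  have h2 := eLpNorm_norm_rpow (μ := volume) (p := 3 / 2) (fun x => wt a x • U x) (q := 2) two_pos
  have e : (3 / 2 : ℝ≥0∞) * ENNReal.ofReal 2 = 3 := by
    rw [ENNReal.ofReal_ofNat, ENNReal.div_mul_cancel two_ne_zero ENNReal.ofNat_ne_top]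
  rw [e, ENNReal.rpow_ofNat] at h2
  rw [wn, ← h2]
  congr 1; ext x
  simp [sq]

/-- Absorption of the energy rate by the dissipation. -/
lemma exists_absorb (C₁ C₂ c : ℝ≥0) : ∃ C₃ : ℝ≥0, ∀ N M G K H a : ℝ≥0,
    H ^ 2 ≤ (c * a) ^ 2 * (N * M) → M ≤ C₂ * (N + G) →
    C₁ * (N * N + H * M * N + K * N + K * G) ≤
      2⁻¹ * G ^ 2 + C₃ * (N ^ 2 + a ^ 4 * N ^ 6 + K ^ 2) := by
  -- Chosen so that the M² produced by Young, converted by Sobolev, costs at most G²/4. The term K G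
  -- costs another G²/4, for a total of half the dissipation.
  set δ : ℝ := 1 / (16 * (C₁ + 1) * (C₂ + 1) ^ 2) with hδ
  have hδ0 : 0 < δ := by positivity
  have hδ1 : C₁ * (4 * δ * C₂ ^ 2) ≤ (1 : ℝ) / 4 := by
    rw [hδ]
    have h1 : (C₁ : ℝ) ≤ C₁ + 1 := by linarith
    have h2 : (C₂ : ℝ) ^ 2 ≤ (C₂ + 1) ^ 2 := by gcongr; linarith
    calc _ = (C₁ * (C₂ : ℝ) ^ 2) * (4 / (16 * (C₁ + 1) * (C₂ + 1) ^ 2)) := by ring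
      _ ≤ ((C₁ + 1) * (C₂ + 1) ^ 2) * (4 / (16 * (C₁ + 1) * (C₂ + 1) ^ 2)) := by gcongr
      _ = 1 / 4 := by field_simp; norm_num
  refine ⟨(C₁ * c ^ 4 / (64 * δ ^ 3) + 2 * C₁ + C₁ ^ 2 + 1 : ℝ).toNNReal,
    fun N M G K H a hH hM => ?_⟩
  have hC3 : (0 : ℝ) ≤ C₁ * c ^ 4 / (64 * δ ^ 3) + 2 * C₁ + C₁ ^ 2 + 1 := by positivity
  rw [← NNReal.coe_le_coe] at hH hM ⊢
  push_cast [Real.coe_toNNReal _ hC3] at hH hM ⊢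
  have hN := N.coe_nonneg
  have hM0 := M.coe_nonneg
  have hG := G.coe_nonneg
  have hK := K.coe_nonneg
  have hH0 := H.coe_nonneg
  have hC1 := C₁.coe_nonneg
  -- Young twice. First H M N ≤ δ M² + (H N)²/(4δ); then (H N)² ≤ (c a)² N³ M by interpolation, and
  -- M is separated from N³ at the cost of another δ M². This produces N⁶ and the factor a⁴, hence
  -- C₀⁴.
  have h1 : (H : ℝ) * M * N ≤ 2 * δ * M ^ 2 + c ^ 4 * a ^ 4 * N ^ 6 / (64 * δ ^ 3) := by
    have y1 : (H : ℝ) * M * N ≤ δ * M ^ 2 + (H * N) ^ 2 / (4 * δ) := by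
      rw [← sub_nonneg]
      have : δ * (M : ℝ) ^ 2 + (H * N) ^ 2 / (4 * δ) - H * M * N =
        δ * (M - H * N / (2 * δ)) ^ 2 := by field_simp; ring
      rw [this]; positivity
    have y2 : ((H : ℝ) * N) ^ 2 ≤ 4 * δ * (δ * M ^ 2 + c ^ 4 * a ^ 4 * N ^ 6 / (64 * δ ^ 3)) := by
      have z : ((H : ℝ) * N) ^ 2 ≤ (c * a) ^ 2 * (N * M) * N ^ 2 := by
        rw [mul_pow]; gcongr
      refine z.trans ?_
      rw [← sub_nonneg]
      have : 4 * δ * (δ * (M : ℝ) ^ 2 + c ^ 4 * a ^ 4 * N ^ 6 / (64 * δ ^ 3)) -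
        (c * a) ^ 2 * (N * M) * N ^ 2 =
        (2 * δ * M - c ^ 2 * a ^ 2 * N ^ 3 / (4 * δ)) ^ 2 := by field_simp; ring
      rw [this]; positivity
    have y3 : ((H : ℝ) * N) ^ 2 / (4 * δ) ≤
        δ * M ^ 2 + c ^ 4 * a ^ 4 * N ^ 6 / (64 * δ ^ 3) := by
      rw [div_le_iff₀ (by positivity)]; linarith
    linarith
  have h2 : (M : ℝ) ^ 2 ≤ 2 * C₂ ^ 2 * (N ^ 2 + G ^ 2) := by
    refine (pow_le_pow_left₀ hM0 hM 2).trans ?_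
    rw [mul_pow, mul_comm 2, mul_assoc]
    refine mul_le_mul_of_nonneg_left ?_ (by positivity)
    nlinarith [sq_nonneg ((N : ℝ) - G)]
  have h3 : C₁ * (2 * δ * (M : ℝ) ^ 2) ≤ 1 / 4 * (N ^ 2 + G ^ 2) := by
    calc C₁ * (2 * δ * (M : ℝ) ^ 2) ≤ C₁ * (2 * δ * (2 * C₂ ^ 2 * (N ^ 2 + G ^ 2))) := by gcongr
      _ = (C₁ * (4 * δ * C₂ ^ 2)) * (N ^ 2 + G ^ 2) := by ring
      _ ≤ _ := by gcongr
  have h4 : C₁ * ((K : ℝ) * N) ≤ C₁ * (K ^ 2 + N ^ 2) := by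
    gcongr; nlinarith [sq_nonneg ((K : ℝ) - N)]
  have h5 : C₁ * ((K : ℝ) * G) ≤ 1 / 4 * G ^ 2 + C₁ ^ 2 * K ^ 2 := by
    nlinarith [sq_nonneg (1 / 2 * (G : ℝ) - C₁ * K)]
  have h6 : C₁ * ((H : ℝ) * M * N) ≤ C₁ * (2 * δ * M ^ 2) +
      C₁ * c ^ 4 / (64 * δ ^ 3) * (a ^ 4 * N ^ 6) := by
    refine (mul_le_mul_of_nonneg_left h1 hC1).trans (le_of_eq ?_)
    ring
  have n1 : (0 : ℝ) ≤ C₁ * c ^ 4 / (64 * δ ^ 3) := by positivity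
  have n2 : (0 : ℝ) ≤ (N : ℝ) ^ 2 := by positivity
  have n3 : (0 : ℝ) ≤ (K : ℝ) ^ 2 := by positivity
  have n4 : (0 : ℝ) ≤ (a : ℝ) ^ 4 * N ^ 6 := by positivity
  have p1 := mul_nonneg n1 n2
  have p2 := mul_nonneg n1 n3
  have p3 := mul_nonneg hC1 n2
  have p4 := mul_nonneg hC1 n3
  have p5 := mul_nonneg hC1 n4
  have p6 := mul_nonneg (sq_nonneg (C₁ : ℝ)) n2
  have p7 := mul_nonneg (sq_nonneg (C₁ : ℝ)) n4
  nlinarith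

section

variable {γ : ℝ}

/-- The energy inequality with the flux absorbed. -/
lemma exists_energy_gronwall (hγ : 0 < γ) (hγ2 : γ ≤ 2) : ∃ C : ℝ≥0, ∀ T u₀ F b u Du p,
    0 < T → IsADSolution γ T u₀ F b u Du p → ∀ C₀ : ℝ≥0,
    (∀ᵐ t ∂(volume.restrict (Ioo 0 T)), eLpNorm (b t) 3 (wMeasure (3 * γ / 2)) ≤
      C₀ * eLpNorm (u t) 3 (wMeasure (3 * γ / 2))) →
    ∀ᵐ t ∂(volume.restrict (Ioo 0 T)),
      wn (γ / 2) 2 (u t) ^ 2 + 2⁻¹ * ∫⁻ r in Ioo 0 t, wn (γ / 2) 2 (Du r) ^ 2 ≤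
        wn (γ / 2) 2 u₀ ^ 2 + C * ∫⁻ r in Ioo 0 t, (wn (γ / 2) 2 (u r) ^ 2 +
          C₀ ^ 4 * wn (γ / 2) 2 (u r) ^ 6 + wn (γ / 2) 2 (F r) ^ 2) := by
  obtain ⟨C₁, hC₁⟩ := exists_energy_inequality hγ hγ2
  obtain ⟨C₂, hC₂⟩ := exists_wn_six_le hγ
  obtain ⟨C₃, hC₃⟩ := exists_absorb C₁ C₂ (√2 ^ (γ / 2)).toNNReal
  refine ⟨C₃, fun T u₀ F b u Du p hT h C₀ hb => ?_⟩
  obtain ⟨P, Q, hs, -, -, -, -⟩ := h.exists_isSlice hγ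
  have hγ' : 0 ≤ γ / 2 := by positivity
  have hrate : ∀ᵐ t ∂(volume.restrict (Ioo 0 T)), C₁ * energyRate γ F b u Du t ≤
      2⁻¹ * wn (γ / 2) 2 (Du t) ^ 2 + C₃ * (wn (γ / 2) 2 (u t) ^ 2 +
          C₀ ^ 4 * wn (γ / 2) 2 (u t) ^ 6 + wn (γ / 2) 2 (F t) ^ 2) := by
    filter_upwards [hs, hb] with t ht hbt
    have hN : wn (γ / 2) 2 (u t) ≠ ⊤ := ht.U_mem.2.ne
    have hG : wn (γ / 2) 2 (Du t) ≠ ⊤ := ht.D_mem.2.ne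
    have hK : wn (γ / 2) 2 (F t) ≠ ⊤ := ht.F_mem.2.ne
    have hH : wn (γ / 2) 3 (b t) ≠ ⊤ := ht.B_mem.2.ne
    have hM : wn (γ / 2) 6 (u t) ≠ ⊤ := (wn_lt_top_of_sobolev hγ ht).ne
    -- The factor √2^(γ/2) is the price of passing between the given weight and the smooth one; it
    -- becomes the constant c of the absorption lemma.
    have h1 : wn (γ / 2) 3 (b t) ≤ (√2 ^ (γ / 2)).toNNReal * C₀ * wn (γ / 2) 3 (u t) := by
      have e1 := eLpNorm_wt_smul_le hγ' three_ne_zero ENNReal.ofNat_ne_top (b t)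
      have e2 := eLpNorm_wMeasure_le hγ' three_ne_zero ENNReal.ofNat_ne_top (u t)
      rw [half_mul_three] at e1 e2
      rw [mul_assoc]
      exact e1.trans (mul_le_mul' le_rfl (hbt.trans (mul_le_mul' le_rfl e2)))
    have h2 : wn (γ / 2) 3 (b t) ^ 2 ≤ ((√2 ^ (γ / 2)).toNNReal * C₀) ^ 2 *
        (wn (γ / 2) 2 (u t) * wn (γ / 2) 6 (u t)) := by
      refine (pow_le_pow_left' h1 2).trans ?_
      rw [mul_pow]
      exact mul_le_mul' le_rfl (wn_three_sq_le ht.aestronglyMeasurable.1)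
    have h3 := hC₂ _ _ _ _ _ _ ht
    rw [energyRate]
    generalize wn (γ / 2) 2 (u t) = N at *
    generalize wn (γ / 2) 2 (Du t) = G at *
    generalize wn (γ / 2) 2 (F t) = K at *
    generalize wn (γ / 2) 3 (b t) = H at *
    generalize wn (γ / 2) 6 (u t) = M at *
    lift N to ℝ≥0 using hN
    lift G to ℝ≥0 using hG
    lift K to ℝ≥0 using hK
    lift H to ℝ≥0 using hH
    lift M to ℝ≥0 using hM
    have := hC₃ N M G K H C₀ (by exact_mod_cast h2) (by exact_mod_cast h3)
    have e : ((2⁻¹ : ℝ≥0) : ℝ≥0∞) = 2⁻¹ := by simp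
    rw [← e]
    exact_mod_cast this
  filter_upwards [hC₁ T u₀ F b u Du p hT h, ae_restrict_mem measurableSet_Ioo] with t ht htT
  have hres : volume.restrict (Ioo 0 t) ≤ volume.restrict (Ioo 0 T) :=
    Measure.restrict_mono (Ioo_subset_Ioo_right htT.2.le) le_rfl
  have hG := h.isSquareIntegrable_Du hγ
  have hGf : ∫⁻ r in Ioo 0 t, wn (γ / 2) 2 (Du r) ^ 2 ≠ ⊤ :=
    ((lintegral_mono' hres le_rfl).trans_lt hG.lintegral_lt_top).ne
  have h1 : C₁ * ∫⁻ r in Ioo 0 t, energyRate γ F b u Du r ≤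
      2⁻¹ * (∫⁻ r in Ioo 0 t, wn (γ / 2) 2 (Du r) ^ 2) +
      C₃ * ∫⁻ r in Ioo 0 t, (wn (γ / 2) 2 (u r) ^ 2 +
          C₀ ^ 4 * wn (γ / 2) 2 (u r) ^ 6 + wn (γ / 2) 2 (F r) ^ 2) := by
    have h2 : (2⁻¹ : ℝ≥0∞) ≠ ⊤ := by simp
    rw [← lintegral_const_mul' _ _ ENNReal.coe_ne_top, ← lintegral_const_mul' _ _ h2,
      ← lintegral_const_mul' _ _ ENNReal.coe_ne_top,
      ← lintegral_add_left' (((hG.aemeasurable.pow_const 2).const_mul _).mono_measure hres)]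
    exact lintegral_mono_ae (ae_mono hres hrate)
  have h2 : 2⁻¹ * (∫⁻ r in Ioo 0 t, wn (γ / 2) 2 (Du r) ^ 2) ≠ ⊤ :=
    ENNReal.mul_ne_top (by simp) hGf
  have h3 := ht.trans (add_le_add le_rfl h1)
  have h4 (x : ℝ≥0∞) : x = 2⁻¹ * x + 2⁻¹ * x := by
    rw [← add_mul, ENNReal.inv_two_add_inv_two, one_mul]
  -- Half of the dissipation on the left cancels the half on the right. In the extended reals this
  -- requires it to be finite, which is `h2`.
  nth_rewrite 1 [h4 (∫⁻ r in Ioo 0 t, wn (γ / 2) 2 (Du r) ^ 2)] at h3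
  refine (ENNReal.add_le_add_iff_left h2).1 ?_
  calc _ = wn (γ / 2) 2 (u t) ^ 2 + (2⁻¹ * (∫⁻ r in Ioo 0 t, wn (γ / 2) 2 (Du r) ^ 2) +
      2⁻¹ * (∫⁻ r in Ioo 0 t, wn (γ / 2) 2 (Du r) ^ 2)) := by ring
    _ ≤ _ := h3
    _ = _ := by ring

end

/-- A continuity argument for an integral inequality with cubic growth. -/
lemma mul_integral_le_of_small {T₀ L c a : ℝ} {y : ℝ → ℝ} (hT₀ : 0 < T₀) (hc : 0 ≤ c)
    (ha : 0 ≤ a) (hL : 0 ≤ L) (hy : ∀ t, 0 ≤ y t)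
    (hint : IntegrableOn (fun r => y r + a * y r ^ 3) (Icc 0 T₀))
    (h : ∀ᵐ t ∂(volume.restrict (Ioo 0 T₀)), y t ≤ L + c * ∫ r in (0)..t, (y r + a * y r ^ 3))
    (hsmall : c * (T₀ * (2 * L + a * (2 * L) ^ 3)) < L) :
    ∀ t ∈ Icc 0 T₀, c * ∫ r in (0)..t, (y r + a * y r ^ 3) ≤ L := by
  set g : ℝ → ℝ := fun r => y r + a * y r ^ 3
  have hg (r : ℝ) : 0 ≤ g r := add_nonneg (hy r) (mul_nonneg ha (pow_nonneg (hy r) 3))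
  have hcont : ContinuousOn (fun t => c * ∫ r in (0)..t, g r) (Icc 0 T₀) := by
    have := intervalIntegral.continuousOn_primitive_interval (f := g) (μ := volume) (a := 0) (b := T₀)
      (by rwa [uIcc_of_le hT₀.le])
    rw [uIcc_of_le hT₀.le] at this
    exact this.const_mul c
  have hii {t : ℝ} (ht : t ∈ Icc 0 T₀) : IntervalIntegrable g volume 0 t :=
    (intervalIntegrable_iff_integrableOn_Icc_of_le ht.1).2 (hint.mono_set (Icc_subset_Icc_right ht.2))
  have hmono {r t : ℝ} (hr : 0 ≤ r) (hrt : r ≤ t) (ht : t ≤ T₀) :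
      c * ∫ r in (0)..r, g r ≤ c * ∫ r in (0)..t, g r := by
    refine mul_le_mul_of_nonneg_left ?_ hc
    exact intervalIntegral.integral_mono_interval le_rfl hr hrt (Eventually.of_forall hg)
      (hii ⟨hr.trans hrt, ht⟩)
  have hsub : Icc 0 T₀ ⊆ {t | c * ∫ r in (0)..t, g r ≤ L} := by
    -- Induction on the real interval: the set where the bound holds is closed and contains 0, so it
    -- is enough that it extend a little to the right of each of its points.
    refine IsClosed.Icc_subset_of_forall_mem_nhdsWithin ?_ (by simpa using hL) ?_
    · rw [inter_comm]
      exact hcont.preimage_isClosed_of_isClosed isClosed_Icc isClosed_Iic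
    rintro x ⟨hx, hx0, hxT⟩
    have hxI : x ∈ Icc 0 T₀ := ⟨hx0, hxT.le⟩
    have hB : 0 ≤ 2 * L + a * (2 * L) ^ 3 := by positivity
    -- The bound at x holds at all earlier times by monotonicity, so y ≤ 2L almost everywhere before
    -- x. The smallness condition then improves the bound to a strict one, which continuity carries
    -- past x.
    have hlt : c * ∫ r in (0)..x, g r < L := by
      refine lt_of_le_of_lt (mul_le_mul_of_nonneg_left ?_ hc) hsmall
      have h1 : ∫ r in (0)..x, g r ≤ ∫ r in (0)..x, (2 * L + a * (2 * L) ^ 3) := by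
        refine intervalIntegral.integral_mono_ae_restrict hx0 (hii hxI) (by simp) ?_
        rw [restrict_Ioo_eq_restrict_Icc.symm]
        filter_upwards [ae_mono (Measure.restrict_mono (Ioo_subset_Ioo_right hxT.le) le_rfl) h,
          ae_restrict_mem measurableSet_Ioo] with r hr hr0
        have h2 : y r ≤ 2 * L := by
          have h3 := hmono hr0.1.le hr0.2.le hxT.le
          have h4 : c * ∫ r in (0)..x, g r ≤ L := hx
          linarith
        exact add_le_add h2 (mul_le_mul_of_nonneg_left (pow_le_pow_left₀ (hy r) h2 3) ha)
      refine h1.trans ?_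
      rw [intervalIntegral.integral_const, smul_eq_mul, sub_zero]
      exact mul_le_mul_of_nonneg_right hxT.le hB
    have hev := (hcont x hxI).eventually (gt_mem_nhds hlt)
    have hle : 𝓝[>] x ≤ 𝓝[Icc 0 T₀] x :=
      nhdsWithin_le_of_mem (mem_of_superset (Ioc_mem_nhdsGT hxT) fun r hr => ⟨hx0.trans hr.1.le, hr.2⟩)
    exact (hev.filter_mono hle).mono fun r hr => le_of_lt hr
  exact fun t ht => hsub ht

/-- The total size of the data. -/
def dataSize (γ : ℝ) (u₀ : E3 → E3) (F : ℝ → E3 → Tensor3) (C₀ : ℝ≥0) (T₀ : ℝ) : ℝ≥0∞ :=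
  1 + (C₀ : ℝ≥0∞) ^ 4 + eLpNorm u₀ 2 (wMeasure γ) ^ 2 +
    ∫⁻ s in Ioo 0 T₀, eLpNorm (F s) 2 (wMeasure γ) ^ 2

/-- A priori estimates at almost every time. -/
lemma exists_ae_apriori {γ : ℝ} (hγ : 0 < γ) (hγ2 : γ ≤ 2) : ∃ C : ℝ≥0, 1 ≤ C ∧
    ∀ T u₀ F b u Du p, 0 < T → IsADSolution γ T u₀ F b u Du p → ∀ C₀ : ℝ≥0,
    (∀ᵐ t ∂(volume.restrict (Ioo 0 T)), eLpNorm (b t) 3 (wMeasure (3 * γ / 2)) ≤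
      C₀ * eLpNorm (u t) 3 (wMeasure (3 * γ / 2))) →
    ∀ T₀, 0 < T₀ → T₀ < T →
    C * (1 + (C₀ : ℝ≥0∞) ^ 4) * dataSize γ u₀ F C₀ T₀ ^ 2 * ENNReal.ofReal T₀ ≤ 1 →
    ∀ᵐ t ∂(volume.restrict (Ioo 0 T₀)),
      wn (γ / 2) 2 (u t) ^ 2 ≤ C * dataSize γ u₀ F C₀ T₀ ∧
      ∫⁻ r in Ioo 0 t, wn (γ / 2) 2 (Du r) ^ 2 ≤ C * dataSize γ u₀ F C₀ T₀ := by
  obtain ⟨c, hc⟩ := exists_energy_gronwall hγ hγ2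
  set κ : ℝ≥0 := (√2 ^ (γ / 2)).toNNReal with hκ
  -- The factor κ² compares the two weights, and 1 + c gathers the initial value and the forcing.
  -- The continuity argument is run with L = Λ K, where K is the size of the data.
  set Λ : ℝ≥0 := κ ^ 2 * (1 + c) with hΛ
  have hκ0 : 0 < κ := Real.toNNReal_pos.2 (by positivity)
  have hΛ0 : 0 < Λ := by positivity
  -- The summand c (2 + 8Λ²) turns the smallness hypothesis into the one for L = Λ K. The summand 4Λ
  -- gives both final bounds: 2Λ for the energy, and twice that for the dissipation because of its
  -- factor 1/2.
  refine ⟨1 + c * (2 + 8 * Λ ^ 2) + 4 * Λ, by rw [add_assoc]; exact le_self_add,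
    fun T u₀ F b u Du p hT h C₀ hb T₀ hT₀ hT₀T hsmall => ?_⟩
  have hγ' : 0 ≤ γ / 2 := by positivity
  have hres : volume.restrict (Ioo 0 T₀) ≤ volume.restrict (Ioo 0 T) :=
    Measure.restrict_mono (Ioo_subset_Ioo_right hT₀T.le) le_rfl
  have hwn {V : Type} [NormedAddCommGroup V] [NormedSpace ℝ V] (f : E3 → V) :
      wn (γ / 2) 2 f ^ 2 ≤ κ ^ 2 * eLpNorm f 2 (wMeasure γ) ^ 2 := by
    have e1 := eLpNorm_wt_smul_le hγ' two_ne_zero ENNReal.ofNat_ne_top f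
    rw [half_mul_two] at e1
    rw [← mul_pow]
    exact pow_le_pow_left' e1 2
  have hwn' {V : Type} [NormedAddCommGroup V] [NormedSpace ℝ V] (f : E3 → V) :
      eLpNorm f 2 (wMeasure γ) ^ 2 ≤ wn (γ / 2) 2 f ^ 2 := by
    have e1 := eLpNorm_wMeasure_le hγ' two_ne_zero ENNReal.ofNat_ne_top f
    rw [half_mul_two] at e1
    exact pow_le_pow_left' e1 2
  have hKfin : dataSize γ u₀ F C₀ T₀ ≠ ⊤ := by
    have h1 : ∫⁻ s in Ioo 0 T₀, eLpNorm (F s) 2 (wMeasure γ) ^ 2 < ⊤ :=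
      (lintegral_mono' hres fun s => hwn' (F s)).trans_lt (h.isSquareIntegrable_F hγ).lintegral_lt_top
    have h2 := h.u₀_mem.2
    rw [dataSize]
    finiteness
  have hK1 : 1 ≤ dataSize γ u₀ F C₀ T₀ := by
    rw [dataSize, add_assoc, add_assoc]; exact le_self_add
  have hdata : wn (γ / 2) 2 u₀ ^ 2 + c * ∫⁻ r in Ioo 0 T₀, wn (γ / 2) 2 (F r) ^ 2 ≤
      Λ * dataSize γ u₀ F C₀ T₀ := by
    have h1 : ∫⁻ r in Ioo 0 T₀, wn (γ / 2) 2 (F r) ^ 2 ≤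
        κ ^ 2 * ∫⁻ s in Ioo 0 T₀, eLpNorm (F s) 2 (wMeasure γ) ^ 2 := by
      rw [← lintegral_const_mul' _ _ (by finiteness)]
      exact lintegral_mono fun s => hwn (F s)
    calc _ ≤ κ ^ 2 * eLpNorm u₀ 2 (wMeasure γ) ^ 2 +
          c * (κ ^ 2 * ∫⁻ s in Ioo 0 T₀, eLpNorm (F s) 2 (wMeasure γ) ^ 2) := by
          gcongr
          exact hwn u₀
      _ ≤ κ ^ 2 * dataSize γ u₀ F C₀ T₀ + c * (κ ^ 2 * dataSize γ u₀ F C₀ T₀) := by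
          gcongr
          · rw [dataSize]; exact le_add_self.trans le_self_add
          · rw [dataSize]; exact le_add_self
      _ = _ := by rw [hΛ]; push_cast; ring
  obtain ⟨m, hm⟩ := h.exists_bound hγ
  have hm' := ae_mono hres hm
  have hNm : AEMeasurable (fun t => wn (γ / 2) 2 (u t)) (volume.restrict (Ioo 0 T₀)) :=
    (h.isSquareIntegrable_u hγ).aemeasurable.mono_measure hres
  generalize hKdef : dataSize γ u₀ F C₀ T₀ = K at *
  lift K to ℝ≥0 using hKfin
  set y : ℝ → ℝ := fun t => (wn (γ / 2) 2 (u t)).toReal ^ 2 with hy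
  have hy0 (t : ℝ) : 0 ≤ y t := by positivity
  have hNy : ∀ᵐ t ∂(volume.restrict (Ioo 0 T₀)), wn (γ / 2) 2 (u t) ^ 2 = ENNReal.ofReal (y t) := by
    filter_upwards [hm'] with t ht
    rw [hy, ENNReal.ofReal_pow ENNReal.toReal_nonneg, ENNReal.ofReal_toReal
      (ht.trans_lt ENNReal.coe_lt_top).ne]
  have hint : IntegrableOn (fun r => y r + (C₀ : ℝ) ^ 4 * y r ^ 3) (Icc 0 T₀) := by
    rw [integrableOn_Icc_iff_integrableOn_Ioo]
    have hym : AEStronglyMeasurable y (volume.restrict (Ioo 0 T₀)) :=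
      (hNm.ennreal_toReal.pow_const 2).aestronglyMeasurable
    have hyb : ∀ᵐ t ∂(volume.restrict (Ioo 0 T₀)), y t ≤ (m : ℝ) ^ 2 := by
      filter_upwards [hm'] with t ht
      exact pow_le_pow_left₀ ENNReal.toReal_nonneg (ENNReal.toReal_mono ENNReal.coe_ne_top ht) 2
    refine Integrable.of_bound (hym.add ((hym.pow 3).const_mul _))
      ((m : ℝ) ^ 2 + (C₀ : ℝ) ^ 4 * ((m : ℝ) ^ 2) ^ 3) ?_
    filter_upwards [hyb] with t ht
    rw [Real.norm_of_nonneg (by have := hy0 t; positivity)]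
    exact add_le_add ht (mul_le_mul_of_nonneg_left (pow_le_pow_left₀ (hy0 t) ht 3) (by positivity))
  have hlin (t : ℝ) (ht : t ∈ Ioo 0 T₀) : ∫⁻ r in Ioo 0 t, (wn (γ / 2) 2 (u r) ^ 2 +
      C₀ ^ 4 * wn (γ / 2) 2 (u r) ^ 6) =
      ENNReal.ofReal (∫ r in (0)..t, (y r + (C₀ : ℝ) ^ 4 * y r ^ 3)) := by
    have hrt : volume.restrict (Ioo 0 t) ≤ volume.restrict (Ioo 0 T₀) :=
      Measure.restrict_mono (Ioo_subset_Ioo_right ht.2.le) le_rfl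
    rw [intervalIntegral.integral_of_le ht.1.le, integral_Ioc_eq_integral_Ioo,
      ofReal_integral_eq_lintegral_ofReal
        (hint.mono_set (Ioo_subset_Icc_self.trans (Icc_subset_Icc_right ht.2.le)))
        (Eventually.of_forall fun r => by have := hy0 r; positivity)]
    refine lintegral_congr_ae ?_
    filter_upwards [ae_mono hrt hNy] with r hr
    rw [show wn (γ / 2) 2 (u r) ^ 6 = (wn (γ / 2) 2 (u r) ^ 2) ^ 3 by ring, hr,
      ENNReal.ofReal_add (hy0 r) (by have := hy0 r; positivity),
      ENNReal.ofReal_mul (by positivity), ENNReal.ofReal_pow (hy0 r),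
      ENNReal.ofReal_pow C₀.coe_nonneg, ENNReal.ofReal_coe_nnreal]
  have hI0 {t : ℝ} (ht : 0 ≤ t) : 0 ≤ ∫ r in (0)..t, (y r + (C₀ : ℝ) ^ 4 * y r ^ 3) :=
    intervalIntegral.integral_nonneg ht fun r _ => by have := hy0 r; positivity
  have hgron : ∀ᵐ t ∂(volume.restrict (Ioo 0 T₀)),
      wn (γ / 2) 2 (u t) ^ 2 + 2⁻¹ * ∫⁻ r in Ioo 0 t, wn (γ / 2) 2 (Du r) ^ 2 ≤
      ENNReal.ofReal (Λ * K + c * ∫ r in (0)..t, (y r + (C₀ : ℝ) ^ 4 * y r ^ 3)) := by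
    filter_upwards [ae_mono hres (hc T u₀ F b u Du p hT h C₀ hb), ae_restrict_mem measurableSet_Ioo]
      with t ht htT
    refine ht.trans ?_
    have hrt : volume.restrict (Ioo 0 t) ≤ volume.restrict (Ioo 0 T₀) :=
      Measure.restrict_mono (Ioo_subset_Ioo_right htT.2.le) le_rfl
    have hmm : AEMeasurable (fun r => wn (γ / 2) 2 (u r) ^ 2 +
        (C₀ : ℝ≥0∞) ^ 4 * wn (γ / 2) 2 (u r) ^ 6) (volume.restrict (Ioo 0 t)) :=
      ((hNm.pow_const 2).add ((hNm.pow_const 6).const_mul _)).mono_measure hrt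
    rw [lintegral_add_left' hmm, hlin t htT, ENNReal.ofReal_add (by positivity)
      (mul_nonneg c.coe_nonneg (hI0 htT.1.le)), ENNReal.ofReal_mul c.coe_nonneg,
      ENNReal.ofReal_mul Λ.coe_nonneg, ENNReal.ofReal_coe_nnreal, ENNReal.ofReal_coe_nnreal,
      ENNReal.ofReal_coe_nnreal]
    calc _ = (wn (γ / 2) 2 u₀ ^ 2 + c * ∫⁻ r in Ioo 0 t, wn (γ / 2) 2 (F r) ^ 2) +
          c * ENNReal.ofReal (∫ r in (0)..t, (y r + (C₀ : ℝ) ^ 4 * y r ^ 3)) := by ring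
      _ ≤ _ := by
          gcongr
          refine le_trans ?_ hdata
          gcongr
  have hsm : (c : ℝ) * (T₀ * (2 * (Λ * K) + (C₀ : ℝ) ^ 4 * (2 * (Λ * K)) ^ 3)) < Λ * K := by
    have hK1' : (1 : ℝ) ≤ K := by exact_mod_cast hK1
    have hs : (1 + c * (2 + 8 * Λ ^ 2) + 4 * Λ : ℝ) * (1 + (C₀ : ℝ) ^ 4) * K ^ 2 * T₀ ≤ 1 := by
      have h1 := ENNReal.toReal_mono ENNReal.one_ne_top hsmall
      rw [ENNReal.toReal_mul, ENNReal.toReal_ofReal hT₀.le] at h1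
      exact_mod_cast h1
    have hΛp : (0 : ℝ) < Λ := hΛ0
    have hX : 0 < (1 + (C₀ : ℝ) ^ 4) * K ^ 2 * T₀ := by positivity
    have hlt : (c : ℝ) * (2 + 8 * Λ ^ 2) * ((1 + (C₀ : ℝ) ^ 4) * K ^ 2 * T₀) < 1 := by
      nlinarith [mul_pos hΛp hX]
    have hC4 : (0 : ℝ) ≤ (C₀ : ℝ) ^ 4 := by positivity
    -- Dividing 2L + C₀⁴ (2L)³ by L = Λ K leaves 2 + 8 C₀⁴ Λ² K². Since K ≥ 1, this fits under a
    -- multiple of (1 + C₀⁴) K², the form of the hypothesis on T₀.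
    have hle : 2 + 8 * (C₀ : ℝ) ^ 4 * Λ ^ 2 * K ^ 2 ≤
        (2 + 8 * Λ ^ 2) * ((1 + (C₀ : ℝ) ^ 4) * K ^ 2) := by
      have hK2 : (1 : ℝ) ≤ K ^ 2 := one_le_pow₀ hK1'
      have h8 : (0 : ℝ) ≤ 8 * Λ ^ 2 * K ^ 2 := by positivity
      nlinarith [mul_nonneg hC4 (sq_nonneg (K : ℝ))]
    calc (c : ℝ) * (T₀ * (2 * (Λ * K) + (C₀ : ℝ) ^ 4 * (2 * (Λ * K)) ^ 3)) =
        (c * (2 + 8 * (C₀ : ℝ) ^ 4 * Λ ^ 2 * K ^ 2) * T₀) * (Λ * K) := by ring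
      _ ≤ (c * ((2 + 8 * Λ ^ 2) * ((1 + (C₀ : ℝ) ^ 4) * K ^ 2)) * T₀) * (Λ * K) := by gcongr
      _ = (c * (2 + 8 * Λ ^ 2) * ((1 + (C₀ : ℝ) ^ 4) * K ^ 2 * T₀)) * (Λ * K) := by ring
      _ < 1 * (Λ * K) := by gcongr
      _ = _ := one_mul _
  have hyg : ∀ᵐ t ∂(volume.restrict (Ioo 0 T₀)),
      y t ≤ Λ * K + c * ∫ r in (0)..t, (y r + (C₀ : ℝ) ^ 4 * y r ^ 3) := by
    filter_upwards [hgron, hNy, ae_restrict_mem measurableSet_Ioo] with t h1 h2 h3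
    have h4 := le_self_add.trans h1
    rw [h2] at h4
    exact (ENNReal.ofReal_le_ofReal_iff (add_nonneg (by positivity)
      (mul_nonneg c.coe_nonneg (hI0 h3.1.le)))).1 h4
  have hfin := mul_integral_le_of_small hT₀ c.coe_nonneg (by positivity) (by positivity) hy0 hint
    hyg hsm
  filter_upwards [hgron, ae_restrict_mem measurableSet_Ioo] with t h1 h2
  have h3 : wn (γ / 2) 2 (u t) ^ 2 + 2⁻¹ * ∫⁻ r in Ioo 0 t, wn (γ / 2) 2 (Du r) ^ 2 ≤
      2 * Λ * K := by
    -- The data and the integral term each contribute at most Λ K.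
    refine h1.trans ((ENNReal.ofReal_le_ofReal (add_le_add le_rfl (hfin t ⟨h2.1.le, h2.2.le⟩))).trans
      (le_of_eq ?_))
    rw [← two_mul, ← mul_assoc, ENNReal.ofReal_mul (by positivity), ENNReal.ofReal_mul (by positivity)]
    simp
  constructor
  · refine (le_self_add.trans h3).trans ?_
    push_cast
    gcongr
    calc (2 : ℝ≥0∞) * Λ ≤ 4 * Λ := by gcongr; norm_num
      _ ≤ _ := le_add_self
  · have h4 : 2⁻¹ * ∫⁻ r in Ioo 0 t, wn (γ / 2) 2 (Du r) ^ 2 ≤ 2 * Λ * K := le_add_self.trans h3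
    calc ∫⁻ r in Ioo 0 t, wn (γ / 2) 2 (Du r) ^ 2 =
        2 * (2⁻¹ * ∫⁻ r in Ioo 0 t, wn (γ / 2) 2 (Du r) ^ 2) := by
          rw [← mul_assoc, ENNReal.mul_inv_cancel two_ne_zero ENNReal.ofNat_ne_top, one_mul]
      _ ≤ 2 * (2 * Λ * K) := by gcongr
      _ = 4 * Λ * K := by ring
      _ ≤ _ := by
          push_cast
          gcongr
          exact le_add_self

/-! ### From almost every time to every time. -/

lemma enorm_integral_inner_self {δ : ℝ} {f : E3 → E3} (hf : MemLp f 2 (wMeasure δ)) :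
    ‖∫ x, inner ℝ (f x) (f x) ∂(wMeasure δ)‖ₑ = eLpNorm f 2 (wMeasure δ) ^ 2 := by
  simp_rw [real_inner_self_eq_norm_sq]
  rw [Real.enorm_of_nonneg (integral_nonneg fun x => by positivity),
    ofReal_integral_eq_lintegral_ofReal hf.norm.integrable_sq
      (Eventually.of_forall fun x => by positivity)]
  have h := eLpNorm_nnreal_pow_eq_lintegral (f := f) (μ := wMeasure δ) (p := 2) two_ne_zero
  simp only [ENNReal.coe_ofNat, NNReal.coe_ofNat, ENNReal.rpow_ofNat] at h
  rw [h]
  refine lintegral_congr fun x => ?_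
  rw [ENNReal.ofReal_pow (norm_nonneg _), ofReal_norm]

lemma enorm_integral_inner_le {δ : ℝ} {f g : E3 → E3} (hf : MemLp f 2 (wMeasure δ))
    (hg : MemLp g 2 (wMeasure δ)) : ‖∫ x, inner ℝ (f x) (g x) ∂(wMeasure δ)‖ₑ ≤
      eLpNorm f 2 (wMeasure δ) * eLpNorm g 2 (wMeasure δ) := by
  refine (enorm_integral_le_lintegral_enorm _).trans (le_trans (lintegral_mono fun x => ?_)
    (lintegral_enorm_mul_le holderConjugate_two_two hf.1 hg.1))
  rw [← ofReal_norm, ← ofReal_norm, ← ofReal_norm, ← ENNReal.ofReal_mul (norm_nonneg _)]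
  exact ENNReal.ofReal_le_ofReal (norm_inner_le_norm _ _)

/-- Weak lower semicontinuity of the energy along the solution. -/
lemma IsADSolution.eLpNorm_sq_le {γ T : ℝ} {u₀ : E3 → E3} {F : ℝ → E3 → Tensor3} {b u : ℝ → E3 → E3}
    {Du : ℝ → E3 → Tensor3} {p : ℝ → E3 → ℝ} (h : IsADSolution γ T u₀ F b u Du p) {R : ℝ≥0∞}
    {s : ℕ → ℝ} {t : ℝ} (ht : t ∈ Ico 0 T) (hs : ∀ n, s n ∈ Ico 0 T)
    (hst : Tendsto s atTop (𝓝 t)) (hR : ∀ n, eLpNorm (u (s n)) 2 (wMeasure γ) ^ 2 ≤ R) :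
    eLpNorm (u t) 2 (wMeasure γ) ^ 2 ≤ R := by
  have hut := h.slice_mem t ht
  -- Weak continuity is tested against u(t) itself: the pairings of u(s_n) with u(t) tend to
  -- ‖u(t)‖². Cauchy–Schwarz then gives ‖u(t)‖⁴ ≤ R ‖u(t)‖², and it remains to divide.
  have hlim := ((h.weak_cont (u t) hut t ht).tendsto.comp
    (tendsto_nhdsWithin_iff.2 ⟨hst, Eventually.of_forall hs⟩)).enorm
  rw [enorm_integral_inner_self hut] at hlim
  have hsq := ((ENNReal.continuous_pow 2).tendsto _).comp hlim
  have hle := le_of_tendsto hsq (Eventually.of_forall fun n => show _ ≤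
    R * eLpNorm (u t) 2 (wMeasure γ) ^ 2 from
    (pow_le_pow_left' (enorm_integral_inner_le (h.slice_mem _ (hs n)) hut) 2).trans (by
      rw [mul_pow]; exact mul_le_mul' (hR n) le_rfl))
  by_cases h0 : eLpNorm (u t) 2 (wMeasure γ) ^ 2 = 0
  · rw [h0]; exact zero_le
  · rw [sq (eLpNorm (u t) 2 (wMeasure γ) ^ 2)] at hle
    exact (ENNReal.mul_le_mul_iff_left h0 (ENNReal.pow_ne_top hut.2.ne)).1 hle

lemma lintegral_Ioo_le_of_frequently {f : ℝ → ℝ≥0∞} {T₀ : ℝ} {R : ℝ≥0∞} (hT₀ : 0 < T₀)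
    (h : ∀ᵐ t ∂(volume.restrict (Ioo 0 T₀)), ∫⁻ r in Ioo 0 t, f r ≤ R) :
    ∫⁻ r in Ioo 0 T₀, f r ≤ R := by
  have hU : Ioo 0 T₀ ⊆ ⋃ m : ℕ, Ioo 0 (T₀ - T₀ / (m + 2)) := fun r hr => by
    obtain ⟨m, hm⟩ := exists_nat_gt (T₀ / (T₀ - r))
    have h1 : 0 < T₀ - r := sub_pos.2 hr.2
    refine mem_iUnion.2 ⟨m, hr.1, ?_⟩
    rw [lt_sub_comm, div_lt_iff₀ (by positivity)]
    rw [div_lt_iff₀ h1] at hm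
    nlinarith
  have hdir : Directed (· ⊆ ·) fun m : ℕ => Ioo 0 (T₀ - T₀ / (m + 2)) := by
    refine Monotone.directed_le fun m k hmk => Ioo_subset_Ioo_right ?_
    gcongr
  refine (lintegral_mono_set hU).trans ?_
  rw [setLIntegral_iUnion_of_directed _ hdir]
  refine iSup_le fun m => ?_
  have h1 : T₀ / (m + 2) < T₀ := div_lt_self hT₀ (by linarith [show (0 : ℝ) ≤ m by positivity])
  obtain ⟨t, ht, hR⟩ := exists_mem_Ioo_of_ae (a := T₀ - T₀ / (m + 2)) (b := T₀) (by linarith)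
    (sub_lt_self _ (by positivity)) le_rfl h
  exact (lintegral_mono_set (Ioo_subset_Ioo_right ht.1.le)).trans hR

end WeightedNS

end

theorem mainTheorem9 (γ : ℝ) (hγ0 : 0 < γ) (hγ2 : γ ≤ 2) :
    ∃ C : ℝ≥0, 1 ≤ C ∧
      ∀ (T : ℝ), 0 < T →
      ∀ (u₀ : WeightedNS.E3 → WeightedNS.E3)
        (F : ℝ → WeightedNS.E3 → WeightedNS.Tensor3)
        (b u : ℝ → WeightedNS.E3 → WeightedNS.E3)
        (Du : ℝ → WeightedNS.E3 → WeightedNS.Tensor3)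
        (p : ℝ → WeightedNS.E3 → ℝ),
      WeightedNS.IsADSolution γ T u₀ F b u Du p →
      ∀ (C₀ : ℝ≥0),
      (∀ᵐ t ∂(volume.restrict (Ioo 0 T)),
        eLpNorm (b t) 3 (WeightedNS.wMeasure (3 * γ / 2)) ≤
          C₀ * eLpNorm (u t) 3 (WeightedNS.wMeasure (3 * γ / 2))) →
      ∀ (T₀ : ℝ), 0 < T₀ → T₀ < T →
      C * (1 + (C₀ : ℝ≥0∞) ^ 4) *
          (1 + (C₀ : ℝ≥0∞) ^ 4 + eLpNorm u₀ 2 (WeightedNS.wMeasure γ) ^ 2 +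
            ∫⁻ s in Ioo 0 T₀, eLpNorm (F s) 2 (WeightedNS.wMeasure γ) ^ 2) ^ 2 *
          ENNReal.ofReal T₀ ≤ 1 →
      (⨆ t ∈ Icc 0 T₀, eLpNorm (u t) 2 (WeightedNS.wMeasure γ) ^ 2) ≤
          C * (1 + (C₀ : ℝ≥0∞) ^ 4 + eLpNorm u₀ 2 (WeightedNS.wMeasure γ) ^ 2 +
            ∫⁻ s in Ioo 0 T₀, eLpNorm (F s) 2 (WeightedNS.wMeasure γ) ^ 2) ∧
      (∫⁻ s in Ioo 0 T₀, eLpNorm (Du s) 2 (WeightedNS.wMeasure γ) ^ 2) ≤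
          C * (1 + (C₀ : ℝ≥0∞) ^ 4 + eLpNorm u₀ 2 (WeightedNS.wMeasure γ) ^ 2 +
            ∫⁻ s in Ioo 0 T₀, eLpNorm (F s) 2 (WeightedNS.wMeasure γ) ^ 2) := by
  obtain ⟨C, hC1, hC⟩ := WeightedNS.exists_ae_apriori hγ0 hγ2
  refine ⟨C, hC1, fun T hT u₀ F b u Du p h C₀ hb T₀ hT₀ hT₀T hsmall => ?_⟩
  have hae := hC T u₀ F b u Du p hT h C₀ hb T₀ hT₀ hT₀T hsmall
  have hwn {V : Type} [NormedAddCommGroup V] [NormedSpace ℝ V] (f : WeightedNS.E3 → V) :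
      eLpNorm f 2 (WeightedNS.wMeasure γ) ^ 2 ≤ WeightedNS.wn (γ / 2) 2 f ^ 2 := by
    have e1 := WeightedNS.eLpNorm_wMeasure_le (a := γ / 2) (by positivity) two_ne_zero
      ENNReal.ofNat_ne_top f
    rw [WeightedNS.half_mul_two] at e1
    exact pow_le_pow_left' e1 2
  change _ ≤ C * WeightedNS.dataSize γ u₀ F C₀ T₀ ∧ _ ≤ C * WeightedNS.dataSize γ u₀ F C₀ T₀
  constructor
  · refine iSup₂_le fun t ht => ?_
    have htT : t ∈ Ico 0 T := ⟨ht.1, ht.2.trans_lt hT₀T⟩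
    rcases ht.1.eq_or_lt with rfl | ht0
    -- At time 0 the norm is that of the initial value, which is one of the summands of the data,
    -- and C ≥ 1.
    · rw [eLpNorm_congr_ae ((WeightedNS.wMeasure_absolutelyContinuous_volume γ).ae_le h.initial)]
      refine le_trans ?_ (le_mul_of_one_le_left' (by exact_mod_cast hC1))
      rw [WeightedNS.dataSize]
      exact le_add_self.trans le_self_add
    -- Good times are taken to the left of t, since at t = T₀ the almost everywhere bound is
    -- available on that side only.
    · have hs (n : ℕ) := WeightedNS.exists_mem_Ioo_of_ae (a := t - t / (n + 2)) (b := t)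
        (sub_nonneg.2 (div_le_self ht0.le (by linarith [show (0 : ℝ) ≤ n by positivity])))
        (sub_lt_self _ (by positivity)) ht.2 hae
      choose s hs1 hs2 using hs
      have hlim : Tendsto (fun n : ℕ => t - t / ((n : ℝ) + 2)) atTop (𝓝 t) := by
        have h1 : Tendsto (fun n : ℕ => t / ((n : ℝ) + 2)) atTop (𝓝 0) :=
          tendsto_const_nhds.div_atTop
            (tendsto_atTop_add_const_right _ _ tendsto_natCast_atTop_atTop)
        simpa using h1.const_sub t
      have hs0 (n : ℕ) : 0 ≤ s n := by
        have : t / ((n : ℝ) + 2) ≤ t :=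
          div_le_self ht0.le (by linarith [show (0 : ℝ) ≤ n by positivity])
        linarith [(hs1 n).1]
      refine h.eLpNorm_sq_le htT (fun n => ⟨hs0 n, (hs1 n).2.trans htT.2⟩)
        (tendsto_of_tendsto_of_tendsto_of_le_of_le hlim tendsto_const_nhds
          (fun n => (hs1 n).1.le) (fun n => (hs1 n).2.le)) fun n => ?_
      exact (hwn _).trans (hs2 n).1
  · refine (lintegral_mono fun s => hwn (Du s)).trans ?_
    exact WeightedNS.lintegral_Ioo_le_of_frequently hT₀ (hae.mono fun t ht => ht.2)
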